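/- **Setting.** Let $\omega\subset\mathbb{R}^2$ be open and connected, and let $\gamma=b([\alpha,\beta])\subset\overline\omega$ be a simple (possibly closed) piecewise $C^1$ curve parametrized by arclength by $b$, such that $\omega\setminus\gamma=\omega_1\cup\omega_2$ with two disjoint bounded Lipschitz domains $\omega_1,\omega_2$. Let $$V=\{v\in H^2(\omega\setminus\gamma;\mathbb{R}^3)\cap W^{1,\infty}(\omega;\mathbb{R}^3):(\nabla v)^{\sf T}\nabla v=I_{2\times2}\text{ a.e.}\},\qquad I(v)=\frac12\int_{\omega\setminus\gamma}|D^2v|^2\,dx .$$ For each $m\in\mathbb{N}$ let $\alpha=t_0<\dots<t_{N}=\beta$ (with $N=N_m$) be a partition, and let $c_i=b(t_i)$ be the vertices of the corresponding polygonal crease line $\gamma_m$. Let $\mathcal{T}_m$ be a finite conforming triangulation of $\omega$ (the union of its closed triangles is $\overline\omega$) in which every segment $[c_{i-1},c_i]$ is an edge. Assume that the triangulations are uniformly shape-regular and that their maximal mesh-size tends to zero. Let $\widehat\gamma_m$ (the fattened crease line) be a union of triangles of $\mathcal{T}_m$, each of which has one of the segments $[c_{i-1},c_i]$ as an edge, such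 that $\gamma\subset\widehat\gamma_m$, such that the two sets $\widehat\omega_{m,\ell}=\omega_\ell\setminus\widehat\gamma_m$, $\ell=1,2$, are nonempty and connected, and such that every vertex $c_i\in\omega$ belongs to the closure of both of them. Let $\widetilde V_m$ be the set of all $v\in H^2(\omega\setminus\widehat\gamma_m;\mathbb{R}^3)$ with $(\nabla v)^{\sf T}\nabla v=I_{2\times2}$ a.e. that are continuous in the vertices $c_0,\dots,c_{N}$ (i.e., some representative is continuous on $\omega\setminus\widehat\gamma_m$ and extends continuously to these points), and let $$\widetilde I_m(v)=\frac12\int_{\omega\setminus\widehat\gamma_m}|D^2v|^2\,dx .$$ Functions given on $\omega\setminus\widehat\gamma_m$ and their second derivatives are extended by zero to $\omega$ when convergence in $L^2(\omega)$ is considered. **Corollary (Convergence of almost-minimizers).** Let $\delta_m>0$ with $\delta_m\to0$, and let $u_m\in\widetilde V_m$ satisfy $\widetilde I_m(u_m)\le\inf_{v\in\widetilde V_m}\widetilde I_m(v)+\delta_m$ for all $m$. (a) There exist a subsequence $(u_{m_k})$, vectors $a_k\in\mathbb{R}^3$, and a minimizer $u\in V$ of $I$ over $V$ such that $u_{m_k}-a_k\to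 u$ in $L^2(\omega;\mathbb{R}^3)$ and $D^2u_{m_k}\rightharpoonup D^2u$ weakly in $L^2(\omega;\mathbb{R}^{3\times2\times2})$, where $D^2u$ is the Hessian of $u$ on $\omega\setminus\gamma$. (b) If, in addition, $(u_m)$ is bounded in $L^2(\omega;\mathbb{R}^3)$, then there exist a subsequence $(u_{m_k})$ and a minimizer $u\in V$ of $I$ over $V$ such that $u_{m_k}\to u$ in $L^2(\omega;\mathbb{R}^3)$ and $D^2u_{m_k}\rightharpoonup D^2u$ weakly in $L^2(\omega;\mathbb{R}^{3\times2\times2})$. -/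

import Mathlib

open MeasureTheory Filter Topology

/-- The reference plane containing the plate. -/
abbrev Plane := EuclideanSpace ℝ (Fin 2)

/-- The target space of the deformations. -/
abbrev Space3 := EuclideanSpace ℝ (Fin 3)

noncomputable section

/-! ### Weak derivatives and Sobolev classes on open subsets of the plane -/

/-- `g` is a weak partial derivative of `f` in the coordinate direction `j` on the open set `U`:
both are locally integrable on `U` and `∫_U (∂_j φ) f = - ∫_U φ g` for every `φ ∈ C_c^∞(U)`. -/
def IsWeakPartial (U : Set Plane) (j : Fin 2) (f g : Plane → Space3) : Prop :=
  LocallyIntegrableOn f U ∧ LocallyIntegrableOn g U ∧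
    ∀ φ : Plane → ℝ, ContDiff ℝ (⊤ : ℕ∞) φ → HasCompactSupport φ → tsupport φ ⊆ U →
      ∫ x in U, fderiv ℝ φ x (EuclideanSpace.single j 1) • f x = -∫ x in U, φ x • g x

/-- Existence of the weak partial derivative in direction `j` on `U`. -/
def HasWeakPartial (U : Set Plane) (j : Fin 2) (f : Plane → Space3) : Prop :=
  ∃ g, IsWeakPartial U j f g

open Classical in
/-- The weak partial derivative `∂_j f` on `U` (unique almost everywhere on `U`);
it is used only where `HasWeakPartial U j f` holds. -/
def weakPartial (U : Set Plane) (j : Fin 2) (f : Plane → Space3) : Plane → Space3 :=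
  if h : HasWeakPartial U j f then Classical.choose h else 0

/-- The entry `∂_k ∂_j f` of the weak Hessian of `f` on `U`. -/
def weakHess (U : Set Plane) (f : Plane → Space3) (j k : Fin 2) : Plane → Space3 :=
  weakPartial U k (weakPartial U j f)

/-- `f ∈ H²(U; ℝ³)`. -/
def MemH2 (U : Set Plane) (f : Plane → Space3) : Prop :=
  MemLp f 2 (volume.restrict U) ∧
    (∀ j, HasWeakPartial U j f ∧ MemLp (weakPartial U j f) 2 (volume.restrict U)) ∧
    ∀ j k, HasWeakPartial U k (weakPartial U j f) ∧
      MemLp (weakHess U f j k) 2 (volume.restrict U)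

/-- `f ∈ W^{1,∞}(U; ℝ³)`. -/
def MemW1Infty (U : Set Plane) (f : Plane → Space3) : Prop :=
  MemLp f ⊤ (volume.restrict U) ∧
    ∀ j, HasWeakPartial U j f ∧ MemLp (weakPartial U j f) ⊤ (volume.restrict U)

/-- The isometry constraint `(∇f)ᵀ (∇f) = I_{2×2}` almost everywhere in `U`. -/
def IsIsometricOn (U : Set Plane) (f : Plane → Space3) : Prop :=
  ∀ᵐ x ∂(volume.restrict U), ∀ j k : Fin 2,
    inner ℝ (weakPartial U j f x) (weakPartial U k f x) = if j = k then (1 : ℝ) else 0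

/-- The bending energy `½ ∫_U |D²f|²` with the Frobenius norm of the weak Hessian on `U`. -/
def bendingEnergy (U : Set Plane) (f : Plane → Space3) : ℝ :=
  1 / 2 * ∫ x in U, ∑ j : Fin 2, ∑ k : Fin 2, ‖weakHess U f j k x‖ ^ 2

/-! ### Geometry of the plate, the crease line and its fattened polygonal approximations -/

/-- A bounded Lipschitz domain in the plane: a bounded, open, connected set that near each boundary
point is, in suitable Cartesian coordinates, the strict epigraph of a Lipschitz function. -/
def IsLipschitzDomain (Ω : Set Plane) : Prop :=
  IsOpen Ω ∧ IsConnected Ω ∧ Bornology.IsBounded Ω ∧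
    ∀ x ∈ frontier Ω, ∃ r > 0, ∃ R : Plane ≃ₗᵢ[ℝ] Plane, ∃ (L : NNReal) (h : ℝ → ℝ),
      LipschitzWith L h ∧
        ∀ y ∈ Metric.ball x r, y ∈ Ω ↔ h (R (y - x) 0) < R (y - x) 1

/-- `b : [α, β] → ℝ²` is a piecewise `C¹` parametrization by arclength. -/
def IsPiecewiseC1Arclength (b : ℝ → Plane) (α β : ℝ) : Prop :=
  ∃ (n : ℕ) (τ : Fin (n + 1) → ℝ), StrictMono τ ∧ τ 0 = α ∧ τ (Fin.last n) = β ∧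
    ∀ i : Fin n, ContDiffOn ℝ 1 b (Set.Icc (τ i.castSucc) (τ i.succ)) ∧
      ∀ s ∈ Set.Ioo (τ i.castSucc) (τ i.succ), ‖deriv b s‖ = 1

/-- A plate `ω` with a crease line `γ = b([α, β])`: a simple (possibly closed) piecewise `C¹` curve
in the closure of `ω`, parametrized by arclength, that partitions `ω` into two disjoint Lipschitz
domains `sub 0` and `sub 1`. -/
structure CreasedPlate where
  /-- the plate -/
  ω : Set Plane
  /-- left end of the parameter interval -/
  α : ℝ
  /-- right end of the parameter interval -/
  β : ℝ
  /-- arclength parametrization of the crease line -/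
  b : ℝ → Plane
  /-- the two subdomains -/
  sub : Fin 2 → Set Plane
  ω_open : IsOpen ω
  ω_connected : IsConnected ω
  α_lt_β : α < β
  b_arclength : IsPiecewiseC1Arclength b α β
  b_simple : ∀ s ∈ Set.Icc α β, ∀ t ∈ Set.Icc α β, s < t → b s = b t → s = α ∧ t = β
  b_mem : b '' Set.Icc α β ⊆ closure ω
  sub_lipschitz : ∀ l, IsLipschitzDomain (sub l)
  sub_disjoint : Disjoint (sub 0) (sub 1)
  sub_union : ω \ b '' Set.Icc α β = sub 0 ∪ sub 1

/-- The crease line. -/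
def CreasedPlate.γ (P : CreasedPlate) : Set Plane := P.b '' Set.Icc P.α P.β

/-- The set `V` of folded isometries:
`v ∈ H²(ω ∖ γ; ℝ³) ∩ W^{1,∞}(ω; ℝ³)` with `(∇v)ᵀ(∇v) = I`. -/
def CreasedPlate.V (P : CreasedPlate) : Set (Plane → Space3) :=
  {v | MemH2 (P.ω \ P.γ) v ∧ MemW1Infty P.ω v ∧ IsIsometricOn P.ω v}

/-- The functional `I(v) = ½ ∫_{ω∖γ} |D²v|²`. -/
def CreasedPlate.I (P : CreasedPlate) (v : Plane → Space3) : ℝ := bendingEnergy (P.ω \ P.γ) v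

/-- `K` is a (finite, conforming) triangulation of the planar domain `ω`. -/
structure IsTriangulation (K : Geometry.SimplicialComplex ℝ Plane) (ω : Set Plane) : Prop where
  finite : K.faces.Finite
  pure : ∀ s ∈ K.faces, ∃ t ∈ K.faces, s ⊆ t ∧ t.card = 3
  space_eq : K.space = closure ω

/-- A fattened polygonal approximation of the crease line. The vertices `c i = b (t i)` define the
linear interpolant of `b`; its segments are edges of the triangulation `K` of `ω`. The family `F`
consists of triangles of `K` that have one of these segments as an edge. Their union, the fattened
crease line, contains `γ`, and its complement in `ω` consists of the two subdomains `sub l ∖ fat`,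
both of which touch every vertex `c i` in the interior of the plate (so that the continuity
condition in `c i` relates the two sides). -/
structure CreaseApprox (P : CreasedPlate) where
  /-- number of segments of the polygonal crease line -/
  N : ℕ
  /-- parameters of the vertices -/
  t : Fin (N + 1) → ℝ
  /-- the triangulation -/
  K : Geometry.SimplicialComplex ℝ Plane
  /-- the triangles forming the fattened crease line -/
  F : Set (Finset Plane)
  t_strictMono : StrictMono t
  t_zero : t 0 = P.α
  t_last : t (Fin.last N) = P.β
  K_triangulation : IsTriangulation K P.ω
  matching : ∀ i : Fin N, ∃ e ∈ K.faces, (e : Set Plane) = {P.b (t i.castSucc), P.b (t i.succ)}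
  F_faces : ∀ s ∈ F, s ∈ K.faces ∧ s.card = 3
  F_segment : ∀ s ∈ F, ∃ i : Fin N, P.b (t i.castSucc) ∈ s ∧ P.b (t i.succ) ∈ s
  crease_subset : P.γ ⊆ ⋃ s ∈ F, convexHull ℝ (s : Set Plane)
  sub_connected : ∀ l, IsConnected (P.sub l \ ⋃ s ∈ F, convexHull ℝ (s : Set Plane))
  vertex_mem : ∀ i, P.b (t i) ∈ P.ω →
    ∀ l, P.b (t i) ∈ closure (P.sub l \ ⋃ s ∈ F, convexHull ℝ (s : Set Plane))

namespace CreaseApprox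

variable {P : CreasedPlate}

/-- The fattened crease line. -/
def fat (A : CreaseApprox P) : Set Plane := ⋃ s ∈ A.F, convexHull ℝ (s : Set Plane)

/-- The plate without the fattened crease line. -/
def dom (A : CreaseApprox P) : Set Plane := P.ω \ A.fat

/-- The vertices of the polygonal crease line. -/
def vertex (A : CreaseApprox P) (i : Fin (A.N + 1)) : Plane := P.b (A.t i)

/-- The admissible set `Ṽ` of isometries in `H²(ω ∖ fat; ℝ³)` that are continuous in the vertices
of the polygonal crease line, i.e., that have a representative which is continuous on
`ω ∖ fat` and extends continuously to all vertices. -/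
def V (A : CreaseApprox P) : Set (Plane → Space3) :=
  {v | MemH2 A.dom v ∧ IsIsometricOn A.dom v ∧
    ∃ w : Plane → Space3, w =ᵐ[volume.restrict A.dom] v ∧
      ContinuousOn w (A.dom ∪ Set.range A.vertex)}

/-- The approximating functional `Ĩ(v) = ½ ∫_{ω ∖ fat} |D²v|²`. -/
def I (A : CreaseApprox P) (v : Plane → Space3) : ℝ := bendingEnergy A.dom v

end CreaseApprox

/-- Uniform shape regularity: every triangle contains a disk of radius comparable to its
diameter. -/
def ShapeRegular {P : CreasedPlate} (A : ℕ → CreaseApprox P) : Prop :=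
  ∃ κ > 0, ∀ m, ∀ s ∈ (A m).K.faces, s.card = 3 →
    ∃ x, Metric.closedBall x (κ * Metric.diam (s : Set Plane)) ⊆ convexHull ℝ (s : Set Plane)

/-- The maximal mesh-size tends to zero. -/
def MeshSizeVanishes {P : CreasedPlate} (A : ℕ → CreaseApprox P) : Prop :=
  ∀ ε > 0, ∀ᶠ m in atTop, ∀ s ∈ (A m).K.faces, Metric.diam (s : Set Plane) ≤ ε

/-! ### Convergence of functions and Hessians, extended by zero to `ω` -/

/-- `v k → u` in `L²(ω; ℝ³)`, where `v k`, given on `ω ∖ fat`, is extended by zero to `ω`. -/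
def TendstoL2 {P : CreasedPlate} (A : ℕ → CreaseApprox P) (v : ℕ → Plane → Space3)
    (u : Plane → Space3) : Prop :=
  Tendsto (fun k => eLpNorm (fun x => (A k).dom.indicator (v k) x - u x) 2
    (volume.restrict P.ω)) atTop (𝓝 0)

/-- `D² (v k) ⇀ D² u` weakly in `L²(ω; ℝ^{3×2×2})`, where `D² (v k)`, given on `ω ∖ fat`, is
extended by zero to `ω`, and `D² u` is the Hessian of `u` on `ω ∖ γ`. -/
def HessTendstoWeakly {P : CreasedPlate} (A : ℕ → CreaseApprox P) (v : ℕ → Plane → Space3)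
    (u : Plane → Space3) : Prop :=
  ∀ G : Fin 2 → Fin 2 → Plane → Space3, (∀ i j, MemLp (G i j) 2 (volume.restrict P.ω)) →
    Tendsto (fun k => ∫ x in P.ω, ∑ i : Fin 2, ∑ j : Fin 2,
        inner ℝ ((A k).dom.indicator (weakHess (A k).dom (v k) i j) x) (G i j x)) atTop
      (𝓝 (∫ x in P.ω, ∑ i : Fin 2, ∑ j : Fin 2,
        inner ℝ (weakHess (P.ω \ P.γ) u i j x) (G i j x)))

end

/-! No load or boundary condition is imposed, so a single affine isometry is admissible for every
approximation and has zero energy. Hence the energies of almost-minimizers tend to zero, and every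
member of `P.V` with vanishing Hessian off the crease minimizes `P.I`. What has to be shown is
compactness up to translations, and that the limit is one map on the whole plate: an affine isometry
on each subdomain, the two agreeing along the crease.

The only uniform information on the admissible maps is that their continuous representatives are
nonexpansive on balls in their domain (`CreaseApprox.exists_rep`). The domains vary and may be cut
up badly by the triangles, so extension and Poincaré arguments are replaced by an oscillation bound,
`LocNonexpansive.sub_le`: if the points of `V` within distance `g` of the complement have area at
most `A * g`, a locally nonexpansive `f` satisfies `f x - f y ≤ dist x y + 40 * A`. Indeed, since
the plane is simply connected, every value between `f y` and `f x` is attained either on the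
boundary of a slightly smaller domain or on the straight segment (`exists_mem_segment_eq`), and both
images are short. For a Lipschitz domain without the fattened crease line, `A` is controlled by the
Lipschitz boundary and by the sum of the triangle diameters, which shape regularity bounds by the
length of the crease (`sum_diam_le`).

The same bound is used in a box of size `r` around a regular crease point, where `A` is of order
`r`. A barrier argument (`LocalSide.mem_component_top`) shows that points of one side close to the
centre are joined inside the box to a fixed reference point of that side. Continuity at a vertex
near the centre then links the reference points of the two sides with an error of order `r`
(`LocalGraph.exists_link`). With the global bound on each side this yields uniform bounds up to
constants; letting `r` tend to zero, it also yields agreement of the two limits on the crease.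

A subsequence converges pointwise off the crease by an Arzelà–Ascoli argument. Vanishing Hessians
make the limit locally affine, and an integration by parts transfers the isometry constraint
(`exists_isometric_affine_limit`). Connectedness gives one affine isometry per subdomain; glued
together they form an element of `P.V` with zero energy. In part (b) the `L²` bound makes the
subtracted constants bounded, so a further subsequence makes them converge. -/

noncomputable section

/-! ### Intermediate values on planar sets, by lifting circle-valued maps -/

/-- Simple connectedness of the plane enters here: the covering of the circle by the line has no
obstruction to lifting. -/
theorem exists_real_lift (F : Plane → AddCircle (1 : ℝ)) (hF : Continuous F) :
    ∃ G : Plane → ℝ, Continuous G ∧ ∀ x, ((G x : ℝ) : AddCircle (1 : ℝ)) = F x := by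
  obtain ⟨e, he⟩ := QuotientAddGroup.mk_surjective (F 0)
  obtain ⟨G, ⟨-, hG⟩, -⟩ := (AddCircle.isCoveringMap_coe (1 : ℝ)).existsUnique_continuousMap_lifts
    (A := Plane) ⟨F, hF⟩ 0 e he
  exact ⟨G, G.continuous, fun x => congr_fun hG x⟩

/-- Otherwise the intermediate value theorem would produce a half-integer value. This serves to
compare two real lifts of one circle-valued map. -/
theorem IsPreconnected.eq_of_integer_valued {X : Type*} [TopologicalSpace X] {S : Set X}
    (hS : IsPreconnected S) {h : X → ℝ} (hc : ContinuousOn h S)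
    (hz : ∀ z ∈ S, ((h z : ℝ) : AddCircle (1 : ℝ)) = 0) {x y : X} (hx : x ∈ S) (hy : y ∈ S) :
    h x = h y := by
  have hz' : ∀ z ∈ S, ∃ n : ℤ, h z = n := by
    intro z hzS
    obtain ⟨n, hn⟩ := (AddCircle.coe_eq_zero_iff (1 : ℝ)).1 (hz z hzS)
    exact ⟨n, by simpa using hn.symm⟩
  have key : ∀ x ∈ S, ∀ y ∈ S, ¬ h x < h y := by
    intro x hx y hy hlt
    obtain ⟨n, hn⟩ := hz' x hx
    obtain ⟨m, hm⟩ := hz' y hy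
    have hnm : n < m := by rw [hn, hm] at hlt; exact_mod_cast hlt
    have hnm' : (n : ℝ) + 1 ≤ m := by exact_mod_cast hnm
    obtain ⟨z, hzS, hz2⟩ := hS.intermediate_value hx hy hc
      (show (n : ℝ) + 1 / 2 ∈ Set.Icc (h x) (h y) by constructor <;> linarith)
    obtain ⟨k, hk⟩ := hz' z hzS
    rw [hk] at hz2
    have h1 : ((2 * k : ℤ) : ℝ) = ((2 * n + 1 : ℤ) : ℝ) := by push_cast; linarith
    have h2 : 2 * k = 2 * n + 1 := by exact_mod_cast h1
    omega
  exact le_antisymm (not_lt.1 (key y hy x hx)) (not_lt.1 (key x hx y hy))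

/-- A real function on a connected open bounded planar set that avoids the value `t` on the
boundary attains every such intermediate value on the straight segment, even if the segment leaves
the set. -/
theorem exists_mem_segment_eq {V : Set Plane} (hVo : IsOpen V) (hV : IsPreconnected V)
    (hVb : Bornology.IsBounded V) {f : Plane → ℝ} (hf : ContinuousOn f (closure V))
    {x y : Plane} (hx : x ∈ V) (hy : y ∈ V) {t : ℝ} (ht : t ∉ f '' frontier V)
    (hyt : f y < t) (htx : t < f x) : ∃ z ∈ segment ℝ y x, z ∈ V ∧ f z = t := by
  classical
  by_contra hcon
  push Not at hcon
  have hcl : IsCompact (closure V) := hVb.isCompact_closure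
  have hsegc : IsCompact (segment ℝ y x) := by
    rw [segment_eq_image]
    exact isCompact_Icc.image (by fun_prop)
  -- If the claim fails, `f - t` has no zero on `K`, and by compactness `|f - t|` is at least some
  -- `ε > 0` there.
  set K : Set Plane := frontier V ∪ segment ℝ y x ∩ closure V with hK
  have hKc : IsCompact K :=
    (hcl.of_isClosed_subset isClosed_frontier frontier_subset_closure).union
      (hsegc.inter_right isClosed_closure)
  have hKV : K ⊆ closure V := Set.union_subset frontier_subset_closure Set.inter_subset_right
  have hne : ∀ z ∈ K, f z - t ≠ 0 := by
    rintro z (hz | ⟨hz1, hz2⟩) h0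
    · exact ht ⟨z, hz, by linarith⟩
    · by_cases hzV : z ∈ V
      · exact hcon z hz1 hzV (by linarith)
      · exact ht ⟨z, ⟨hz2, by rwa [hVo.interior_eq]⟩, by linarith⟩
  have hxK : x ∈ K := Or.inr ⟨right_mem_segment ℝ y x, subset_closure hx⟩
  have hyK : y ∈ K := Or.inr ⟨left_mem_segment ℝ y x, subset_closure hy⟩
  obtain ⟨z₀, hz₀, hmin⟩ := hKc.exists_isMinOn ⟨x, hxK⟩
    (((hf.mono hKV).sub continuousOn_const).abs)
  set ε := |f z₀ - t| with hε
  have hεpos : 0 < ε := abs_pos.2 (hne z₀ hz₀)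
  have hεle : ∀ z ∈ K, ε ≤ |f z - t| := fun z hz => hmin hz
  -- A ramp that is `0` where `f ≤ t` and `1` where `f ≥ t + ε`. On `K` it takes only these two
  -- values, so modulo `1` it vanishes on the frontier and extends continuously by zero outside `V`.
  set θ : Plane → ℝ := fun z => max 0 (min 1 ((f z - t) / ε)) with hθ
  have hθc : ContinuousOn θ (closure V) := by
    have : ContinuousOn (fun z => (f z - t) / ε) (closure V) :=
      (hf.sub continuousOn_const).div_const ε
    exact (continuous_const.max (continuous_const.min continuous_id)).comp_continuousOn this
  have hθ1 : ∀ z, ε ≤ f z - t → θ z = 1 := by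
    intro z hz
    have : 1 ≤ (f z - t) / ε := by rwa [le_div_iff₀ hεpos, one_mul]
    simp [hθ, this]
  have hθ0 : ∀ z, f z - t ≤ 0 → θ z = 0 := by
    intro z hz
    have : (f z - t) / ε ≤ 0 := div_nonpos_of_nonpos_of_nonneg hz hεpos.le
    simp [hθ, this]
  have hθK : ∀ z ∈ K, ((θ z : ℝ) : AddCircle (1 : ℝ)) = 0 := by
    intro z hz
    rcases le_total 0 (f z - t) with h | h
    · have := hεle z hz
      rw [abs_of_nonneg h] at this
      rw [hθ1 z this]; exact AddCircle.coe_period 1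
    · rw [hθ0 z h]; rfl
  set F : Plane → AddCircle (1 : ℝ) := V.piecewise (fun z => ((θ z : ℝ) : AddCircle (1 : ℝ)))
    (fun _ => 0) with hF
  have hFc : Continuous F := by
    apply continuous_piecewise
    · intro z hz; exact hθK z (Or.inl hz)
    · exact (AddCircle.continuous_mk' 1).comp_continuousOn hθc
    · exact continuousOn_const
  -- On `V` the lift differs from `θ` by a constant, and along the segment it is itself constant
  -- because `F` vanishes there. Together these force `θ x = θ y`, although the values are `1` and
  -- `0`.
  obtain ⟨G, hGc, hG⟩ := exists_real_lift F hFc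
  have h1 : G x - θ x = G y - θ y := by
    refine hV.eq_of_integer_valued (h := fun z => G z - θ z)
      (hGc.continuousOn.sub (hθc.mono subset_closure)) ?_ hx hy
    intro z hz
    rw [AddCircle.coe_sub, hG z, hF, Set.piecewise_eq_of_mem _ _ _ hz, sub_self]
  have h2 : G x = G y := by
    refine (convex_segment (𝕜 := ℝ) y x).isPreconnected.eq_of_integer_valued (h := G)
      hGc.continuousOn ?_ (right_mem_segment ℝ y x) (left_mem_segment ℝ y x)
    intro z hz
    rw [hG z]
    by_cases hzV : z ∈ V
    · rw [hF, Set.piecewise_eq_of_mem _ _ _ hzV]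
      exact hθK z (Or.inr ⟨hz, subset_closure hzV⟩)
    · rw [hF, Set.piecewise_eq_of_notMem _ _ _ hzV]
  have h3 : θ x = 1 := hθ1 x (by
    have := hεle x hxK
    rwa [abs_of_pos (by linarith)] at this)
  have h4 : θ y = 0 := hθ0 y (by linarith)
  linarith

/-! ### Locally nonexpansive maps and their oscillation -/

/-- `f` is nonexpansive on every ball contained in `V`. -/
def LocNonexpansive {E : Type*} [PseudoMetricSpace E] (V : Set Plane) (f : Plane → E) : Prop :=
  ∀ x r, Metric.ball x r ⊆ V → ∀ y ∈ Metric.ball x r, ∀ z ∈ Metric.ball x r,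
    dist (f y) (f z) ≤ dist y z

theorem LocNonexpansive.mono {E : Type*} [PseudoMetricSpace E] {V W : Set Plane} {f : Plane → E}
    (hf : LocNonexpansive W f) (h : V ⊆ W) : LocNonexpansive V f :=
  fun x r hb => hf x r (hb.trans h)

theorem LocNonexpansive.continuousOn {E : Type*} [PseudoMetricSpace E] {V : Set Plane}
    (hV : IsOpen V) {f : Plane → E} (hf : LocNonexpansive V f) : ContinuousOn f V := by
  intro x hx
  obtain ⟨r, hr, hb⟩ := Metric.isOpen_iff.1 hV x hx
  apply ContinuousAt.continuousWithinAt
  rw [Metric.continuousAt_iff]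
  intro ε hε
  refine ⟨min ε r, lt_min hε hr, fun {z} hz => ?_⟩
  exact (hf x r hb z (lt_of_lt_of_le hz (min_le_right _ _)) x (Metric.mem_ball_self hr)).trans_lt
    (lt_of_lt_of_le hz (min_le_left _ _))

theorem LocNonexpansive.dist_base {E : Type*} [PseudoMetricSpace E] {V : Set Plane}
    {f : Plane → E} (hf : LocNonexpansive V f) (p : E) :
    LocNonexpansive V (fun x => dist (f x) p) := by
  intro x r hb y hy z hz
  rw [Real.dist_eq]
  exact (abs_dist_sub_le _ _ _).trans (hf x r hb y hy z hz)

/-- The segment may leave `V`, so `f` is not controlled along all of it. After cutting it into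
pieces shorter than `g`, two points of `W` on the same piece lie in one ball of radius `g` inside
`V`, and the lengths of the images add up to at most that of the segment. -/
theorem volume_image_segment_inter_le {V : Set Plane} {f : Plane → ℝ} (hf : LocNonexpansive V f)
    {g : ℝ} (hg : 0 < g) {W : Set Plane} (hW : ∀ z ∈ W, Metric.ball z g ⊆ V) (x y : Plane) :
    volume (f '' (segment ℝ y x ∩ W)) ≤ ENNReal.ofReal (dist x y) := by
  obtain ⟨N, hN⟩ := exists_nat_gt (dist x y / g)
  have hN0 : (0 : ℝ) < N := lt_of_le_of_lt (by positivity) hN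
  have hNpos : 0 < N := by exact_mod_cast hN0
  have hLN : dist x y / N < g := by
    rw [div_lt_iff₀ hg] at hN
    rw [div_lt_iff₀ hN0]; linarith
  set S : ℕ → Set Plane := fun i =>
    (AffineMap.lineMap y x '' Set.Icc ((i : ℝ) / N) ((i + 1 : ℝ) / N)) ∩ W with hS
  have hcover : f '' (segment ℝ y x ∩ W) ⊆ ⋃ i ∈ Finset.range N, f '' S i := by
    rintro _ ⟨z, ⟨hz, hzW⟩, rfl⟩
    rw [segment_eq_image_lineMap] at hz
    obtain ⟨s, ⟨hs0, hs1⟩, rfl⟩ := hz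
    simp only [Set.mem_iUnion, Finset.mem_range]
    rcases eq_or_lt_of_le hs1 with rfl | hs1
    -- The right endpoint is assigned to the last piece, since the floor would give the index `N`.
    · refine ⟨N - 1, by omega, _, ⟨⟨1, ⟨?_, ?_⟩, rfl⟩, hzW⟩, rfl⟩
      · rw [div_le_one hN0]; exact_mod_cast Nat.sub_le N 1
      · rw [le_div_iff₀ hN0, one_mul, Nat.cast_sub hNpos]; simp
    · refine ⟨⌊s * N⌋₊, ?_, _, ⟨⟨s, ⟨?_, ?_⟩, rfl⟩, hzW⟩, rfl⟩
      · rw [Nat.floor_lt (by positivity)]; nlinarith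
      · rw [div_le_iff₀ hN0]; exact Nat.floor_le (by positivity)
      · rw [le_div_iff₀ hN0]; exact (Nat.lt_floor_add_one _).le
  have hdiam : ∀ i, volume (f '' S i) ≤ ENNReal.ofReal (dist x y / N) := by
    intro i
    refine (Real.volume_le_diam _).trans ?_
    apply Metric.ediam_le
    rintro _ ⟨_, ⟨⟨s, hs, rfl⟩, hsW⟩, rfl⟩ _ ⟨_, ⟨⟨s', hs', rfl⟩, hsW'⟩, rfl⟩
    have hd : dist (AffineMap.lineMap y x s : Plane) (AffineMap.lineMap y x s') ≤ dist x y / N := by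
      rw [dist_lineMap_lineMap, Real.dist_eq, dist_comm y x, mul_comm, div_eq_mul_one_div]
      gcongr
      rw [abs_le]
      have : ((i : ℝ) + 1) / N = i / N + 1 / N := by ring
      rw [this] at hs hs'
      constructor <;> linarith [hs.1, hs.2, hs'.1, hs'.2]
    rw [edist_dist]
    apply ENNReal.ofReal_le_ofReal
    exact (hf _ g (hW _ hsW) _ (Metric.mem_ball_self hg) _
      (by rw [Metric.mem_ball, dist_comm]; linarith)).trans hd
  calc volume (f '' (segment ℝ y x ∩ W)) ≤ ∑ i ∈ Finset.range N, volume (f '' S i) :=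
        (measure_mono hcover).trans (measure_biUnion_finset_le _ _)
    _ ≤ ∑ i ∈ Finset.range N, ENNReal.ofReal (dist x y / N) := Finset.sum_le_sum fun i _ => hdiam i
    _ = ENNReal.ofReal (dist x y) := by
        rw [Finset.sum_const, Finset.card_range, nsmul_eq_mul, ← ENNReal.ofReal_natCast,
          ← ENNReal.ofReal_mul hN0.le]
        congr 1; field_simp

theorem ball_subset_of_lt_infDist_compl {V : Set Plane} {z : Plane} {r : ℝ}
    (h : r ≤ Metric.infDist z Vᶜ) : Metric.ball z r ⊆ V := by
  intro w hw
  by_contra hwV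
  have h1 := Metric.infDist_le_dist_of_mem (x := z) (show w ∈ Vᶜ from hwV)
  have h2 : dist w z < r := hw
  rw [dist_comm] at h2
  linarith

/-- A compact set at depth `g` inside `V` is covered by boundedly many balls in terms of the
collar volume, so that its image under a locally nonexpansive function is short. -/
theorem volume_image_le_of_collar {V : Set Plane} {f : Plane → ℝ} (hf : LocNonexpansive V f)
    {g A : ℝ} (hg : 0 < g) (hA : 0 ≤ A)
    (hcol : volume {z ∈ V | Metric.infDist z Vᶜ ≤ 2 * g} ≤ ENNReal.ofReal (A * (2 * g)))
    {S : Set Plane} (hS : IsCompact S) (hSg : ∀ z ∈ S, Metric.infDist z Vᶜ = g) :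
    volume (f '' S) ≤ ENNReal.ofReal (40 * A) := by
  -- Radius `g / 6` is chosen so that the fivefold Vitali enlargement stays inside the ball of
  -- radius `g`, where `f` is nonexpansive, while the disjoint small balls still lie in the collar
  -- of width `2 * g`.
  obtain ⟨t, htS, htfin, htcov⟩ := hS.finite_cover_balls (show 0 < g / 6 by positivity)
  obtain ⟨u, hut, hdis, hucov⟩ := Vitali.exists_disjoint_subfamily_covering_enlargement_closedBall
    t (fun z => z) (fun _ => g / 6) (g / 6) (fun _ _ => le_rfl) 5 (by norm_num)
  have hufin : u.Finite := htfin.subset hut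
  lift u to Finset Plane using hufin
  have hcov : f '' S ⊆ ⋃ b ∈ u, f '' Metric.closedBall b (5 * (g / 6)) := by
    rintro _ ⟨z, hz, rfl⟩
    obtain ⟨a, ha, hza⟩ := Set.mem_iUnion₂.1 (htcov hz)
    obtain ⟨b, hb, hab⟩ := hucov a ha
    exact Set.mem_iUnion₂.2 ⟨b, hb, z, hab (Metric.ball_subset_closedBall hza), rfl⟩
  have hball : ∀ b ∈ u, volume (f '' Metric.closedBall b (5 * (g / 6))) ≤
      ENNReal.ofReal (5 / 3 * g) := by
    intro b hb
    have hbg : Metric.ball b g ⊆ V :=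
      ball_subset_of_lt_infDist_compl (hSg b (htS (hut hb))).ge
    refine (Real.volume_le_diam _).trans (Metric.ediam_le ?_)
    rintro _ ⟨z, hz, rfl⟩ _ ⟨w, hw, rfl⟩
    rw [edist_dist]
    apply ENNReal.ofReal_le_ofReal
    rw [Metric.mem_closedBall] at hz hw
    have := hf b g hbg z (by rw [Metric.mem_ball]; linarith) w (by rw [Metric.mem_ball]; linarith)
    linarith [dist_triangle_right z w b]
  have hsub : ∀ b ∈ u, Metric.closedBall b (g / 6) ⊆ {z ∈ V | Metric.infDist z Vᶜ ≤ 2 * g} := by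
    intro b hb z hz
    have hbg := hSg b (htS (hut hb))
    rw [Metric.mem_closedBall] at hz
    refine ⟨ball_subset_of_lt_infDist_compl hbg.ge (by rw [Metric.mem_ball]; linarith), ?_⟩
    have := Metric.infDist_le_infDist_add_dist (s := Vᶜ) (x := z) (y := b)
    linarith
  have hcount : (u.card : ℝ) * (Real.pi * (g / 6) ^ 2) ≤ A * (2 * g) := by
    have h1 : ∑ b ∈ u, volume (Metric.closedBall b (g / 6)) ≤ ENNReal.ofReal (A * (2 * g)) := by
      rw [← measure_biUnion_finset (fun i hi j hj hij => hdis hi hj hij)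
        (fun b _ => Metric.isClosed_closedBall.measurableSet)]
      exact (measure_mono (Set.iUnion₂_subset hsub)).trans hcol
    have h2 : ∀ b ∈ u, volume (Metric.closedBall b (g / 6)) =
        ENNReal.ofReal (Real.pi * (g / 6) ^ 2) := by
      intro b _
      rw [EuclideanSpace.volume_closedBall_fin_two, ← ENNReal.ofReal_pow (by positivity),
        mul_comm, ENNReal.ofReal_mul Real.pi_pos.le]
    rw [Finset.sum_congr rfl h2, Finset.sum_const, nsmul_eq_mul, ← ENNReal.ofReal_natCast,
      ← ENNReal.ofReal_mul (by positivity)] at h1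
    exact (ENNReal.ofReal_le_ofReal_iff (by positivity)).1 h1
  calc volume (f '' S) ≤ ∑ b ∈ u, volume (f '' Metric.closedBall b (5 * (g / 6))) :=
        (measure_mono hcov).trans (measure_biUnion_finset_le _ _)
    _ ≤ ∑ b ∈ u, ENNReal.ofReal (5 / 3 * g) := Finset.sum_le_sum hball
    _ = ENNReal.ofReal (u.card * (5 / 3 * g)) := by
        rw [Finset.sum_const, nsmul_eq_mul, ← ENNReal.ofReal_natCast,
          ← ENNReal.ofReal_mul (by positivity)]
    _ ≤ ENNReal.ofReal (40 * A) := by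
        apply ENNReal.ofReal_le_ofReal
        -- Using `π ≥ 3`, the number of balls times `g` is at most `24 * A`; each image has length
        -- at most `5 / 3 * g`, and `24 * 5 / 3 = 40`.
        have h3 : (u.card : ℝ) * 3 * (g / 6) ^ 2 ≤ A * (2 * g) := by
          refine le_trans ?_ hcount
          have := Real.pi_gt_three.le
          rw [mul_assoc]
          gcongr
        have h4 : (u.card : ℝ) * g ≤ 24 * A := by
          have : g * ((u.card : ℝ) * g) ≤ g * (24 * A) := by nlinarith
          exact le_of_mul_le_mul_left this hg
        linarith

/-- Oscillation bound: a locally nonexpansive function on a connected bounded planar domain, whose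
collar of width `g` has area at most `A g`, oscillates at most by a multiple of `A` in addition to
the distance. -/
theorem LocNonexpansive.sub_le {V : Set Plane} (hVo : IsOpen V) (hV : IsPreconnected V)
    (hVb : Bornology.IsBounded V) {f : Plane → ℝ} (hf : LocNonexpansive V f) {A g₀ : ℝ}
    (hA : 0 ≤ A) (hg₀ : 0 < g₀)
    (hcol : ∀ g, 0 < g → g < g₀ →
      volume {z ∈ V | Metric.infDist z Vᶜ ≤ g} ≤ ENNReal.ofReal (A * g))
    {x y : Plane} (hx : x ∈ V) (hy : y ∈ V) : f x - f y ≤ dist x y + 40 * A := by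
  have hVc : (Vᶜ : Set Plane).Nonempty := by
    rw [Set.nonempty_compl]
    rintro rfl
    exact NormedSpace.unbounded_univ ℝ Plane hVb
  have hcont : Continuous fun z => Metric.infDist z Vᶜ := Metric.continuous_infDist_pt _
  have hpos : ∀ z ∈ V, 0 < Metric.infDist z Vᶜ := fun z hz =>
    (hVo.isClosed_compl.notMem_iff_infDist_pos hVc).1 (by simpa using hz)
  have hpath : IsPathConnected V := (hVo.isConnected_iff_isPathConnected).1 ⟨⟨x, hx⟩, hV⟩
  obtain ⟨σ, hσ⟩ := hpath.joinedIn x hx y hy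
  have hσc : IsCompact (Set.range σ) := isCompact_range σ.continuous
  obtain ⟨z₀, ⟨s₀, rfl⟩, hz₀⟩ := hσc.exists_isMinOn ⟨x, 0, σ.source⟩ hcont.continuousOn
  have hd := hpos _ (hσ s₀)
  set d := Metric.infDist (σ s₀) Vᶜ with hdd
  -- The path from `x` to `y` has positive depth `d` in `V`. Below this depth `x` and `y` stay in
  -- one component `W` of the deep part; the covering argument needs the collar of width `2 * g`.
  obtain ⟨g, hg, hgd, hgg⟩ : ∃ g, 0 < g ∧ g < d ∧ 2 * g < g₀ :=
    ⟨min (d / 2) (g₀ / 4), by positivity, by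
      have := min_le_left (d / 2) (g₀ / 4); linarith, by
      have := min_le_right (d / 2) (g₀ / 4); linarith⟩
  set Vg : Set Plane := {z | g < Metric.infDist z Vᶜ} with hVg
  have hVgo : IsOpen Vg := isOpen_lt continuous_const hcont
  have hσg : Set.range σ ⊆ Vg := by
    rintro _ ⟨s, rfl⟩
    exact lt_of_lt_of_le hgd (hz₀ ⟨s, rfl⟩)
  have hxg : x ∈ Vg := hσg ⟨0, σ.source⟩
  set W := connectedComponentIn Vg x with hW
  have hWo : IsOpen W := hVgo.connectedComponentIn
  have hWp : IsPreconnected W := isPreconnected_connectedComponentIn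
  have hWg : W ⊆ Vg := connectedComponentIn_subset _ _
  have hVgV : Vg ⊆ V := fun z hz =>
    ball_subset_of_lt_infDist_compl (le_of_lt hz) (Metric.mem_ball_self hg)
  have hxW : x ∈ W := mem_connectedComponentIn hxg
  have hyW : y ∈ W := (isPreconnected_range σ.continuous).subset_connectedComponentIn
    ⟨0, σ.source⟩ hσg ⟨1, σ.target⟩
  have hclge : ∀ z ∈ closure W, g ≤ Metric.infDist z Vᶜ := by
    have : IsClosed {z | g ≤ Metric.infDist z Vᶜ} := isClosed_le continuous_const hcont
    exact fun z hz => (closure_minimal (t := {z | g ≤ Metric.infDist z Vᶜ})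
      (fun w hw => show g ≤ Metric.infDist w Vᶜ from le_of_lt (hWg hw)) this) hz
  have hclV : closure W ⊆ V := fun z hz =>
    ball_subset_of_lt_infDist_compl (hclge z hz) (Metric.mem_ball_self hg)
  -- A frontier point deeper than `g` would belong to `Vg`, and its open component there would meet
  -- `W`, hence equal it.
  have hfr : ∀ z ∈ frontier W, Metric.infDist z Vᶜ = g := by
    intro z hz
    refine le_antisymm ?_ (hclge z (frontier_subset_closure hz))
    by_contra hlt
    push Not at hlt
    have hzg : z ∈ Vg := hlt
    have hO : IsOpen (connectedComponentIn Vg z) := hVgo.connectedComponentIn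
    obtain ⟨w, hwz, hwW⟩ := mem_closure_iff.1 (frontier_subset_closure hz) _ hO
      (mem_connectedComponentIn hzg)
    have h1 : connectedComponentIn Vg z = connectedComponentIn Vg w := connectedComponentIn_eq hwz
    have h2 : W = connectedComponentIn Vg w := connectedComponentIn_eq hwW
    have : z ∈ W := by rw [h2, ← h1]; exact mem_connectedComponentIn hzg
    exact (hWo.frontier_eq ▸ hz).2 this
  have hWb : Bornology.IsBounded W := hVb.subset (hWg.trans hVgV)
  have hfc : ContinuousOn f (closure W) := (hf.continuousOn hVo).mono hclV
  have hfrc : IsCompact (frontier W) := hWb.isCompact_closure.of_isClosed_subset isClosed_frontier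
    frontier_subset_closure
  -- The interval of intermediate values is covered by two sets of controlled length: the image of
  -- the frontier, at depth exactly `g`, and that of the segment.
  have hsub : Set.Ioo (f y) (f x) ⊆ f '' frontier W ∪ f '' (segment ℝ y x ∩ W) := by
    intro t ht
    by_cases htE : t ∈ f '' frontier W
    · exact Or.inl htE
    · obtain ⟨z, hz1, hz2, hz3⟩ := exists_mem_segment_eq hWo hWp hWb hfc hxW hyW htE ht.1 ht.2
      exact Or.inr ⟨z, ⟨hz1, hz2⟩, hz3⟩
  have h1 : volume (f '' frontier W) ≤ ENNReal.ofReal (40 * A) :=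
    volume_image_le_of_collar hf hg hA (hcol (2 * g) (by positivity) hgg) hfrc hfr
  have h2 : volume (f '' (segment ℝ y x ∩ W)) ≤ ENNReal.ofReal (dist x y) :=
    volume_image_segment_inter_le hf hg
      (fun z hz => ball_subset_of_lt_infDist_compl (hWg hz).le) x y
  have h3 : ENNReal.ofReal (f x - f y) ≤ ENNReal.ofReal (40 * A + dist x y) := by
    rw [← Real.volume_Ioo, ENNReal.ofReal_add (by positivity) dist_nonneg]
    exact (measure_mono hsub).trans ((measure_union_le _ _).trans (add_le_add h1 h2))
  rw [ENNReal.ofReal_le_ofReal_iff (by positivity)] at h3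
  linarith

/-- The scalar bound applied to the distance from `f y` loses nothing, so the constant does not
depend on the target space. -/
theorem LocNonexpansive.dist_le {E : Type*} [PseudoMetricSpace E] {V : Set Plane} (hVo : IsOpen V)
    (hV : IsPreconnected V) (hVb : Bornology.IsBounded V) {f : Plane → E}
    (hf : LocNonexpansive V f) {A g₀ : ℝ} (hA : 0 ≤ A) (hg₀ : 0 < g₀)
    (hcol : ∀ g, 0 < g → g < g₀ →
      volume {z ∈ V | Metric.infDist z Vᶜ ≤ g} ≤ ENNReal.ofReal (A * g))
    {x y : Plane} (hx : x ∈ V) (hy : y ∈ V) : dist (f x) (f y) ≤ dist x y + 40 * A := by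
  have := (hf.dist_base (f y)).sub_le hVo hV hVb hA hg₀ hcol hx hy
  simpa using this

/-! ### Collars -/

theorem volume_closedBall_plane (x : Plane) {r : ℝ} (hr : 0 ≤ r) :
    volume (Metric.closedBall x r) = ENNReal.ofReal (Real.pi * r ^ 2) := by
  rw [EuclideanSpace.volume_closedBall_fin_two, ← ENNReal.ofReal_pow hr, mul_comm,
    ENNReal.ofReal_mul Real.pi_pos.le]

theorem volume_homothety_plane (x : Plane) (c : ℝ) (s : Set Plane) :
    volume (AffineMap.homothety x c '' s) = ENNReal.ofReal (c ^ 2) * volume s := by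
  rw [Measure.addHaar_image_homothety, finrank_euclideanSpace, Fintype.card_fin,
    abs_of_nonneg (by positivity)]

/-- With `t` the point of `T` nearest to `z`, the preimage of `z` is a convex combination of `t` and
the point of the inscribed ball lying in direction `z - t` from its centre. -/
theorem Convex.subset_homothety_of_infDist_le {T : Set Plane} (hT : Convex ℝ T)
    (hTc : IsClosed T) {x : Plane} {ρ δ : ℝ} (hρ : 0 < ρ) (hδ : 0 ≤ δ)
    (hball : Metric.closedBall x ρ ⊆ T) :
    {z | Metric.infDist z T ≤ δ} ⊆ AffineMap.homothety x (1 + δ / ρ) '' T := by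
  intro z hz
  have hTn : T.Nonempty := ⟨x, hball (Metric.mem_closedBall_self hρ.le)⟩
  obtain ⟨t, ht, htz⟩ := hTc.exists_infDist_eq_dist hTn z
  have hdz : dist z t ≤ δ := htz ▸ hz
  have hpos : 0 < 1 + δ / ρ := by positivity
  rcases eq_or_lt_of_le hδ with rfl | hδ
  · refine ⟨t, ht, ?_⟩
    have : z = t := dist_le_zero.1 hdz
    simp [this]
  have hu : x + (ρ / δ) • (z - t) ∈ T := by
    apply hball
    rw [Metric.mem_closedBall, dist_eq_norm, add_sub_cancel_left, norm_smul, Real.norm_eq_abs,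
      abs_of_pos (by positivity), ← dist_eq_norm]
    calc ρ / δ * dist z t ≤ ρ / δ * δ := by gcongr
      _ = ρ := by field_simp
  refine ⟨(ρ / (ρ + δ)) • t + (δ / (ρ + δ)) • (x + (ρ / δ) • (z - t)),
    hT ht hu (by positivity) (by positivity) (by field_simp), ?_⟩
  rw [AffineMap.homothety_apply]
  simp only [vsub_eq_sub, vadd_eq_add]
  ext i
  simp only [PiLp.add_apply, PiLp.smul_apply, PiLp.sub_apply, smul_eq_mul]
  field_simp
  ring

/-- The outer collar lies between `T` and its homothetic enlargement, whose area exceeds that of `T`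
by the factor `(1 + δ / (κ * d)) ^ 2 - 1`. The restriction `δ ≤ κ * d` makes this at most `3 * δ /
(κ * d)`, and `3 * π ≤ 10`. It matters that the bound is linear in `d`, so that diameters can be
summed. -/
theorem Convex.volume_outer_collar_le {T : Set Plane} (hT : Convex ℝ T) (hTc : IsCompact T)
    {x : Plane} {κ d δ : ℝ} (hκ : 0 < κ) (hd : 0 < d) (hTd : Metric.diam T ≤ d) (hδ : 0 ≤ δ)
    (hball : Metric.closedBall x (κ * d) ⊆ T) (hδκ : δ ≤ κ * d) :
    volume {z | z ∉ T ∧ Metric.infDist z T ≤ δ} ≤ ENNReal.ofReal (10 / κ * d * δ) := by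
  have hρ : 0 < κ * d := by positivity
  have hsub := hT.subset_homothety_of_infDist_le hTc.isClosed hρ hδ hball
  have hxT : x ∈ T := hball (Metric.mem_closedBall_self hρ.le)
  have hTH : T ⊆ AffineMap.homothety x (1 + δ / (κ * d)) '' T := fun z hz => hsub (by
    show Metric.infDist z T ≤ δ
    rw [Metric.infDist_zero_of_mem hz]; exact hδ)
  have hvol : volume T ≤ ENNReal.ofReal (Real.pi * d ^ 2) := by
    rw [← volume_closedBall_plane x hd.le]
    apply measure_mono
    intro z hz
    exact (Metric.dist_le_diam_of_mem hTc.isBounded hz hxT).trans hTd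
  have hfin : volume T ≠ ⊤ := hTc.measure_lt_top.ne
  calc volume {z | z ∉ T ∧ Metric.infDist z T ≤ δ}
      ≤ volume (AffineMap.homothety x (1 + δ / (κ * d)) '' T \ T) :=
        measure_mono fun z hz => ⟨hsub hz.2, hz.1⟩
    _ = volume (AffineMap.homothety x (1 + δ / (κ * d)) '' T) - volume T :=
        measure_sdiff hTH hTc.measurableSet.nullMeasurableSet hfin
    _ = ENNReal.ofReal ((1 + δ / (κ * d)) ^ 2 - 1) * volume T := by
        rw [volume_homothety_plane, ENNReal.ofReal_sub _ zero_le_one,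
          ENNReal.sub_mul (fun _ _ => hfin), ENNReal.ofReal_one, one_mul]
    _ ≤ ENNReal.ofReal (3 * (δ / (κ * d))) * ENNReal.ofReal (Real.pi * d ^ 2) := by
        gcongr
        have h1 : δ / (κ * d) ≤ 1 := by rwa [div_le_one hρ]
        have h0 : 0 ≤ δ / (κ * d) := by positivity
        nlinarith
    _ = ENNReal.ofReal (3 * Real.pi * (δ * d / κ)) := by
        rw [← ENNReal.ofReal_mul (by positivity)]
        congr 1; field_simp
    _ ≤ ENNReal.ofReal (10 / κ * d * δ) := by
        apply ENNReal.ofReal_le_ofReal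
        have : 10 / κ * d * δ = 10 * (δ * d / κ) := by ring
        rw [this]
        gcongr
        linarith [Real.pi_lt_d2]

/-- Shrinking `Q` towards `x` by the factor `1 - 2 * g / ρ` gives a copy at depth at least `2 * g`,
which is disjoint from the collar. The area lost is at most `2 * l` times that of `Q`. -/
theorem Convex.volume_inner_collar_le {Q : Set Plane} (hQ : Convex ℝ Q) (hQo : IsOpen Q)
    {x : Plane} {ρ R g : ℝ} (hρ : 0 < ρ) (hR : 0 ≤ R) (hg : 0 < g) (hgρ : 2 * g < ρ)
    (hball : Metric.ball x ρ ⊆ Q) (hQR : Q ⊆ Metric.closedBall x R) :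
    volume {z ∈ Q | Metric.infDist z Qᶜ ≤ g} ≤ ENNReal.ofReal (4 / ρ * (Real.pi * R ^ 2) * g) := by
  set l := 2 * g / ρ with hl
  have hl0 : 0 < l := by positivity
  have hl1 : l < 1 := by rwa [hl, div_lt_one hρ]
  have hxQ : x ∈ Q := hball (Metric.mem_ball_self hρ)
  have hHQ : AffineMap.homothety x (1 - l) '' Q ⊆ Q := by
    rintro _ ⟨q, hq, rfl⟩
    rw [AffineMap.homothety_eq_lineMap]
    exact hQ.lineMap_mem hxQ hq ⟨by linarith, by linarith⟩
  have hdeep : ∀ z ∈ AffineMap.homothety x (1 - l) '' Q, Metric.ball z (l * ρ) ⊆ Q := by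
    rintro _ ⟨q, hq, rfl⟩ w hw
    set z := AffineMap.homothety x (1 - l) q with hz
    have h1 : x + (1 / l) • (w - z) ∈ Q := by
      apply hball
      rw [Metric.mem_ball, dist_eq_norm, add_sub_cancel_left, norm_smul, Real.norm_eq_abs,
        abs_of_pos (by positivity), ← dist_eq_norm]
      rw [Metric.mem_ball] at hw
      calc 1 / l * dist w z < 1 / l * (l * ρ) := by gcongr
        _ = ρ := by field_simp
    have h2 : w = (1 - l) • q + l • (x + (1 / l) • (w - z)) := by
      have : l • (1 / l) • (w - z) = w - z := by
        rw [smul_smul, mul_one_div_cancel hl0.ne', one_smul]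
      rw [smul_add, this, hz, AffineMap.homothety_apply]
      simp only [vsub_eq_sub, vadd_eq_add]
      module
    rw [h2]
    exact hQ hq h1 (by linarith) hl0.le (by ring)
  have hfin : volume Q ≠ ⊤ :=
    ((measure_mono hQR).trans_lt (isCompact_closedBall x R).measure_lt_top).ne
  have hHo : MeasurableSet (AffineMap.homothety x (1 - l) '' Q) := by
    have : IsOpenMap (AffineMap.homothety x (1 - l) : Plane → Plane) :=
      AffineMap.homothety_isOpenMap x (1 - l) (by linarith)
    exact (this Q hQo).measurableSet
  have hsub : {z ∈ Q | Metric.infDist z Qᶜ ≤ g} ⊆ Q \ AffineMap.homothety x (1 - l) '' Q := by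
    rintro z ⟨hzQ, hzg⟩
    refine ⟨hzQ, fun hzH => ?_⟩
    have h1 := hdeep z hzH
    have hne : (Qᶜ : Set Plane).Nonempty := by
      rw [Set.nonempty_compl]; rintro rfl
      exact NormedSpace.unbounded_univ ℝ Plane (Metric.isBounded_closedBall.subset hQR)
    have h2 : l * ρ ≤ Metric.infDist z Qᶜ := by
      rw [Metric.le_infDist hne]
      intro w hw
      by_contra hlt
      push Not at hlt
      exact hw (h1 (by rwa [Metric.mem_ball, dist_comm]))
    have h3 : l * ρ = 2 * g := by rw [hl]; field_simp
    linarith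
  calc volume {z ∈ Q | Metric.infDist z Qᶜ ≤ g}
      ≤ volume (Q \ AffineMap.homothety x (1 - l) '' Q) := measure_mono hsub
    _ = volume Q - volume (AffineMap.homothety x (1 - l) '' Q) :=
        measure_sdiff hHQ hHo.nullMeasurableSet (measure_ne_top_of_subset hHQ hfin)
    _ = ENNReal.ofReal (1 - (1 - l) ^ 2) * volume Q := by
        rw [volume_homothety_plane, ENNReal.ofReal_sub _ (by positivity),
          ENNReal.sub_mul (fun _ _ => hfin), ENNReal.ofReal_one, one_mul]
    _ ≤ ENNReal.ofReal (2 * l) * ENNReal.ofReal (Real.pi * R ^ 2) := by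
        rw [← volume_closedBall_plane x hR]
        gcongr
        nlinarith
    _ = ENNReal.ofReal (4 / ρ * (Real.pi * R ^ 2) * g) := by
        rw [← ENNReal.ofReal_mul (by positivity)]
        congr 1; rw [hl]; field_simp; ring

/-- The collar of `V ⊆ W ∖ ⋃ T` is contained in the collar of `W` and the outer collars
of the removed sets. -/
theorem collar_subset {V W : Set Plane} {ι : Type*} {S : Finset ι} {T : ι → Set Plane}
    (hVo : IsOpen V) (hVW : V ⊆ W)
    (hVT : ∀ s ∈ S, Disjoint V (T s))
    (hfr : frontier V ⊆ Wᶜ ∪ ⋃ s ∈ S, T s) (hne : (Vᶜ).Nonempty) (g : ℝ) :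
    {z ∈ V | Metric.infDist z Vᶜ ≤ g} ⊆
      {z ∈ W | Metric.infDist z Wᶜ ≤ g} ∪ ⋃ s ∈ S, {z | z ∉ T s ∧ Metric.infDist z (T s) ≤ g} := by
  rintro z ⟨hzV, hzg⟩
  obtain ⟨y, hyV, hy⟩ := hVo.isClosed_compl.exists_infDist_eq_dist hne z
  have hzy : 0 < dist z y := dist_pos.2 fun h => hyV (h ▸ hzV)
  have hyfr : y ∈ frontier V := by
    refine ⟨?_, by rwa [hVo.interior_eq]⟩
    have h1 : closure (Metric.ball z (dist z y)) ⊆ closure V :=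
      closure_mono (ball_subset_of_lt_infDist_compl hy.ge)
    apply h1
    rw [closure_ball z hzy.ne', Metric.mem_closedBall, dist_comm]
  rcases hfr hyfr with hyW | hyT
  · exact Or.inl ⟨hVW hzV, (Metric.infDist_le_dist_of_mem hyW).trans (hy ▸ hzg)⟩
  · obtain ⟨s, hs, hys⟩ := Set.mem_iUnion₂.1 hyT
    exact Or.inr (Set.mem_iUnion₂.2 ⟨s, hs, fun hzT => Set.disjoint_left.1 (hVT s hs) hzV hzT,
      (Metric.infDist_le_dist_of_mem hys).trans (hy ▸ hzg)⟩)

/-- The collars of `W` and of the finitely many triangles are added. The threshold `g₁` depends on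
the smallest triangle and is not uniform in the mesh; the oscillation bound only sees the constant,
which depends on the sum of the diameters. -/
theorem volume_collar_le {V W : Set Plane} {S : Finset (Finset Plane)} {κ A g₀ : ℝ}
    (hVo : IsOpen V) (hVW : V ⊆ W) (hκ : 0 < κ) (hA : 0 ≤ A) (hg₀ : 0 < g₀)
    (hVT : ∀ s ∈ S, Disjoint V (convexHull ℝ (s : Set Plane)))
    (hfr : frontier V ⊆ Wᶜ ∪ ⋃ s ∈ S, convexHull ℝ (s : Set Plane)) (hne : (Vᶜ).Nonempty)
    (hball : ∀ s ∈ S, 0 < Metric.diam (s : Set Plane) ∧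
      ∃ x, Metric.closedBall x (κ * Metric.diam (s : Set Plane)) ⊆ convexHull ℝ (s : Set Plane))
    (hW : ∀ g, 0 < g → g < g₀ →
      volume {z ∈ W | Metric.infDist z Wᶜ ≤ g} ≤ ENNReal.ofReal (A * g)) :
    ∃ g₁ > 0, ∀ g, 0 < g → g < g₁ → volume {z ∈ V | Metric.infDist z Vᶜ ≤ g} ≤
      ENNReal.ofReal ((A + 10 / κ * ∑ s ∈ S, Metric.diam (s : Set Plane)) * g) := by
  have hsmall : ∀ᶠ g in 𝓝[>] (0 : ℝ), ∀ s ∈ S, g ≤ κ * Metric.diam (s : Set Plane) := by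
    rw [Filter.eventually_all_finset]
    intro s hs
    have : 0 < κ * Metric.diam (s : Set Plane) := mul_pos hκ (hball s hs).1
    filter_upwards [Ioo_mem_nhdsGT this] with g hg using hg.2.le
  obtain ⟨g₁, hg₁, hg₁'⟩ := (mem_nhdsGT_iff_exists_Ioo_subset).1 hsmall
  refine ⟨min g₀ g₁, lt_min hg₀ hg₁, fun g hg hgm => ?_⟩
  have hg' : ∀ s ∈ S, g ≤ κ * Metric.diam (s : Set Plane) :=
    hg₁' ⟨hg, hgm.trans_le (min_le_right _ _)⟩
  have hd0 : ∀ s ∈ S, 0 ≤ 10 / κ * Metric.diam (s : Set Plane) * g := fun s hs => by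
    have := Metric.diam_nonneg (s := (s : Set Plane)); positivity
  calc volume {z ∈ V | Metric.infDist z Vᶜ ≤ g}
      ≤ volume {z ∈ W | Metric.infDist z Wᶜ ≤ g} +
        ∑ s ∈ S, volume {z | z ∉ convexHull ℝ (s : Set Plane) ∧
          Metric.infDist z (convexHull ℝ (s : Set Plane)) ≤ g} :=
        (measure_mono (collar_subset hVo hVW hVT hfr hne g)).trans
          ((measure_union_le _ _).trans (by gcongr; exact measure_biUnion_finset_le _ _))
    _ ≤ ENNReal.ofReal (A * g) + ∑ s ∈ S,
          ENNReal.ofReal (10 / κ * Metric.diam (s : Set Plane) * g) := by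
        refine add_le_add (hW g hg (hgm.trans_le (min_le_left _ _))) (Finset.sum_le_sum fun s hs => ?_)
        obtain ⟨hd, x, hx⟩ := hball s hs
        exact (convex_convexHull ℝ _).volume_outer_collar_le
          (s.finite_toSet.isCompact_convexHull (𝕜 := ℝ)) hκ hd (convexHull_diam _).le hg.le hx (hg' s hs)
    _ = ENNReal.ofReal ((A + 10 / κ * ∑ s ∈ S, Metric.diam (s : Set Plane)) * g) := by
        rw [← ENNReal.ofReal_sum_of_nonneg hd0, ← ENNReal.ofReal_add (by positivity)
          (Finset.sum_nonneg hd0), ← Finset.sum_mul, ← Finset.mul_sum]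
        congr 1; ring

/-! ### The collar of a Lipschitz domain -/

theorem volume_strip_le {h : ℝ → ℝ} (hh : Continuous h) {r M : ℝ} (hM : 0 ≤ M) :
    volume {w : Plane | |w 0| < r ∧ h (w 0) < w 1 ∧ w 1 < h (w 0) + M} ≤
      ENNReal.ofReal (2 * r * M) := by
  have hmp : MeasurePreserving (fun w : Plane => (w 0, w 1)) volume (volume.prod volume) := by
    have h1 := PiLp.volume_preserving_ofLp (Fin 2)
    have h2 := volume_preserving_finTwoArrow ℝ
    exact h2.comp h1
  have hset : {w : Plane | |w 0| < r ∧ h (w 0) < w 1 ∧ w 1 < h (w 0) + M} =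
      (fun w : Plane => (w 0, w 1)) ⁻¹'
        regionBetween h (fun t => h t + M) (Set.Ioo (-r) r) := by
    ext w
    simp [regionBetween, abs_lt]
  rw [hset, hmp.measure_preimage
    (measurableSet_regionBetween hh.measurable (by fun_prop) measurableSet_Ioo).nullMeasurableSet,
    volume_regionBetween_eq_lintegral hh.measurable.aemeasurable
      (by fun_prop) measurableSet_Ioo]
  simp only [Pi.sub_apply, add_sub_cancel_left, lintegral_const, Measure.restrict_apply_univ,
    Real.volume_Ioo]
  rw [← ENNReal.ofReal_mul hM]
  apply le_of_eq; congr 1; ring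

/-- Finitely many charts cover the compact boundary. In a chart, a point of `Ω` within `g` of a
boundary point lies above the graph by at most `(1 + L) * g`, so the collar is covered by thin
strips over graphs; `2 + L` makes the inequality strict. -/
theorem IsLipschitzDomain.exists_collar_bound {Ω : Set Plane} (hΩ : IsLipschitzDomain Ω) :
    ∃ A ≥ 0, ∃ g₀ > 0, ∀ g, 0 < g → g < g₀ →
      volume {z ∈ Ω | Metric.infDist z Ωᶜ ≤ g} ≤ ENNReal.ofReal (A * g) := by
  obtain ⟨hΩo, -, hΩb, hchart⟩ := hΩ
  choose! r hr R L h hL hmem using hchart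
  have hcomp : IsCompact (frontier Ω) := hΩb.isCompact_closure.of_isClosed_subset
    isClosed_frontier frontier_subset_closure
  obtain ⟨t, htfr, htcov⟩ := hcomp.elim_nhds_subcover (fun x => Metric.ball x (r x / 4))
    (fun x hx => Metric.ball_mem_nhds x (by have := hr x hx; positivity))
  have hsmall : ∀ᶠ g in 𝓝[>] (0 : ℝ), ∀ x ∈ t, g < r x / 4 := by
    rw [Filter.eventually_all_finset]
    intro x hx
    have : 0 < r x / 4 := by have := hr x (htfr x hx); positivity
    filter_upwards [Ioo_mem_nhdsGT this] with g hg using hg.2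
  obtain ⟨g₀, hg₀, hg₀'⟩ := (mem_nhdsGT_iff_exists_Ioo_subset).1 hsmall
  refine ⟨∑ x ∈ t, 2 * r x * (2 + L x), Finset.sum_nonneg fun x hx => by
    have := (hr x (htfr x hx)).le; positivity, g₀, hg₀, fun g hg hgg => ?_⟩
  have hgr : ∀ x ∈ t, g < r x / 4 := hg₀' ⟨hg, hgg⟩
  have hne : (Ωᶜ : Set Plane).Nonempty := by
    rw [Set.nonempty_compl]; rintro rfl
    exact NormedSpace.unbounded_univ ℝ Plane hΩb
  have hsub : {z ∈ Ω | Metric.infDist z Ωᶜ ≤ g} ⊆ ⋃ x ∈ t, (fun z => R x (z - x)) ⁻¹'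
      {w : Plane | |w 0| < r x ∧ h x (w 0) < w 1 ∧ w 1 < h x (w 0) + (2 + L x) * g} := by
    rintro z ⟨hzΩ, hzg⟩
    obtain ⟨y, hyΩ, hy⟩ := hΩo.isClosed_compl.exists_infDist_eq_dist hne z
    have hzy : 0 < dist z y := dist_pos.2 fun h => hyΩ (h ▸ hzΩ)
    have hyfr : y ∈ frontier Ω := by
      refine ⟨?_, by rwa [hΩo.interior_eq]⟩
      have h1 : closure (Metric.ball z (dist z y)) ⊆ closure Ω :=
        closure_mono (ball_subset_of_lt_infDist_compl hy.ge)
      apply h1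
      rw [closure_ball z hzy.ne', Metric.mem_closedBall, dist_comm]
    have hdist : dist z y ≤ g := hy ▸ hzg
    obtain ⟨x, hx, hyx⟩ := Set.mem_iUnion₂.1 (htcov hyfr)
    have hrx := hr x (htfr x hx)
    have hgx := hgr x hx
    rw [Metric.mem_ball] at hyx
    have hzx : dist z x < r x := by linarith [dist_triangle z y x]
    have hz1 := (hmem x (htfr x hx) z hzx).1 hzΩ
    have hy1 : ¬ _ := fun hh => hyΩ ((hmem x (htfr x hx) y (by
      rw [Metric.mem_ball]; linarith)).2 hh)
    push Not at hy1
    refine Set.mem_iUnion₂.2 ⟨x, hx, ?_, hz1, ?_⟩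
    · calc |(R x (z - x)) 0| = ‖(R x (z - x)) 0‖ := rfl
        _ ≤ ‖R x (z - x)‖ := PiLp.norm_apply_le _ 0
        _ = dist z x := by rw [(R x).norm_map, dist_eq_norm]
        _ < r x := hzx
    -- The nearest point `y` lies on or below the graph; passing to `z` costs at most `g` in height
    -- and `L * g` in the graph function.
    · have hcoord : ∀ i, |(R x (z - x)) i - (R x (y - x)) i| ≤ g := by
        intro i
        calc |(R x (z - x)) i - (R x (y - x)) i| = ‖(R x (z - x) - R x (y - x)) i‖ := rfl
          _ ≤ ‖R x (z - x) - R x (y - x)‖ := PiLp.norm_apply_le _ i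
          _ = dist z y := by
              rw [← map_sub, (R x).norm_map, dist_eq_norm, sub_sub_sub_cancel_right]
          _ ≤ g := hdist
      have h0 := hcoord 0
      have h1 := (abs_le.1 (hcoord 1)).2
      have h2 := (hL x (htfr x hx)).dist_le_mul ((R x (y - x)) 0) ((R x (z - x)) 0)
      rw [Real.dist_eq, Real.dist_eq, abs_sub_comm ((R x (y - x)) 0)] at h2
      have h3 : (L x : ℝ) * |(R x (z - x)) 0 - (R x (y - x)) 0| ≤ L x * g := by gcongr
      have h4 := (abs_le.1 (h2.trans h3)).2
      linarith
  have hmp : ∀ x, MeasurePreserving (fun z : Plane => R x (z - x)) := fun x =>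
    (R x).measurePreserving.comp (measurePreserving_sub_right volume x)
  calc volume {z ∈ Ω | Metric.infDist z Ωᶜ ≤ g}
      ≤ ∑ x ∈ t, volume ((fun z => R x (z - x)) ⁻¹'
      {w : Plane | |w 0| < r x ∧ h x (w 0) < w 1 ∧ w 1 < h x (w 0) + (2 + L x) * g}) :=
        (measure_mono hsub).trans (measure_biUnion_finset_le _ _)
    _ ≤ ∑ x ∈ t, ENNReal.ofReal (2 * r x * ((2 + L x) * g)) := by
        refine Finset.sum_le_sum fun x hx => ?_
        have hc : Continuous (h x) := (hL x (htfr x hx)).continuous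
        have hms : MeasurableSet {w : Plane | |w 0| < r x ∧ h x (w 0) < w 1 ∧
            w 1 < h x (w 0) + (2 + L x) * g} := by
          simp only [Set.ofPred_and]
          exact ((isOpen_lt (by fun_prop) (by fun_prop)).inter
            ((isOpen_lt (by fun_prop) (by fun_prop)).inter
              (isOpen_lt (by fun_prop) (by fun_prop)))).measurableSet
        rw [(hmp x).measure_preimage hms.nullMeasurableSet]
        exact volume_strip_le hc (by positivity)
    _ = ENNReal.ofReal ((∑ x ∈ t, 2 * r x * (2 + L x)) * g) := by
        rw [← ENNReal.ofReal_sum_of_nonneg (fun x hx => by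
          have := (hr x (htfr x hx)).le; positivity), Finset.sum_mul]
        congr 1
        exact Finset.sum_congr rfl fun x _ => by ring

/-! ### Triangles on an edge -/

/-- Twice the signed area of the triangle `c, c', z`. -/
def signedArea (c c' z : Plane) : ℝ :=
  (c' 0 - c 0) * (z 1 - c 1) - (c' 1 - c 1) * (z 0 - c 0)

theorem signedArea_combo (c c' z w : Plane) {a b : ℝ} (hab : a + b = 1) :
    signedArea c c' (a • z + b • w) = a * signedArea c c' z + b * signedArea c c' w := by
  obtain rfl : b = 1 - a := by linarith
  simp only [signedArea, PiLp.add_apply, PiLp.smul_apply, smul_eq_mul]; ring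

theorem Finset.exists_eq_insert_pair {s : Finset Plane} (hs : s.card = 3) {c c' : Plane}
    (hc : c ∈ s) (hc' : c' ∈ s) (hne : c ≠ c') :
    ∃ a, a ≠ c ∧ a ≠ c' ∧ s = {c, c', a} := by
  have h1 : ((s.erase c).erase c').card = 1 := by
    rw [Finset.card_erase_of_mem (Finset.mem_erase.2 ⟨hne.symm, hc'⟩),
      Finset.card_erase_of_mem hc, hs]
  obtain ⟨a, ha⟩ := Finset.card_eq_one.1 h1
  have ha' : a ∈ (s.erase c).erase c' := by rw [ha]; simp
  simp only [Finset.mem_erase] at ha'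
  refine ⟨a, ha'.2.1, ha'.1, ?_⟩
  ext z
  have := Finset.ext_iff.1 ha z
  simp only [Finset.mem_erase, Finset.mem_singleton] at this
  simp only [Finset.mem_insert, Finset.mem_singleton]
  constructor
  · intro hz
    by_cases h1 : z = c
    · exact Or.inl h1
    by_cases h2 : z = c'
    · exact Or.inr (Or.inl h2)
    exact Or.inr (Or.inr (this.1 ⟨h2, h1, hz⟩))
  · rintro (rfl | rfl | rfl)
    exacts [hc, hc', ha'.2.2]


/-- Lagrange's identity: the square of the inner product of the two edge vectors is the missing
nonnegative term. -/
theorem abs_signedArea_le (c c' z : Plane) : |signedArea c c' z| ≤ dist c c' * dist c z := by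
  have h1 : dist c c' ^ 2 = (c' 0 - c 0) ^ 2 + (c' 1 - c 1) ^ 2 := by
    rw [dist_comm, dist_eq_norm, EuclideanSpace.real_norm_sq_eq]; simp [Fin.sum_univ_two]
  have h2 : dist c z ^ 2 = (z 0 - c 0) ^ 2 + (z 1 - c 1) ^ 2 := by
    rw [dist_comm, dist_eq_norm, EuclideanSpace.real_norm_sq_eq]; simp [Fin.sum_univ_two]
  apply abs_le_of_sq_le_sq _ (by positivity)
  rw [mul_pow, h1, h2, signedArea]
  nlinarith [sq_nonneg ((c' 0 - c 0) * (z 0 - c 0) + (c' 1 - c 1) * (z 1 - c 1))]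

theorem mem_convexHull_triple {c c' a z : Plane}
    (hz : z ∈ convexHull ℝ ((({c, c', a} : Finset Plane)) : Set Plane)) :
    ∃ p q r : ℝ, 0 ≤ p ∧ 0 ≤ q ∧ 0 ≤ r ∧ p + q + r = 1 ∧ p • c + q • c' + r • a = z := by
  simp only [Finset.coe_insert, Finset.coe_singleton] at hz
  rw [convexHull_insert (by simp), convexHull_pair] at hz
  rw [mem_convexJoin] at hz
  obtain ⟨_, rfl, w, ⟨s, t, hs, ht, hst, rfl⟩, u, v, hu, hv, huv, rfl⟩ := hz
  exact ⟨u, v * s, v * t, hu, by positivity, by positivity, by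
    rw [add_assoc, ← mul_add, hst, mul_one, huv], by module⟩

theorem combo_mem_convexHull_triple {c c' a : Plane} {p q r : ℝ} (hp : 0 ≤ p) (hq : 0 ≤ q)
    (hr : 0 ≤ r) (h : p + q + r = 1) :
    p • c + q • c' + r • a ∈ convexHull ℝ ((({c, c', a} : Finset Plane)) : Set Plane) := by
  have hc : ∀ z ∈ ({c, c', a} : Finset Plane),
      z ∈ convexHull ℝ ((({c, c', a} : Finset Plane)) : Set Plane) := fun z hz =>
    subset_convexHull ℝ _ (Finset.mem_coe.2 hz)
  have := (convex_convexHull ℝ ((({c, c', a} : Finset Plane)) : Set Plane)).sum_mem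
    (t := Finset.univ) (w := ![p, q, r]) (z := ![c, c', a])
    (by intro i _; fin_cases i <;> simpa) (by simp [Fin.sum_univ_three, h])
    (by intro i _; fin_cases i <;> exact hc _ (by simp))
  simpa [Fin.sum_univ_three] using this

theorem signedArea_combo_triple (b b' c c' a : Plane) {p q r : ℝ} (h : p + q + r = 1) :
    signedArea b b' (p • c + q • c' + r • a) =
      p * signedArea b b' c + q * signedArea b b' c' + r * signedArea b b' a := by
  obtain rfl : p = 1 - q - r := by linarith
  simp only [signedArea, PiLp.add_apply, PiLp.smul_apply, smul_eq_mul]; ring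

@[simp] theorem signedArea_left (c c' : Plane) : signedArea c c' c = 0 := by simp [signedArea]
@[simp] theorem signedArea_right (c c' : Plane) : signedArea c c' c' = 0 := by
  simp [signedArea]; ring

/-- A disk of radius `ρ` inside a triangle forces every edge to have length at least `2ρ`. -/
theorem two_mul_radius_le_edge {c c' a x : Plane} {ρ : ℝ} (hρ : 0 ≤ ρ) (hac : a ≠ c)
    (hball : Metric.closedBall x ρ ⊆ convexHull ℝ ((({c, c', a} : Finset Plane)) : Set Plane)) :
    2 * ρ ≤ dist c c' := by
  set ℓ := dist c a with hℓ
  have hℓ0 : 0 < ℓ := dist_pos.2 hac.symm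
  have hℓ2 : ℓ ^ 2 = (a 0 - c 0) ^ 2 + (a 1 - c 1) ^ 2 := by
    rw [hℓ, dist_comm, dist_eq_norm, EuclideanSpace.real_norm_sq_eq]; simp [Fin.sum_univ_two]
  -- Relative to the edge from `c` to `a`, the area function on the triangle is a multiple `q ∈ [0,
  -- 1]` of its value at `c'`. Across the disk, in the direction normal to this edge, it varies by
  -- `2 * ρ * ℓ`.
  have key : ∀ z ∈ Metric.closedBall x ρ, ∃ q, 0 ≤ q ∧ q ≤ 1 ∧
      signedArea c a z = q * signedArea c a c' := by
    intro z hz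
    obtain ⟨p, q, r, hp, hq, hr, hsum, rfl⟩ := mem_convexHull_triple (hball hz)
    exact ⟨q, hq, by linarith, by rw [signedArea_combo_triple _ _ _ _ _ hsum]; simp⟩
  set u : Plane := !₂[-(a 1 - c 1), a 0 - c 0] with hu
  have hun : ‖u‖ = ℓ := by
    have : ‖u‖ ^ 2 = ℓ ^ 2 := by
      rw [EuclideanSpace.real_norm_sq_eq, hℓ2]; simp [hu, Fin.sum_univ_two]; ring
    exact (pow_left_inj₀ (norm_nonneg _) hℓ0.le two_ne_zero).1 this
  have hmem : ∀ s : ℝ, |s| = ρ / ℓ → x + s • u ∈ Metric.closedBall x ρ := by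
    intro s hs
    rw [Metric.mem_closedBall, dist_eq_norm, add_sub_cancel_left, norm_smul, Real.norm_eq_abs, hs,
      hun]
    apply le_of_eq; field_simp
  have hval : ∀ s : ℝ, signedArea c a (x + s • u) = signedArea c a x + s * ℓ ^ 2 := by
    intro s
    simp only [signedArea, hu, PiLp.add_apply, PiLp.smul_apply, smul_eq_mul, hℓ2]
    simp; ring
  have hρℓ : 0 ≤ ρ / ℓ := by positivity
  obtain ⟨q₁, h1, h1', e1⟩ := key _ (hmem (ρ / ℓ) (abs_of_nonneg hρℓ))
  obtain ⟨q₂, h2, h2', e2⟩ := key _ (hmem (-(ρ / ℓ)) (by rw [abs_neg, abs_of_nonneg hρℓ]))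
  rw [hval] at e1 e2
  have h3 : 2 * ρ * ℓ = (q₁ - q₂) * signedArea c a c' := by
    have : ρ / ℓ * ℓ ^ 2 = ρ * ℓ := by field_simp
    linear_combination e1 - e2 - 2 * this
  have h4 : 2 * ρ * ℓ ≤ ℓ * dist c c' := by
    refine le_trans ?_ (abs_signedArea_le c a c')
    rw [h3]
    calc (q₁ - q₂) * signedArea c a c' ≤ |(q₁ - q₂) * signedArea c a c'| := le_abs_self _
      _ = |q₁ - q₂| * |signedArea c a c'| := abs_mul _ _
      _ ≤ 1 * |signedArea c a c'| := by
          gcongr; rw [abs_le]; constructor <;> linarith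
      _ = _ := one_mul _
  have : 2 * ρ * ℓ ≤ dist c c' * ℓ := by linarith
  exact le_of_mul_le_mul_right this hℓ0

/-- If it vanished, the affine area function would vanish on the whole disk; the centre and two
coordinate translates then force `c = c'`. -/
theorem signedArea_apex_ne_zero {c c' a x : Plane} {ρ : ℝ} (hρ : 0 < ρ) (hne : c ≠ c')
    (hball : Metric.closedBall x ρ ⊆ convexHull ℝ ((({c, c', a} : Finset Plane)) : Set Plane)) :
    signedArea c c' a ≠ 0 := by
  intro h0
  have key : ∀ z ∈ Metric.closedBall x ρ, signedArea c c' z = 0 := by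
    intro z hz
    obtain ⟨p, q, r, hp, hq, hr, hsum, rfl⟩ := mem_convexHull_triple (hball hz)
    rw [signedArea_combo_triple _ _ _ _ _ hsum]; simp [h0]
  have h1 := key x (Metric.mem_closedBall_self hρ.le)
  have h2 : ∀ i, signedArea c c' (x + EuclideanSpace.single i ρ) = 0 := fun i => key _ (by
    rw [Metric.mem_closedBall, dist_eq_norm, add_sub_cancel_left, PiLp.norm_single,
      Real.norm_eq_abs, abs_of_pos hρ])
  have h3 := h2 0
  have h4 := h2 1
  simp only [signedArea, PiLp.add_apply, PiLp.single_apply] at h1 h3 h4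
  simp at h3 h4
  apply hne
  have e0 : c' 0 - c 0 = 0 := by
    have : (c' 0 - c 0) * ρ = 0 := by linear_combination h4 - h1
    rcases mul_eq_zero.1 this with h | h
    exacts [h, absurd h hρ.ne']
  have e1 : c' 1 - c 1 = 0 := by
    have : (c' 1 - c 1) * ρ = 0 := by linear_combination h1 - h3
    rcases mul_eq_zero.1 this with h | h
    exacts [h, absurd h hρ.ne']
  ext i
  fin_cases i
  · simp; linarith
  · simp; linarith

/-- Two different triangles of a simplicial complex with a common edge have their apices on
different sides of the edge. -/
theorem SimplicialComplex_opposite_sides {K : Geometry.SimplicialComplex ℝ Plane} {c c' a a' : Plane}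
    (hs : {c, c', a} ∈ K.faces) (ht : {c, c', a'} ∈ K.faces) (hne : a ≠ a') (hac : a ≠ c)
    (hac' : a ≠ c') :
    ¬ 0 < signedArea c c' a * signedArea c c' a' := by
  intro hpos
  set d := signedArea c c' a' with hd
  have hd0 : d ≠ 0 := fun h => by rw [h, mul_zero] at hpos; exact lt_irrefl _ hpos
  -- Cramer's rule: `β` and `γ` are the coordinates of `a - c` in the basis `c' - c`, `a' - c`.
  -- Apices on the same side mean `γ > 0`.
  set γ := signedArea c c' a / d with hγ
  have hγ0 : 0 < γ := by
    rw [hγ]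
    have : signedArea c c' a / d = signedArea c c' a * d / d ^ 2 := by field_simp
    rw [this]; positivity
  set β := ((a 0 - c 0) * (a' 1 - c 1) - (a 1 - c 1) * (a' 0 - c 0)) / d with hβ
  have hexp : a = (1 - β - γ) • c + β • c' + γ • a' := by
    have hβd : β * d = (a 0 - c 0) * (a' 1 - c 1) - (a 1 - c 1) * (a' 0 - c 0) :=
      div_mul_cancel₀ _ hd0
    have hγd : γ * d = (c' 0 - c 0) * (a 1 - c 1) - (c' 1 - c 1) * (a 0 - c 0) :=
      div_mul_cancel₀ _ hd0
    have hdd : d = (c' 0 - c 0) * (a' 1 - c 1) - (c' 1 - c 1) * (a' 0 - c 0) := rfl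
    clear_value d β γ
    ext i
    apply mul_left_cancel₀ hd0
    simp only [PiLp.add_apply, PiLp.smul_apply, smul_eq_mul]
    fin_cases i
    · show d * a 0 = d * ((1 - β - γ) * c 0 + β * c' 0 + γ * a' 0)
      linear_combination (a 0 - c 0) * hdd - (c' 0 - c 0) * hβd - (a' 0 - c 0) * hγd
    · show d * a 1 = d * ((1 - β - γ) * c 1 + β * c' 1 + γ * a' 1)
      linear_combination (a 1 - c 1) * hdd - (c' 1 - c 1) * hβd - (a' 1 - c 1) * hγd
  -- Starting at the midpoint of the common edge and moving a small proportion `ε` towards `a` keeps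
  -- all barycentric weights nonnegative in both triangles, but leaves the line of the edge. The
  -- complex only allows the triangles to meet in the hull of their common vertices, which lie on
  -- that line.
  obtain ⟨ε, hε0, hε1, hε2, hε3⟩ : ∃ ε : ℝ, 0 < ε ∧ ε ≤ 1 ∧ 0 ≤ (1 - ε) / 2 + ε * (1 - β - γ) ∧
      0 ≤ (1 - ε) / 2 + ε * β := by
    refine ⟨1 / (2 * (2 + |β| + |γ|)), by positivity, ?_, ?_, ?_⟩
    · rw [div_le_one (by positivity)]; linarith [abs_nonneg β, abs_nonneg γ]
    all_goals
      set M := 2 + |β| + |γ| with hM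
      have hM0 : 0 < M := by positivity
      have h2 : 1 / (2 * M) * M = 1 / 2 := by field_simp
      have h3 : 0 < 1 / (2 * M) := by positivity
      nlinarith [le_abs_self β, neg_abs_le β, le_abs_self γ, neg_abs_le γ, abs_nonneg β,
        abs_nonneg γ]
  set z := ((1 - ε) / 2) • c + ((1 - ε) / 2) • c' + ε • a with hz
  have hz1 : z ∈ convexHull ℝ ((({c, c', a} : Finset Plane)) : Set Plane) :=
    combo_mem_convexHull_triple (by linarith) (by linarith) hε0.le (by ring)
  have hz2 : z ∈ convexHull ℝ ((({c, c', a'} : Finset Plane)) : Set Plane) := by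
    have : z = ((1 - ε) / 2 + ε * (1 - β - γ)) • c + ((1 - ε) / 2 + ε * β) • c' +
        (ε * γ) • a' := by
      rw [hz]; nth_rewrite 1 [hexp]; module
    rw [this]
    exact combo_mem_convexHull_triple hε2 hε3 (by positivity) (by ring)
  have hz3 := K.inter_subset_convexHull hs ht ⟨hz1, hz2⟩
  have hint : ((({c, c', a} : Finset Plane)) : Set Plane) ∩ (({c, c', a'} : Finset Plane)) ⊆
      {c, c'} := by
    rintro w ⟨h1, h2⟩
    simp only [Finset.coe_insert, Finset.coe_singleton, Set.mem_insert_iff,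
      Set.mem_singleton_iff] at h1 h2 ⊢
    rcases h1 with h1 | h1 | h1
    · exact Or.inl h1
    · exact Or.inr h1
    · subst h1
      rcases h2 with h2 | h2 | h2
      exacts [Or.inl h2, Or.inr h2, absurd h2 hne]
  have hz4 := convexHull_mono hint hz3
  rw [convexHull_pair] at hz4
  obtain ⟨s, t, -, -, hst, hzst⟩ := hz4
  have h0 : signedArea c c' z = 0 := by
    rw [← hzst, signedArea_combo _ _ _ _ hst]; simp
  rw [hz, signedArea_combo_triple _ _ _ _ _ (by ring)] at h0
  simp only [signedArea_left, signedArea_right, mul_zero, zero_add] at h0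
  rcases mul_eq_zero.1 h0 with h | h
  · exact hε0.ne' h
  · rw [h, zero_mul] at hpos; exact lt_irrefl _ hpos


theorem Finset.diam_pos_of_card {s : Finset Plane} (hs : s.card = 3) :
    0 < Metric.diam (s : Set Plane) := by
  obtain ⟨x, hx, y, hy, hxy⟩ := Finset.one_lt_card.1 (by omega : 1 < s.card)
  exact (dist_pos.2 hxy).trans_le
    (Metric.dist_le_diam_of_mem s.finite_toSet.isBounded (Finset.mem_coe.2 hx) (Finset.mem_coe.2 hy))

/-- Shape-regular triangles with an edge among given segments have total diameter controlled by
the total length of these segments. -/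
theorem sum_diam_le {K : Geometry.SimplicialComplex ℝ Plane} {ι : Type*}
    {S : Finset (Finset Plane)} {J : Finset ι} {c c' : ι → Plane} {κ : ℝ} (hκ : 0 < κ)
    (hK : ∀ s ∈ S, s ∈ K.faces ∧ s.card = 3)
    (hball : ∀ s ∈ S, ∃ x, Metric.closedBall x (κ * Metric.diam (s : Set Plane)) ⊆
      convexHull ℝ (s : Set Plane))
    (hJ : ∀ s ∈ S, ∃ i ∈ J, c i ∈ s ∧ c' i ∈ s) (hne : ∀ i ∈ J, c i ≠ c' i) :
    κ * ∑ s ∈ S, Metric.diam (s : Set Plane) ≤ ∑ i ∈ J, dist (c i) (c' i) := by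
  classical
  rcases S.eq_empty_or_nonempty with rfl | ⟨s₀, hs₀⟩
  · simp only [Finset.sum_empty, mul_zero]; exact Finset.sum_nonneg fun _ _ => dist_nonneg
  have : Nonempty ι := ⟨(hJ s₀ hs₀).choose⟩
  choose! f hfJ hf hf' using hJ
  have hapex : ∀ s ∈ S, ∃ a, a ≠ c (f s) ∧ a ≠ c' (f s) ∧ s = {c (f s), c' (f s), a} := fun s hs =>
    Finset.exists_eq_insert_pair (hK s hs).2 (hf s hs) (hf' s hs) (hne _ (hfJ s hs))
  choose! a ha ha' hsa using hapex
  have hdiam : ∀ s ∈ S, 2 * (κ * Metric.diam (s : Set Plane)) ≤ dist (c (f s)) (c' (f s)) := by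
    intro s hs
    obtain ⟨x, hx⟩ := hball s hs
    have h0 := Metric.diam_nonneg (s := (s : Set Plane))
    rw [show convexHull ℝ (s : Set Plane) =
      convexHull ℝ ((({c (f s), c' (f s), a s} : Finset Plane)) : Set Plane) by rw [← hsa s hs]] at hx
    exact two_mul_radius_le_edge (by positivity) (ha s hs) hx
  have harea : ∀ s ∈ S, signedArea (c (f s)) (c' (f s)) (a s) ≠ 0 := by
    intro s hs
    obtain ⟨x, hx⟩ := hball s hs
    have h0 := Finset.diam_pos_of_card (hK s hs).2
    rw [show convexHull ℝ (s : Set Plane) =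
      convexHull ℝ ((({c (f s), c' (f s), a s} : Finset Plane)) : Set Plane) by rw [← hsa s hs]] at hx
    exact signedArea_apex_ne_zero (by positivity) (hne _ (hfJ s hs)) hx
  -- Among three apices over one edge, two lie on the same side, which is excluded.
  have hcard : ∀ i ∈ J, ({s ∈ S | f s = i}).card ≤ 2 := by
    intro i _
    by_contra hlt
    push Not at hlt
    obtain ⟨s, t, r, hs, ht, hr, hst, hsr, htr⟩ := Finset.two_lt_card_iff.1 hlt
    simp only [Finset.mem_filter] at hs ht hr
    have opp : ∀ s ∈ S, ∀ t ∈ S, f s = i → f t = i → s ≠ t →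
        ¬ 0 < signedArea (c i) (c' i) (a s) * signedArea (c i) (c' i) (a t) := by
      intro s hs t ht hsi hti hst
      have e1 := hsa s hs
      have e2 := hsa t ht
      have h1 := ha s hs
      have h2 := ha' s hs
      rw [hsi] at e1 h1 h2
      rw [hti] at e2
      refine SimplicialComplex_opposite_sides (K := K) (e1 ▸ (hK s hs).1) (e2 ▸ (hK t ht).1) ?_ h1 h2
      intro h
      exact hst (by rw [e1, e2, h])
    have h1 := opp s hs.1 t ht.1 hs.2 ht.2 hst
    have h2 := opp s hs.1 r hr.1 hs.2 hr.2 hsr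
    have h3 := opp t ht.1 r hr.1 ht.2 hr.2 htr
    have n1 := harea s hs.1
    have n2 := harea t ht.1
    have n3 := harea r hr.1
    rw [hs.2] at n1
    rw [ht.2] at n2
    rw [hr.2] at n3
    rcases lt_or_gt_of_ne n1 with m1 | m1 <;> rcases lt_or_gt_of_ne n2 with m2 | m2 <;>
      rcases lt_or_gt_of_ne n3 with m3 | m3 <;>
      first
      | exact h1 (mul_pos_of_neg_of_neg m1 m2)
      | exact h1 (mul_pos m1 m2)
      | exact h2 (mul_pos_of_neg_of_neg m1 m3)
      | exact h2 (mul_pos m1 m3)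
      | exact h3 (mul_pos_of_neg_of_neg m2 m3)
      | exact h3 (mul_pos m2 m3)
  -- Each edge is counted at most twice; this factor cancels the `2` in `hdiam`.
  have hsum : ∑ s ∈ S, dist (c (f s)) (c' (f s)) ≤ ∑ i ∈ J, 2 * dist (c i) (c' i) := by
    rw [← Finset.sum_fiberwise_of_maps_to (g := f) hfJ]
    refine Finset.sum_le_sum fun i hi => ?_
    rw [Finset.sum_congr rfl (g := fun _ => dist (c i) (c' i)) (fun s hs => by
      rw [(Finset.mem_filter.1 hs).2]), Finset.sum_const, nsmul_eq_mul]
    gcongr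
    exact_mod_cast hcard i hi
  rw [← Finset.mul_sum] at hsum
  have hs2 := Finset.sum_le_sum hdiam
  rw [← Finset.mul_sum, ← Finset.mul_sum] at hs2
  linarith

/-! ### The crease line -/

/-- The mean value inequality applies on the interior of each piece and extends to its closure;
induction over the breakpoints chains the pieces with the triangle inequality. -/
theorem IsPiecewiseC1Arclength.lipschitzOnWith {b : ℝ → Plane} {α β : ℝ}
    (h : IsPiecewiseC1Arclength b α β) : LipschitzOnWith 1 b (Set.Icc α β) := by
  obtain ⟨n, τ, hτ, rfl, rfl, hp⟩ := h
  have hpiece : ∀ i : Fin n, LipschitzOnWith 1 b (Set.Icc (τ i.castSucc) (τ i.succ)) := by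
    intro i
    obtain ⟨hC, hd⟩ := hp i
    have hlt : τ i.castSucc < τ i.succ := hτ Fin.castSucc_lt_succ
    rw [← closure_Ioo hlt.ne]
    apply LipschitzOnWith.closure
    · rw [closure_Ioo hlt.ne]; exact hC.continuousOn
    · apply (convex_Ioo _ _).lipschitzOnWith_of_nnnorm_deriv_le
      · intro x hx
        exact ((hC x (Set.Ioo_subset_Icc_self hx)).contDiffAt
          (Icc_mem_nhds hx.1 hx.2)).differentiableAt (by simp)
      · intro x hx
        rw [← NNReal.coe_le_coe, coe_nnnorm, hd x hx, NNReal.coe_one]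
  have key : ∀ k : Fin (n + 1), LipschitzOnWith 1 b (Set.Icc (τ 0) (τ k)) := by
    intro k
    induction k using Fin.induction with
    | zero =>
      rw [Set.Icc_self]
      exact LipschitzOnWith.of_dist_le_mul (by rintro x rfl y rfl; simp)
    | succ i ih =>
      apply LipschitzOnWith.of_dist_le_mul
      have hmono : ∀ s ∈ Set.Icc (τ 0) (τ i.succ), ∀ t ∈ Set.Icc (τ 0) (τ i.succ), s ≤ t →
          dist (b s) (b t) ≤ dist s t := by
        intro s hs t ht hst
        rcases le_total t (τ i.castSucc) with h1 | h1
        · simpa using ih.dist_le_mul s ⟨hs.1, hst.trans h1⟩ t ⟨ht.1, h1⟩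
        rcases le_total s (τ i.castSucc) with h2 | h2
        · have a1 := ih.dist_le_mul s ⟨hs.1, h2⟩ _ ⟨hs.1.trans h2, le_rfl⟩
          have a2 := (hpiece i).dist_le_mul _ ⟨le_rfl, h1.trans ht.2⟩ t ⟨h1, ht.2⟩
          have a3 := dist_triangle (b s) (b (τ i.castSucc)) (b t)
          simp only [NNReal.coe_one, one_mul, Real.dist_eq] at a1 a2 ⊢
          rw [abs_of_nonpos (by linarith)] at a1 a2 ⊢
          linarith
        · simpa using (hpiece i).dist_le_mul s ⟨h2, hs.2⟩ t ⟨h1, ht.2⟩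
      intro s hs t ht
      rw [NNReal.coe_one, one_mul]
      rcases le_total s t with hst | hst
      · exact hmono s hs t ht hst
      · rw [dist_comm, dist_comm s]; exact hmono t ht s hs hst
  exact key (Fin.last n)

/-- A Lipschitz image of a subset of the line has Hausdorff dimension at most one, too small to
carry area. -/
theorem LipschitzOnWith.volume_image_eq_zero {b : ℝ → Plane} {K : NNReal} {s : Set ℝ}
    (h : LipschitzOnWith K b s) : volume (b '' s) = 0 := by
  have h1 : dimH (b '' s) < (2 : NNReal) :=
    (h.dimH_image_le.trans (dimH_mono (Set.subset_univ s))).trans_lt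
      (by rw [Real.dimH_univ]; norm_num)
  have h2 : (volume : Measure Plane) ≪ μH[((2 : NNReal) : ℝ)] := by
    have h3 : (Module.finrank ℝ Plane : ℝ) = ((2 : NNReal) : ℝ) := by simp
    have h4 : (μH[(Module.finrank ℝ Plane : ℝ)] : Measure Plane).IsAddHaarMeasure := inferInstance
    rw [← h3]
    exact Measure.absolutelyContinuous_isAddHaarMeasure _ _
  exact measure_zero_of_dimH_lt h2 h1

namespace CreasedPlate

variable (P : CreasedPlate)

theorem isCompact_γ : IsCompact P.γ :=
  isCompact_Icc.image_of_continuousOn P.b_arclength.lipschitzOnWith.continuousOn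

theorem volume_γ : volume P.γ = 0 := P.b_arclength.lipschitzOnWith.volume_image_eq_zero

theorem dist_b_le {s t : ℝ} (hs : s ∈ Set.Icc P.α P.β) (ht : t ∈ Set.Icc P.α P.β) :
    dist (P.b s) (P.b t) ≤ |s - t| := by
  simpa [Real.dist_eq] using P.b_arclength.lipschitzOnWith.dist_le_mul s hs t ht

end CreasedPlate

/-! ### Orthonormal frames and boxes -/

/-- An orthonormal frame of the plane. -/
structure IsFrame (e n : Plane) : Prop where
  norm_left : ‖e‖ = 1
  norm_right : ‖n‖ = 1
  inner_eq : inner ℝ e n = 0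

theorem IsFrame.neg_left {e n : Plane} (h : IsFrame e n) : IsFrame (-e) n :=
  ⟨by rw [norm_neg, h.norm_left], h.norm_right, by rw [inner_neg_left, h.inner_eq, neg_zero]⟩

theorem IsFrame.neg_right {e n : Plane} (h : IsFrame e n) : IsFrame e (-n) :=
  ⟨h.norm_left, by rw [norm_neg, h.norm_right], by rw [inner_neg_right, h.inner_eq, neg_zero]⟩

theorem IsFrame.norm_sq {e n : Plane} (h : IsFrame e n) (z : Plane) :
    ‖z‖ ^ 2 = inner ℝ z e ^ 2 + inner ℝ z n ^ 2 := by
  have ho : Orthonormal ℝ ![e, n] := by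
    refine ⟨fun i => ?_, fun i j hij => ?_⟩
    · fin_cases i
      exacts [h.norm_left, h.norm_right]
    · fin_cases i <;> fin_cases j
      · exact absurd rfl hij
      · exact h.inner_eq
      · simpa [real_inner_comm] using h.inner_eq
      · exact absurd rfl hij
  have hc : Fintype.card (Fin 2) = Module.finrank ℝ Plane := by simp
  let B := (basisOfOrthonormalOfCardEqFinrank ho hc).toOrthonormalBasis (by
    rwa [coe_basisOfOrthonormalOfCardEqFinrank])
  have hB : ⇑B = ![e, n] := by simp [B]
  have := B.sum_sq_norm_inner_left z
  rw [hB, Fin.sum_univ_two] at this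
  simpa using this.symm

theorem IsFrame.inner_combo_left {e n : Plane} (h : IsFrame e n) (s t : ℝ) :
    inner ℝ (s • e + t • n) e = s := by
  rw [inner_add_left, inner_smul_left, inner_smul_left, real_inner_self_eq_norm_sq, h.norm_left,
    real_inner_comm, h.inner_eq]; simp

theorem IsFrame.inner_combo_right {e n : Plane} (h : IsFrame e n) (s t : ℝ) :
    inner ℝ (s • e + t • n) n = t := by
  rw [inner_add_left, inner_smul_left, inner_smul_left, real_inner_self_eq_norm_sq, h.norm_right,
    h.inner_eq]; simp

theorem IsFrame.ext {e n : Plane} (h : IsFrame e n) {z w p : Plane}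
    (h1 : inner ℝ (z - p) e = inner ℝ (w - p) e) (h2 : inner ℝ (z - p) n = inner ℝ (w - p) n) :
    z = w := by
  have h3 : ‖z - w‖ ^ 2 = 0 := by
    rw [h.norm_sq, show z - w = (z - p) - (w - p) by abel, inner_sub_left (z - p),
      inner_sub_left (z - p), h1, h2]
    simp
  exact sub_eq_zero.1 (norm_eq_zero.1 (pow_eq_zero_iff two_ne_zero |>.1 h3))

/-- The open square of half side length `r` around `p` with sides parallel to the frame. -/
def box (p e n : Plane) (r : ℝ) : Set Plane :=
  {z | |inner ℝ (z - p) e| < r ∧ |inner ℝ (z - p) n| < r}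

theorem isOpen_box (p e n : Plane) (r : ℝ) : IsOpen (box p e n r) :=
  IsOpen.inter (s := {z | |inner ℝ (z - p) e| < r}) (t := {z | |inner ℝ (z - p) n| < r})
    (isOpen_lt (by fun_prop) continuous_const) (isOpen_lt (by fun_prop) continuous_const)

theorem convex_box (p e n : Plane) (r : ℝ) : Convex ℝ (box p e n r) := by
  have key : ∀ v : Plane, Convex ℝ {z : Plane | |inner ℝ (z - p) v| < r} := by
    intro v z hz w hw a b ha hb hab
    have : a • z + b • w - p = a • (z - p) + b • (w - p) := by
      obtain rfl : b = 1 - a := by linarith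
      module
    simp only [Set.mem_ofPred_eq] at hz hw ⊢
    rw [this, inner_add_left, inner_smul_left, inner_smul_left]
    simp only [conj_trivial]
    rw [abs_lt] at *
    constructor
    · rcases eq_or_lt_of_le ha with rfl | ha
      · obtain rfl : b = 1 := by linarith
        linarith
      · nlinarith
    · rcases eq_or_lt_of_le ha with rfl | ha
      · obtain rfl : b = 1 := by linarith
        linarith
      · nlinarith
  exact (key e).inter (key n)

theorem box_mono {p e n : Plane} {r r' : ℝ} (h : r ≤ r') : box p e n r ⊆ box p e n r' :=
  fun _ hz => ⟨hz.1.trans_le h, hz.2.trans_le h⟩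

theorem IsFrame.box_subset_ball {e n : Plane} (h : IsFrame e n) (p : Plane) {r : ℝ} (hr : 0 < r) :
    box p e n r ⊆ Metric.ball p (2 * r) := by
  intro z hz
  rw [Metric.mem_ball, dist_eq_norm]
  have h1 := sq_lt_sq' (by linarith [(abs_lt.1 hz.1).1]) (abs_lt.1 hz.1).2
  have h2 := sq_lt_sq' (by linarith [(abs_lt.1 hz.2).1]) (abs_lt.1 hz.2).2
  apply lt_of_pow_lt_pow_left₀ 2 (by positivity)
  rw [h.norm_sq]; nlinarith

theorem IsFrame.ball_subset_box {e n : Plane} (h : IsFrame e n) (p : Plane) (r : ℝ) :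
    Metric.ball p r ⊆ box p e n r := by
  intro z hz
  rw [Metric.mem_ball, dist_eq_norm] at hz
  constructor
  · exact ((abs_real_inner_le_norm _ _).trans (by rw [h.norm_left, mul_one])).trans_lt hz
  · exact ((abs_real_inner_le_norm _ _).trans (by rw [h.norm_right, mul_one])).trans_lt hz

/-- In the box of half side `2r` around `p = b s₀` the crease line is the graph of `η` over the
direction `e`, with height less than `r / 4`. -/
structure LocalGraph (P : CreasedPlate) (p e n : Plane) (s₀ : ℝ) (η : ℝ → ℝ) (r : ℝ) : Prop where
  frame : IsFrame e n
  r_pos : 0 < r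
  box_subset : box p e n (2 * r) ⊆ P.ω
  mem_iff : ∀ z ∈ box p e n (2 * r), z ∈ P.γ ↔ inner ℝ (z - p) n = η (inner ℝ (z - p) e)
  abs_lt : ∀ ξ, |ξ| < 2 * r → |η ξ| < r / 4
  param : ∀ t ∈ Set.Icc P.α P.β, P.b t ∈ box p e n (2 * r) → |t - s₀| ≤ 3 * r

theorem LocalGraph.neg_left {P : CreasedPlate} {p e n : Plane} {s₀ : ℝ} {η : ℝ → ℝ} {r : ℝ}
    (h : LocalGraph P p e n s₀ η r) : LocalGraph P p (-e) n s₀ (fun ξ => η (-ξ)) r := by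
  have hb : ∀ r', box p (-e) n r' = box p e n r' := fun r' => by simp [box, inner_neg_right]
  refine ⟨h.frame.neg_left, h.r_pos, ?_, ?_, fun ξ hξ => h.abs_lt _ (by rwa [abs_neg]), ?_⟩
  · rw [hb]; exact h.box_subset
  · intro z hz; rw [hb] at hz; rw [h.mem_iff z hz, inner_neg_right, neg_neg]
  · rw [hb]; exact h.param

theorem LocalGraph.neg_right {P : CreasedPlate} {p e n : Plane} {s₀ : ℝ} {η : ℝ → ℝ} {r : ℝ}
    (h : LocalGraph P p e n s₀ η r) : LocalGraph P p e (-n) s₀ (fun ξ => -η ξ) r := by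
  have hb : ∀ r', box p e (-n) r' = box p e n r' := fun r' => by simp [box, inner_neg_right]
  refine ⟨h.frame.neg_right, h.r_pos, ?_, ?_, fun ξ hξ => by rw [abs_neg]; exact h.abs_lt _ hξ, ?_⟩
  · rw [hb]; exact h.box_subset
  · intro z hz; rw [hb] at hz; rw [h.mem_iff z hz, inner_neg_right, neg_inj]
  · rw [hb]; exact h.param

/-- Strict differentiability with error `1 / 16` makes the tangential coordinate increase at rate at
least `15 / 16`, while the normal one is at most `|t - s₀| / 16`. The intermediate value theorem
then gives the graph, with height at most `2 * r / 15` and parameters within `32 * r / 15` of `s₀`.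
The frame is the same for all small `r`, so the box may later be shrunk. -/
theorem exists_localGraph (P : CreasedPlate) {s₀ u v : ℝ} (huv : Set.Icc u v ⊆ Set.Icc P.α P.β)
    (hs₀ : s₀ ∈ Set.Ioo u v) (hC : ContDiffOn ℝ 1 P.b (Set.Icc u v)) (hd : ‖deriv P.b s₀‖ = 1)
    (hω : P.b s₀ ∈ P.ω) :
    ∃ e n, ∃ r₀ > 0, ∀ r, 0 < r → r < r₀ → ∃ η, LocalGraph P (P.b s₀) e n s₀ η r := by
  set p := P.b s₀ with hp
  set e := deriv P.b s₀ with he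
  set n : Plane := !₂[-(e 1), e 0] with hn
  have he2 : e 0 ^ 2 + e 1 ^ 2 = 1 := by
    have := EuclideanSpace.real_norm_sq_eq e
    rw [hd, Fin.sum_univ_two] at this; linarith
  have hframe : IsFrame e n := by
    refine ⟨hd, ?_, ?_⟩
    · have : ‖n‖ ^ 2 = 1 := by
        rw [EuclideanSpace.real_norm_sq_eq, Fin.sum_univ_two]; simp [hn]; linarith
      exact (pow_eq_one_iff_of_nonneg (norm_nonneg _) two_ne_zero).1 this
    · simp [PiLp.inner_apply, Fin.sum_univ_two, hn]; ring
  have hstrict : HasStrictDerivAt P.b e s₀ :=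
    ((hC s₀ (Set.Ioo_subset_Icc_self hs₀)).contDiffAt
      (Icc_mem_nhds hs₀.1 hs₀.2)).hasStrictDerivAt (by simp)
  have hev := (hasStrictFDerivAt_iff_isLittleO.1 hstrict.hasStrictFDerivAt).def (show (0 : ℝ) < 1 / 16 by norm_num)
  rw [Metric.eventually_nhds_iff] at hev
  obtain ⟨ρ₁, hρ₁, hev⟩ := hev
  obtain ⟨ρ, hρ, hρ1, hρu, hρv⟩ : ∃ ρ > 0, ρ < ρ₁ ∧ u ≤ s₀ - ρ ∧ s₀ + ρ ≤ v := by
    refine ⟨min (ρ₁ / 2) (min (s₀ - u) (v - s₀)), ?_, ?_, ?_, ?_⟩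
    · have := sub_pos.2 hs₀.1
      have := sub_pos.2 hs₀.2
      positivity
    · have := min_le_left (ρ₁ / 2) (min (s₀ - u) (v - s₀)); linarith
    · have := (min_le_right (ρ₁ / 2) (min (s₀ - u) (v - s₀))).trans (min_le_left _ _); linarith
    · have := (min_le_right (ρ₁ / 2) (min (s₀ - u) (v - s₀))).trans (min_le_right _ _); linarith
  have hlin : ∀ s ∈ Set.Icc (s₀ - ρ) (s₀ + ρ), ∀ t ∈ Set.Icc (s₀ - ρ) (s₀ + ρ),
      ‖P.b t - P.b s - (t - s) • e‖ ≤ 1 / 16 * |t - s| := by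
    intro s hs t ht
    have := @hev (t, s) (by
      rw [Prod.dist_eq, max_lt_iff, Real.dist_eq, Real.dist_eq, abs_lt, abs_lt]
      constructor <;> constructor <;> linarith [hs.1, hs.2, ht.1, ht.2])
    simpa using this
  have hX : ∀ s ∈ Set.Icc (s₀ - ρ) (s₀ + ρ), ∀ t ∈ Set.Icc (s₀ - ρ) (s₀ + ρ), s ≤ t →
      15 / 16 * (t - s) ≤ inner ℝ (P.b t - p) e - inner ℝ (P.b s - p) e := by
    intro s hs t ht hst
    have h1 := abs_real_inner_le_norm (P.b t - P.b s - (t - s) • e) e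
    have h2 := hlin s hs t ht
    rw [hframe.norm_left, mul_one, inner_sub_left, inner_smul_left, real_inner_self_eq_norm_sq,
      hframe.norm_left] at h1
    rw [abs_of_nonneg (sub_nonneg.2 hst)] at h2
    have h3 := (abs_le.1 (h1.trans h2)).1
    simp only [conj_trivial] at h3
    rw [← inner_sub_left, sub_sub_sub_cancel_right]
    linarith
  have hY : ∀ t ∈ Set.Icc (s₀ - ρ) (s₀ + ρ), |inner ℝ (P.b t - p) n| ≤ 1 / 16 * |t - s₀| := by
    intro t ht
    have h1 := abs_real_inner_le_norm (P.b t - P.b s₀ - (t - s₀) • e) n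
    have h2 := hlin s₀ ⟨by linarith, by linarith⟩ t ht
    rw [hframe.norm_right, mul_one, inner_sub_left, inner_smul_left, hframe.inner_eq, mul_zero,
      sub_zero] at h1
    exact h1.trans h2
  have hXabs : ∀ t ∈ Set.Icc (s₀ - ρ) (s₀ + ρ), 15 / 16 * |t - s₀| ≤ |inner ℝ (P.b t - p) e| := by
    intro t ht
    have h0 : inner ℝ (P.b s₀ - p) e = 0 := by simp [hp]
    have hm : s₀ ∈ Set.Icc (s₀ - ρ) (s₀ + ρ) := ⟨by linarith, by linarith⟩
    rcases le_total s₀ t with h | h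
    · have := hX s₀ hm t ht h
      rw [h0, sub_zero] at this
      rw [abs_of_nonneg (sub_nonneg.2 h)]
      exact this.trans (le_abs_self _)
    · have := hX t ht s₀ hm h
      rw [h0, zero_sub] at this
      rw [abs_of_nonpos (sub_nonpos.2 h)]
      exact (by linarith : 15 / 16 * -(t - s₀) ≤ -inner ℝ (P.b t - p) e).trans (neg_le_abs _)
  have hsub : Set.Icc (s₀ - ρ) (s₀ + ρ) ⊆ Set.Icc P.α P.β :=
    (Set.Icc_subset_Icc hρu hρv).trans huv
  have hbc : ContinuousOn P.b (Set.Icc P.α P.β) := P.b_arclength.lipschitzOnWith.continuousOn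
  have hfar : IsCompact (P.b '' (Set.Icc P.α P.β \ Set.Ioo (s₀ - ρ) (s₀ + ρ))) :=
    (isCompact_Icc.diff isOpen_Ioo).image_of_continuousOn (hbc.mono Set.sdiff_subset)
  -- Simplicity excludes a return of the curve to `p`: coinciding parameters would have to be `α`
  -- and `β`, whereas `s₀` is interior.
  have hpfar : p ∉ P.b '' (Set.Icc P.α P.β \ Set.Ioo (s₀ - ρ) (s₀ + ρ)) := by
    rintro ⟨s, ⟨hs, hs'⟩, hsp⟩
    have hα : P.α ≤ u := (huv ⟨le_rfl, (hs₀.1.trans hs₀.2).le⟩).1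
    have hβ : v ≤ P.β := (huv ⟨(hs₀.1.trans hs₀.2).le, le_rfl⟩).2
    have hs₀' : s₀ ∈ Set.Icc P.α P.β := ⟨hα.trans hs₀.1.le, hs₀.2.le.trans hβ⟩
    rcases lt_trichotomy s s₀ with h | h | h
    · have := (P.b_simple s hs s₀ hs₀' h hsp).2; linarith [hs₀.2]
    · exact hs' ⟨by linarith, by linarith⟩
    · have := (P.b_simple s₀ hs₀' s hs h hsp.symm).1; linarith [hs₀.1]
  obtain ⟨d, hd0, hdfar⟩ := Metric.isOpen_iff.1 hfar.isClosed.isOpen_compl p hpfar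
  obtain ⟨d', hd0', hdω⟩ := Metric.isOpen_iff.1 P.ω_open p hω
  -- The box of half side `2 * r` lies in the ball of radius `4 * r`, which must stay in `ω` and
  -- away from the remote part of the curve; `4 * r < ρ` makes the graph reach across the box.
  refine ⟨e, n, min (d / 4) (min (d' / 4) (ρ / 4)), by positivity, fun r hr hrr => ?_⟩
  have hr1 : r < d / 4 := hrr.trans_le (min_le_left _ _)
  have hr2 : r < d' / 4 := hrr.trans_le ((min_le_right _ _).trans (min_le_left _ _))
  have hr3 : r < ρ / 4 := hrr.trans_le ((min_le_right _ _).trans (min_le_right _ _))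
  have hbb : box p e n (2 * r) ⊆ Metric.ball p (4 * r) := by
    have := hframe.box_subset_ball p (show 0 < 2 * r by positivity)
    rwa [show 2 * (2 * r) = 4 * r by ring] at this
  have hin : ∀ t ∈ Set.Icc P.α P.β, P.b t ∈ box p e n (2 * r) →
      t ∈ Set.Icc (s₀ - ρ) (s₀ + ρ) := by
    intro t ht htb
    by_contra hcon
    exact hdfar (Metric.ball_subset_ball (by linarith) (hbb htb))
      ⟨t, ⟨ht, fun h => hcon (Set.Ioo_subset_Icc_self h)⟩, rfl⟩
  have hex : ∀ ξ : ℝ, |ξ| < 2 * r → ∃ t ∈ Set.Icc (s₀ - ρ) (s₀ + ρ), inner ℝ (P.b t - p) e = ξ := by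
    intro ξ hξ
    have h0 : inner ℝ (P.b s₀ - p) e = 0 := by simp [hp]
    have hm : s₀ ∈ Set.Icc (s₀ - ρ) (s₀ + ρ) := ⟨by linarith, by linarith⟩
    have hl : s₀ - ρ ∈ Set.Icc (s₀ - ρ) (s₀ + ρ) := ⟨le_rfl, by linarith⟩
    have hr' : s₀ + ρ ∈ Set.Icc (s₀ - ρ) (s₀ + ρ) := ⟨by linarith, le_rfl⟩
    have h1 := hX _ hl _ hm (by linarith)
    have h2 := hX _ hm _ hr' (by linarith)
    rw [h0] at h1 h2
    have hc : ContinuousOn (fun t => inner ℝ (P.b t - p) e) (Set.Icc (s₀ - ρ) (s₀ + ρ)) :=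
      ContinuousOn.inner (𝕜 := ℝ) ((hbc.mono hsub).sub continuousOn_const) continuousOn_const
    rw [abs_lt] at hξ
    exact intermediate_value_Icc (by linarith) hc ⟨by linarith, by linarith⟩
  have huniq : ∀ s ∈ Set.Icc (s₀ - ρ) (s₀ + ρ), ∀ t ∈ Set.Icc (s₀ - ρ) (s₀ + ρ),
      inner ℝ (P.b s - p) e = inner ℝ (P.b t - p) e → s = t := by
    intro s hs t ht hst
    rcases le_total s t with h | h
    · have := hX s hs t ht h; rw [hst] at this; linarith
    · have := hX t ht s hs h; rw [hst] at this; linarith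
  choose! T hT hTX using hex
  refine ⟨fun ξ => inner ℝ (P.b (T ξ) - p) n, hframe, hr, ?_, ?_, ?_, ?_⟩
  · exact fun z hz => hdω (Metric.ball_subset_ball (by linarith) (hbb hz))
  · intro z hz
    constructor
    · rintro ⟨t, ht, rfl⟩
      rw [huniq _ (hT _ hz.1) t (hin t ht hz) (hTX _ hz.1)]
    · intro h
      refine ⟨T (inner ℝ (z - p) e), hsub (hT _ hz.1), ?_⟩
      exact hframe.ext (hTX _ hz.1) h.symm
  · intro ξ hξ
    have h1 := hXabs _ (hT ξ hξ)
    rw [hTX ξ hξ] at h1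
    have h2 := hY _ (hT ξ hξ)
    linarith
  · intro t ht htb
    have h1 := hXabs t (hin t ht htb)
    linarith [htb.1]

/-! ### Barriers -/

/-- A connected set that avoids the polygonal barrier consisting of the vertical ray below
`(x₁, y₁)`, the segment from `(x₁, y₁)` to `(x₂, y₂)` and the vertical ray above `(x₂, y₂)`
lies on one side of it. -/
theorem IsPreconnected.lt_of_avoids_barrier {V : Set Plane} (hV : IsPreconnected V)
    {X Y : Plane → ℝ} (hX : Continuous X) (hY : Continuous Y) {x₁ x₂ y₁ y₂ : ℝ} (hx : x₁ ≤ x₂)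
    (h1 : ∀ w ∈ V, X w = x₁ → y₁ < Y w) (h2 : ∀ w ∈ V, X w = x₂ → Y w < y₂)
    (h3 : ∀ w ∈ V, x₁ ≤ X w → X w ≤ x₂ → (Y w - y₁) * (x₂ - x₁) ≠ (y₂ - y₁) * (X w - x₁))
    {x : Plane} (hxV : x ∈ V) (hxx : X x < x₁) : ∀ w ∈ V, X w < x₂ := by
  -- `L` and `R` are the open sides of the barrier. Cross-multiplying the equation of its middle
  -- piece admits the vertical case `x₁ = x₂`.
  set L : Set Plane := {w | X w < x₁} ∪
    ({w | X w < x₂} ∩ {w | (y₂ - y₁) * (X w - x₁) < (Y w - y₁) * (x₂ - x₁)}) with hL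
  set R : Set Plane := {w | x₂ < X w} ∪
    ({w | x₁ < X w} ∩ {w | (Y w - y₁) * (x₂ - x₁) < (y₂ - y₁) * (X w - x₁)}) with hR
  have hLo : IsOpen L := (isOpen_lt hX continuous_const).union
    ((isOpen_lt hX continuous_const).inter (isOpen_lt (by fun_prop) (by fun_prop)))
  have hRo : IsOpen R := (isOpen_lt continuous_const hX).union
    ((isOpen_lt continuous_const hX).inter (isOpen_lt (by fun_prop) (by fun_prop)))
  have hdis : Disjoint L R := by
    rw [Set.disjoint_left]
    rintro w (hl | ⟨hl1, hl2⟩) (hr | ⟨hr1, hr2⟩)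
    · exact lt_irrefl _ ((hl.trans_le hx).trans hr)
    · exact lt_irrefl _ (lt_trans (a := X w) hl hr1)
    · exact lt_irrefl _ (lt_trans (a := X w) hl1 hr)
    · exact lt_irrefl _ (lt_trans (a := (y₂ - y₁) * (X w - x₁)) hl2 hr2)
  have hcov : V ⊆ L ∪ R := by
    intro w hw
    rcases lt_or_ge (X w) x₁ with a | a
    · exact Or.inl (Or.inl a)
    rcases lt_or_ge x₂ (X w) with b | b
    · exact Or.inr (Or.inl b)
    rcases lt_or_gt_of_ne (h3 w hw a b) with c | c
    · refine Or.inr (Or.inr ⟨lt_of_le_of_ne a fun heq => ?_, c⟩)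
      have := h1 w hw heq.symm
      rw [← heq, sub_self, mul_zero] at c
      nlinarith
    · refine Or.inl (Or.inr ⟨lt_of_le_of_ne b fun heq => ?_, c⟩)
      have := h2 w hw heq
      rw [heq] at c
      nlinarith
  have hVL : V ⊆ L := hV.subset_left_of_subset_union hLo hRo hdis hcov ⟨x, hxV, Or.inl hxx⟩
  intro w hw
  rcases hVL hw with h | h
  · exact lt_of_lt_of_le h hx
  · exact h.1

/-- The data of the local situation on one side of the crease line: inside the box, `S` is the
region above the graph of `η`, and every point of the closed set `fat ⊇ γ` is joined to
`γ` by a segment in `fat` of length at most `h`. -/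
structure LocalSide (P : CreasedPlate) (S fat : Set Plane) (p e n : Plane) (s₀ : ℝ) (η : ℝ → ℝ)
    (r h : ℝ) : Prop where
  graph : LocalGraph P p e n s₀ η r
  mem_iff : ∀ z ∈ box p e n (2 * r), z ∈ S ↔ η (inner ℝ (z - p) e) < inner ℝ (z - p) n
  S_open : IsOpen S
  fat_closed : IsClosed fat
  γ_subset : P.γ ⊆ fat
  fat_near : ∀ z ∈ fat, ∃ c ∈ P.γ, dist z c ≤ h ∧ segment ℝ z c ⊆ fat
  h_nonneg : 0 ≤ h
  h_lt : h < r / 16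

namespace LocalSide

variable {P : CreasedPlate} {S fat : Set Plane} {p e n : Plane} {s₀ : ℝ} {η : ℝ → ℝ} {r h : ℝ}

theorem neg_left (H : LocalSide P S fat p e n s₀ η r h) :
    LocalSide P S fat p (-e) n s₀ (fun ξ => η (-ξ)) r h := by
  refine ⟨H.graph.neg_left, ?_, H.S_open, H.fat_closed, H.γ_subset, H.fat_near, H.h_nonneg, H.h_lt⟩
  intro z hz
  have hb : box p (-e) n (2 * r) = box p e n (2 * r) := by simp [box, inner_neg_right]
  rw [hb] at hz
  rw [H.mem_iff z hz, inner_neg_right, neg_neg]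

theorem continuous_coord (p v : Plane) : Continuous fun z : Plane => inner ℝ (z - p) v := by
  fun_prop

theorem mem_box_of_dist (H : LocalSide P S fat p e n s₀ η r h) {z c : Plane} {r' : ℝ}
    (hz : z ∈ box p e n r') (hd : dist z c ≤ h) : c ∈ box p e n (r' + h) := by
  have key : ∀ v : Plane, ‖v‖ = 1 → |inner ℝ (c - p) v - inner ℝ (z - p) v| ≤ h := by
    intro v hv
    rw [← inner_sub_left, sub_sub_sub_cancel_right]
    refine (abs_real_inner_le_norm _ _).trans ?_
    rw [hv, mul_one, ← dist_eq_norm, dist_comm]; exact hd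
  have h1 := abs_le.1 (key e H.graph.frame.norm_left)
  have h2 := abs_le.1 (key n H.graph.frame.norm_right)
  have h3 := abs_lt.1 hz.1
  have h4 := abs_lt.1 hz.2
  exact ⟨abs_lt.2 ⟨by linarith, by linarith⟩, abs_lt.2 ⟨by linarith, by linarith⟩⟩

theorem abs_coord_sub_le {z c v : Plane} (p : Plane) (hv : ‖v‖ = 1) (hd : dist z c ≤ h) :
    |inner ℝ (z - p) v - inner ℝ (c - p) v| ≤ h := by
  rw [← inner_sub_left, sub_sub_sub_cancel_right]
  refine (abs_real_inner_le_norm _ _).trans ?_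
  rw [hv, mul_one, ← dist_eq_norm]; exact hd

/-- The region near the top of the box. -/
theorem sky_subset (H : LocalSide P S fat p e n s₀ η r h) {w : Plane} (hw : w ∈ box p e n r)
    (hwY : r / 2 < inner ℝ (w - p) n) : w ∈ (S \ fat) ∩ box p e n r := by
  have hr := H.graph.r_pos
  have hw2 : w ∈ box p e n (2 * r) := box_mono (by linarith) hw
  refine ⟨⟨?_, ?_⟩, hw⟩
  · rw [H.mem_iff w hw2]
    have := (abs_lt.1 (H.graph.abs_lt _ hw2.1)).2
    linarith
  · intro hf
    obtain ⟨c, hcγ, hwc, -⟩ := H.fat_near w hf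
    have hh := H.h_lt
    have hc2 : c ∈ box p e n (2 * r) := box_mono (by linarith) (H.mem_box_of_dist hw hwc)
    have h1 := (H.graph.mem_iff c hc2).1 hcγ
    have h2 := (abs_lt.1 (H.graph.abs_lt _ hc2.1)).2
    have h3 := (abs_le.1 (abs_coord_sub_le p H.graph.frame.norm_right hwc)).2
    linarith

/-- The reference point above the crease line. -/
def top (p n : Plane) (r : ℝ) : Plane := p + (3 / 4 * r) • n

theorem coord_combo (hf : IsFrame e n) (x y : ℝ) :
    inner ℝ (p + (x • e + y • n) - p) e = x ∧ inner ℝ (p + (x • e + y • n) - p) n = y := by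
  rw [add_sub_cancel_left]
  exact ⟨hf.inner_combo_left x y, hf.inner_combo_right x y⟩

theorem top_coord (hf : IsFrame e n) :
    inner ℝ (top p n r - p) e = 0 ∧ inner ℝ (top p n r - p) n = 3 / 4 * r := by
  have := coord_combo (p := p) hf 0 (3 / 4 * r)
  simpa [top] using this

theorem top_mem (H : LocalSide P S fat p e n s₀ η r h) :
    top p n r ∈ box p e n r ∧ r / 2 < inner ℝ (top p n r - p) n := by
  obtain ⟨h1, h2⟩ := top_coord (p := p) (r := r) H.graph.frame
  have hr := H.graph.r_pos
  refine ⟨⟨by rw [h1]; simpa, ?_⟩, by rw [h2]; linarith⟩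
  rw [h2, abs_of_pos (by positivity)]; linarith

theorem convex_half (p v : Plane) (t : ℝ) : Convex ℝ {w : Plane | t < inner ℝ (w - p) v} := by
  intro z hz w hw a b ha hb hab
  have : a • z + b • w - p = a • (z - p) + b • (w - p) := by
    obtain rfl : b = 1 - a := by linarith
    module
  simp only [Set.mem_ofPred_eq] at hz hw ⊢
  rw [this, inner_add_left, inner_smul_left, inner_smul_left]
  simp only [conj_trivial]
  rcases eq_or_lt_of_le ha with rfl | ha
  · obtain rfl : b = 1 := by linarith
    linarith
  · have ht : t = a * t + b * t := by rw [← add_mul, hab, one_mul]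
    linarith [mul_pos ha (sub_pos.2 hz), mul_nonneg hb (sub_pos.2 hw).le]

theorem convex_line (p v : Plane) (t : ℝ) : Convex ℝ {w : Plane | inner ℝ (w - p) v = t} := by
  intro z hz w hw a b ha hb hab
  have : a • z + b • w - p = a • (z - p) + b • (w - p) := by
    obtain rfl : b = 1 - a := by linarith
    module
  simp only [Set.mem_ofPred_eq] at hz hw ⊢
  rw [this, inner_add_left, inner_smul_left, inner_smul_left]
  simp only [conj_trivial]
  rw [hz, hw, ← add_mul, hab, one_mul]

theorem sky_subset_component (H : LocalSide P S fat p e n s₀ η r h) :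
    box p e n r ∩ {w | r / 2 < inner ℝ (w - p) n} ⊆
      connectedComponentIn ((S \ fat) ∩ box p e n r) (top p n r) :=
  ((convex_box p e n r).inter (convex_half p n _)).isPreconnected.subset_connectedComponentIn
    ⟨H.top_mem.1, H.top_mem.2⟩ (fun _ hw => H.sky_subset hw.1 hw.2)

/-- A connected set in `S ∖ fat` inside the box that cannot be joined with the top of the box
does not cross the right barrier. -/
theorem lt_of_disjoint_component (H : LocalSide P S fat p e n s₀ η r h) {V : Set Plane}
    (hV : IsPreconnected V) (hVD : V ⊆ (S \ fat) ∩ box p e n r)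
    (hVq : Disjoint V (connectedComponentIn ((S \ fat) ∩ box p e n r) (top p n r))) {x : Plane}
    (hx : x ∈ V) (hxr : inner ℝ (x - p) e < r / 4) :
    ∀ w ∈ V, inner ℝ (w - p) e < 3 / 4 * r := by
  have hr := H.graph.r_pos
  have hh := H.h_lt
  have hf := H.graph.frame
  set X : Plane → ℝ := fun z => inner ℝ (z - p) e with hX
  set Y : Plane → ℝ := fun z => inner ℝ (z - p) n with hY
  have hXc : Continuous X := continuous_coord p e
  have hYc : Continuous Y := continuous_coord p n
  set Q := connectedComponentIn ((S \ fat) ∩ box p e n r) (top p n r) with hQ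
  -- The barrier is built at the highest point `z` of `fat` on the line `X = r / 2`: the vertical
  -- ray above `z`, a segment in `fat` from `z` to a point `c` of the crease, and the vertical ray
  -- below `c`.
  set K : Set Plane := fat ∩ ({z | X z = r / 2} ∩ {z | |Y z| ≤ r / 2}) with hK
  have hKc : IsCompact K := by
    refine (isCompact_closedBall p (4 * r)).of_isClosed_subset (H.fat_closed.inter
      ((isClosed_eq hXc continuous_const).inter (isClosed_le hYc.abs continuous_const))) ?_
    rintro z ⟨-, hz1, hz2⟩
    apply Metric.ball_subset_closedBall
    have : z ∈ box p e n (2 * r) := ⟨by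
      show |X z| < _
      rw [show X z = r / 2 from hz1, abs_of_pos (by positivity)]; linarith,
      lt_of_le_of_lt hz2 (by linarith)⟩
    have h2 := hf.box_subset_ball p (show 0 < 2 * r by positivity) this
    rwa [show 2 * (2 * r) = 4 * r by ring] at h2
  have hη := abs_lt.1 (H.graph.abs_lt (r / 2) (by rw [abs_of_pos (by positivity)]; linarith))
  set g₀ : Plane := p + ((r / 2) • e + η (r / 2) • n) with hg₀
  obtain ⟨hg1, hg2⟩ := coord_combo (p := p) hf (r / 2) (η (r / 2))
  have hg0K : g₀ ∈ K := by
    refine ⟨H.γ_subset ((H.graph.mem_iff g₀ ⟨?_, ?_⟩).2 ?_), hg1, ?_⟩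
    · rw [hg1, abs_of_pos (by positivity)]; linarith
    · rw [hg2, abs_lt]; constructor <;> linarith
    · rw [hg1, hg2]
    · show |Y g₀| ≤ _
      rw [show Y g₀ = _ from hg2, abs_le]; constructor <;> linarith
  obtain ⟨z, ⟨hzfat, hzX, hzY⟩, hzmax⟩ := hKc.exists_isMaxOn ⟨g₀, hg0K⟩ hYc.continuousOn
  have hzmax' : ∀ w ∈ K, Y w ≤ Y z := fun w hw => hzmax hw
  have hzX : X z = r / 2 := hzX
  have hzY' := abs_le.1 (show |Y z| ≤ r / 2 from hzY)
  have hzg : η (r / 2) ≤ Y z := by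
    have := hzmax' g₀ hg0K
    rwa [show Y g₀ = _ from hg2] at this
  obtain ⟨c, hcγ, hzc, hseg⟩ := H.fat_near z hzfat
  have hzbox : z ∈ box p e n r := ⟨by
    show |X z| < r
    rw [hzX, abs_of_pos (by positivity)]; linarith, lt_of_le_of_lt hzY (by linarith)⟩
  have hc2 : c ∈ box p e n (2 * r) := box_mono (by linarith) (H.mem_box_of_dist hzbox hzc)
  have hcη : Y c = η (X c) := (H.graph.mem_iff c hc2).1 hcγ
  have hXzc := abs_le.1 (abs_coord_sub_le p hf.norm_left hzc)
  have hXzc1 : -h ≤ X z - X c := hXzc.1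
  have hXzc2 : X z - X c ≤ h := hXzc.2
  -- the vertical ray above `z` is joined to the top
  have hray : {w | X w = r / 2} ∩ {w | Y z < Y w} ∩ box p e n r ⊆ Q := by
    have hpre : IsPreconnected ({w | X w = r / 2} ∩ {w | Y z < Y w} ∩ box p e n r) :=
      (((convex_line p e _).inter (convex_half p n _)).inter (convex_box p e n r)).isPreconnected
    set y₀ : Plane := p + ((r / 2) • e + (3 / 4 * r) • n) with hy₀
    obtain ⟨hy1, hy2⟩ := coord_combo (p := p) hf (r / 2) (3 / 4 * r)
    have hybox : y₀ ∈ box p e n r := ⟨by rw [hy1, abs_of_pos (by positivity)]; linarith,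
      by rw [hy2, abs_of_pos (by positivity)]; linarith⟩
    have hysky : y₀ ∈ Q := H.sky_subset_component ⟨hybox, by
      show r / 2 < inner ℝ (y₀ - p) n
      rw [hy2]; linarith⟩
    rw [hQ, connectedComponentIn_eq hysky]
    apply hpre.subset_connectedComponentIn
    · exact ⟨⟨hy1, by show Y z < Y y₀; rw [show Y y₀ = _ from hy2]; linarith⟩, hybox⟩
    · rintro w ⟨⟨hw1, hw2⟩, hwb⟩
      have hw1 : X w = r / 2 := hw1
      have hw2 : Y z < Y w := hw2
      rcases lt_or_ge (r / 2) (Y w) with hs | hs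
      · exact H.sky_subset hwb hs
      · refine ⟨⟨(H.mem_iff w (box_mono (by linarith) hwb)).2 ?_, fun hwf => ?_⟩, hwb⟩
        · show η (X w) < Y w
          rw [hw1]; linarith
        · have := hzmax' w ⟨hwf, hw1, abs_le.2 ⟨by linarith, hs⟩⟩
          linarith
  -- `V` misses each piece of the barrier: above `z` the ray belongs to the component `Q` of the
  -- top, at and below `c` one is outside `S`, and the segment lies in `fat`.
  have av1 : ∀ w ∈ V, X w = X z → Y w < Y z := by
    intro w hw hwX
    by_contra hcon
    push Not at hcon
    rcases eq_or_lt_of_le hcon with heq | hlt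
    · have : w = z := hf.ext hwX heq.symm
      exact (hVD hw).1.2 (this ▸ hzfat)
    · exact Set.disjoint_left.1 hVq hw (hray ⟨⟨hwX.trans hzX, hlt⟩, (hVD hw).2⟩)
  have av2 : ∀ w ∈ V, X w = X c → Y c < Y w := by
    intro w hw hwX
    have := (H.mem_iff w (box_mono (by linarith) (hVD hw).2)).1 (hVD hw).1.1
    rw [show inner ℝ (w - p) e = X c from hwX, ← hcη] at this
    exact this
  have av3 : ∀ w ∈ V, w ∉ segment ℝ z c := fun w hw hws => (hVD hw).1.2 (hseg hws)
  have hmem : ∀ w (l : ℝ), 0 ≤ l → l ≤ 1 → X w = (1 - l) * X z + l * X c →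
      Y w = (1 - l) * Y z + l * Y c → w ∈ segment ℝ z c := by
    intro w l hl0 hl1 h1 h2
    refine ⟨1 - l, l, by linarith, hl0, by ring, ?_⟩
    have e1 : ∀ v : Plane, inner ℝ ((1 - l) • z + l • c - p) v =
        (1 - l) * inner ℝ (z - p) v + l * inner ℝ (c - p) v := by
      intro v
      rw [show (1 - l) • z + l • c - p = (1 - l) • (z - p) + l • (c - p) by module,
        inner_add_left, inner_smul_left, inner_smul_left]
      simp
    exact hf.ext (p := p) ((e1 e).trans h1.symm) ((e1 n).trans h2.symm)
  have hxx : X x < r / 4 := hxr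
  -- The cases distinguish whether `c` lies to the left of, below, or to the right of `z`. In the
  -- last one the sign of `Y` is reversed so that the downward ray again belongs to the left
  -- endpoint. In all cases the barrier stays left of `r / 2 + h < 3 / 4 * r`.
  have main : ∀ w ∈ V, X w < max (X z) (X c) := by
    rcases lt_trichotomy (X c) (X z) with hlt | heq | hgt
    · rw [max_eq_left hlt.le]
      refine hV.lt_of_avoids_barrier hXc hYc hlt.le av2 av1 ?_ hx (by linarith)
      intro w hw h1 h2 h3
      have hd : 0 < X z - X c := sub_pos.2 hlt
      refine av3 w hw (hmem w ((X z - X w) / (X z - X c)) (div_nonneg (by linarith) hd.le)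
        (by rw [div_le_one hd]; linarith) (by field_simp; ring) ?_)
      field_simp
      linear_combination h3
    · rw [heq, max_self]
      refine hV.lt_of_avoids_barrier (y₁ := Y c) (y₂ := Y z) hXc hYc le_rfl ?_ av1 ?_ hx (by linarith)
      · exact fun w hw hwX => av2 w hw (hwX.trans heq.symm)
      · intro w hw h1 h2 _
        have hwX : X w = X z := le_antisymm h2 h1
        have hy1 := av1 w hw hwX
        have hy2 := av2 w hw (hwX.trans heq.symm)
        have hd : 0 < Y z - Y c := by linarith
        refine av3 w hw (hmem w ((Y z - Y w) / (Y z - Y c)) (div_nonneg (by linarith) hd.le)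
          (by rw [div_le_one hd]; linarith) ?_ (by field_simp; ring))
        rw [heq, hwX]; ring
    · rw [max_eq_right hgt.le]
      refine hV.lt_of_avoids_barrier (Y := fun w => -Y w) (y₁ := -Y z) (y₂ := -Y c) hXc hYc.neg
        hgt.le (fun w hw hwX => neg_lt_neg (av1 w hw hwX)) (fun w hw hwX => neg_lt_neg (av2 w hw hwX))
        ?_ hx (by linarith)
      intro w hw h1 h2 h3
      have hd : 0 < X c - X z := sub_pos.2 hgt
      refine av3 w hw (hmem w ((X w - X z) / (X c - X z)) (div_nonneg (by linarith) hd.le)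
        (by rw [div_le_one hd]; linarith) (by field_simp; ring) ?_)
      field_simp
      linear_combination -h3
  intro w hw
  refine (main w hw).trans_le (max_le ?_ ?_) <;> linarith

theorem connectedComponentIn_isClosed_in {U : Set Plane} (hU : IsOpen U) {x y : Plane}
    (hy : y ∈ U) (hcl : y ∈ closure (connectedComponentIn U x)) : y ∈ connectedComponentIn U x := by
  obtain ⟨w, hwy, hwx⟩ := mem_closure_iff.1 hcl _ hU.connectedComponentIn
    (mem_connectedComponentIn hy)
  rw [connectedComponentIn_eq hwx, ← connectedComponentIn_eq hwy]
  exact mem_connectedComponentIn hy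

/-- Points of `S ∖ fat` near `p` are joined to the top of the box inside the box. -/
theorem mem_component_top (H : LocalSide P S fat p e n s₀ η r h)
    (hconn : IsPreconnected (S \ fat)) {x : Plane} (hx : x ∈ S \ fat)
    (hxb : x ∈ box p e n (r / 4)) :
    x ∈ connectedComponentIn ((S \ fat) ∩ box p e n r) (top p n r) := by
  have hr := H.graph.r_pos
  have hf := H.graph.frame
  set D := S \ fat with hD
  have hDo : IsOpen D := H.S_open.sdiff H.fat_closed
  have hUo : IsOpen (D ∩ box p e n r) := hDo.inter (isOpen_box _ _ _ _)
  set Q := connectedComponentIn (D ∩ box p e n r) (top p n r) with hQ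
  set V := connectedComponentIn (D ∩ box p e n r) x with hV
  have hxU : x ∈ D ∩ box p e n r := ⟨hx, box_mono (by linarith) hxb⟩
  have hxV : x ∈ V := mem_connectedComponentIn hxU
  have hVU : V ⊆ D ∩ box p e n r := connectedComponentIn_subset _ _
  by_contra hxQ
  have hdis : Disjoint V Q := by
    rw [Set.disjoint_left]
    intro w hwV hwQ
    apply hxQ
    rw [hQ, connectedComponentIn_eq hwQ, ← connectedComponentIn_eq hwV]
    exact hxV
  have hbe : ∀ r', box p (-e) n r' = box p e n r' := fun r' => by simp [box, inner_neg_right]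
  -- The right barrier and its mirror image confine `V` laterally. Below it is bounded by the graph,
  -- and above by the strip that belongs to `Q`.
  have h1 := H.lt_of_disjoint_component isPreconnected_connectedComponentIn hVU hdis hxV
    (abs_lt.1 hxb.1).2
  have h2 := H.neg_left.lt_of_disjoint_component (V := V) isPreconnected_connectedComponentIn
    (by rw [hbe]; exact hVU) (by rw [hbe]; exact hdis) hxV (by
      rw [inner_neg_right]; linarith [(abs_lt.1 hxb.1).1])
  have hVbox : V ⊆ {w | |inner ℝ (w - p) e| ≤ 3 / 4 * r} ∩ {w | |inner ℝ (w - p) n| ≤ 3 / 4 * r} := by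
    intro w hw
    have a1 := h1 w hw
    have a2 := h2 w hw
    rw [inner_neg_right] at a2
    have a3 : |inner ℝ (w - p) e| ≤ 3 / 4 * r := abs_le.2 ⟨by linarith, a1.le⟩
    suffices a4 : |inner ℝ (w - p) n| ≤ 3 / 4 * r from ⟨a3, a4⟩
    refine abs_le.2 ⟨?_, ?_⟩
    · have hw2 : w ∈ box p e n (2 * r) := box_mono (by linarith) (hVU hw).2
      have b1 := (H.mem_iff w hw2).1 (hVU hw).1.1
      have b2 := (abs_lt.1 (H.graph.abs_lt _ hw2.1)).1
      linarith
    · by_contra hcon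
      push Not at hcon
      exact Set.disjoint_left.1 hdis hw (H.sky_subset_component ⟨(hVU hw).2, by
        show r / 2 < inner ℝ (w - p) n
        linarith⟩)
  have hclbox : closure V ⊆ box p e n r := by
    have hcl : IsClosed ({w : Plane | |inner ℝ (w - p) e| ≤ 3 / 4 * r} ∩
        {w | |inner ℝ (w - p) n| ≤ 3 / 4 * r}) :=
      (isClosed_le (by fun_prop) continuous_const).inter (isClosed_le (by fun_prop) continuous_const)
    intro w hw
    have := closure_minimal hVbox hcl hw
    exact ⟨lt_of_le_of_lt this.1 (by linarith), lt_of_le_of_lt this.2 (by linarith)⟩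
  -- Global connectedness of `S \ fat` enters here. Since the closure of `V` stays inside the box,
  -- `V` is open and relatively closed in `D`, hence all of `D`; but `D` contains the top.
  have hDV : D ⊆ V := by
    refine hconn.subset_of_closure_inter_subset hUo.connectedComponentIn ⟨x, hx, hxV⟩ ?_
    rintro w ⟨hwcl, hwD⟩
    exact connectedComponentIn_isClosed_in hUo ⟨hwD, hclbox hwcl⟩ hwcl
  have htop := H.sky_subset H.top_mem.1 H.top_mem.2
  exact Set.disjoint_left.1 hdis (hDV htop.1) (mem_connectedComponentIn htop)

end LocalSide

/-! ### Triangles of the fattened crease line and uniform oscillation bounds -/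

/-- Truncating the parameters to `[a, b]` leaves the increments in `J` unchanged and the others
nonnegative, so the full sum may be taken, and it telescopes. -/
theorem sum_increments_le {N : ℕ} {t : Fin (N + 1) → ℝ} (ht : Monotone t) {a b : ℝ} (hab : a ≤ b)
    {J : Finset (Fin N)} (hJ : ∀ i ∈ J, a ≤ t i.castSucc ∧ t i.succ ≤ b) :
    ∑ i ∈ J, (t i.succ - t i.castSucc) ≤ b - a := by
  set g : ℝ → ℝ := fun s => max a (min b s) with hg
  have hgm : Monotone g := fun s s' h => max_le_max le_rfl (min_le_min le_rfl h)
  have hle : ∀ i : Fin N, t i.castSucc ≤ t i.succ := fun i => ht Fin.castSucc_lt_succ.le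
  have h1 : ∑ i ∈ J, (t i.succ - t i.castSucc) = ∑ i ∈ J, (g (t i.succ) - g (t i.castSucc)) := by
    refine Finset.sum_congr rfl fun i hi => ?_
    obtain ⟨h1, h2⟩ := hJ i hi
    have h3 := hle i
    simp only [hg]
    rw [min_eq_right h2, min_eq_right (h3.trans h2), max_eq_right h1, max_eq_right (h1.trans h3)]
  have h2 : ∑ i ∈ J, (g (t i.succ) - g (t i.castSucc)) ≤
      ∑ i : Fin N, (g (t i.succ) - g (t i.castSucc)) :=
    Finset.sum_le_sum_of_subset_of_nonneg (Finset.subset_univ _)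
      fun i _ _ => sub_nonneg.2 (hgm (hle i))
  have h3 : ∑ i : Fin N, (g (t i.succ) - g (t i.castSucc)) = g (t (Fin.last N)) - g (t 0) := by
    have e1 := Fin.sum_univ_succ fun i => g (t i)
    have e2 := Fin.sum_univ_castSucc fun i => g (t i)
    rw [Finset.sum_sub_distrib]; linarith
  have h4 : g (t (Fin.last N)) ≤ b := max_le hab (min_le_left _ _)
  have h5 : a ≤ g (t 0) := le_max_left _ _
  linarith

namespace CreaseApprox

variable {P : CreasedPlate} (A : CreaseApprox P)

theorem F_finite : A.F.Finite :=
  A.K_triangulation.finite.subset fun s hs => (A.F_faces s hs).1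

theorem isClosed_fat : IsClosed A.fat :=
  A.F_finite.isClosed_biUnion fun s _ => (s.finite_toSet.isCompact_convexHull (𝕜 := ℝ)).isClosed

theorem isOpen_dom : IsOpen A.dom := P.ω_open.sdiff A.isClosed_fat

theorem γ_subset_fat : P.γ ⊆ A.fat := A.crease_subset

theorem t_mem (i : Fin (A.N + 1)) : A.t i ∈ Set.Icc P.α P.β :=
  ⟨A.t_zero ▸ A.t_strictMono.monotone (Fin.zero_le i),
    A.t_last ▸ A.t_strictMono.monotone (Fin.le_last i)⟩

theorem vertex_mem_γ (i : Fin (A.N + 1)) : P.b (A.t i) ∈ P.γ := ⟨A.t i, A.t_mem i, rfl⟩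

theorem dist_le_of_mem_hull {s : Finset Plane} {h : ℝ} (hs : Metric.diam (s : Set Plane) ≤ h)
    {x y : Plane} (hx : x ∈ convexHull ℝ (s : Set Plane)) (hy : y ∈ convexHull ℝ (s : Set Plane)) :
    dist x y ≤ h := by
  rw [← convexHull_diam] at hs
  exact (Metric.dist_le_diam_of_mem
    (s.finite_toSet.isCompact_convexHull (𝕜 := ℝ)).isBounded hx hy).trans hs

variable {A}

theorem exists_vertex_near {h : ℝ} (hh : ∀ s ∈ A.K.faces, Metric.diam (s : Set Plane) ≤ h)
    {z : Plane} (hz : z ∈ A.fat) :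
    ∃ i, dist z (P.b (A.t i)) ≤ h ∧ segment ℝ z (P.b (A.t i)) ⊆ A.fat := by
  obtain ⟨s, hs, hzs⟩ := Set.mem_iUnion₂.1 hz
  obtain ⟨i, hi, -⟩ := A.F_segment s hs
  have hi' := subset_convexHull ℝ (s : Set Plane) (Finset.mem_coe.2 hi)
  exact ⟨_, dist_le_of_mem_hull (hh s (A.F_faces s hs).1) hzs hi',
    ((convex_convexHull ℝ _).segment_subset hzs hi').trans (Set.subset_biUnion_of_mem
      (u := fun s : Finset Plane => convexHull ℝ (s : Set Plane)) hs)⟩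

theorem fat_near {h : ℝ} (hh : ∀ s ∈ A.K.faces, Metric.diam (s : Set Plane) ≤ h) :
    ∀ z ∈ A.fat, ∃ c ∈ P.γ, dist z c ≤ h ∧ segment ℝ z c ⊆ A.fat := fun z hz => by
  obtain ⟨i, hi⟩ := exists_vertex_near hh hz
  exact ⟨_, A.vertex_mem_γ i, hi⟩

/-- On a fine mesh no segment of the polygonal crease line is degenerate. -/
theorem vertex_ne {h : ℝ} (hh : ∀ s ∈ A.K.faces, Metric.diam (s : Set Plane) ≤ h)
    {g₁ g₂ : Plane} (hg₁ : g₁ ∈ P.γ) (hg₂ : g₂ ∈ P.γ) (hg : 2 * h < dist g₁ g₂) (i : Fin A.N) :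
    P.b (A.t i.castSucc) ≠ P.b (A.t i.succ) := by
  intro heq
  have hlt : A.t i.castSucc < A.t i.succ := A.t_strictMono Fin.castSucc_lt_succ
  -- A degenerate segment requires a closed curve with `N = 1`. Then every triangle of `F` contains
  -- the single vertex, so the whole crease is within `h` of it, which the distance of `g₁` and `g₂`
  -- forbids.
  obtain ⟨h1, h2⟩ := P.b_simple _ (A.t_mem _) _ (A.t_mem _) hlt heq
  have h3 : i.castSucc = 0 := A.t_strictMono.injective (h1.trans A.t_zero.symm)
  have h4 : i.succ = Fin.last A.N := A.t_strictMono.injective (h2.trans A.t_last.symm)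
  have hN : A.N = 1 := by
    have a := congrArg Fin.val h3
    have b := congrArg Fin.val h4
    simp at a b
    omega
  have hall : ∀ z ∈ A.fat, dist z (P.b (A.t 0)) ≤ h := by
    intro z hz
    obtain ⟨s, hs, hzs⟩ := Set.mem_iUnion₂.1 hz
    obtain ⟨j, hj, -⟩ := A.F_segment s hs
    have hj0 : j.castSucc = 0 := by
      ext; have := j.2; simp; omega
    rw [hj0] at hj
    exact dist_le_of_mem_hull (hh s (A.F_faces s hs).1) hzs
      (subset_convexHull ℝ (s : Set Plane) (Finset.mem_coe.2 hj))
  have a := hall g₁ (A.γ_subset_fat hg₁)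
  have b := hall g₂ (A.γ_subset_fat hg₂)
  linarith [dist_triangle_right g₁ g₂ (P.b (A.t 0))]

theorem sub_diff_subset_dom (l : Fin 2) : P.sub l \ A.fat ⊆ A.dom := by
  intro z hz
  have : z ∈ P.ω \ P.b '' Set.Icc P.α P.β := by
    rw [P.sub_union]; fin_cases l
    exacts [Or.inl hz.1, Or.inr hz.1]
  exact ⟨this.1, hz.2⟩

theorem dom_subset (z : Plane) (hz : z ∈ A.dom) : ∃ l, z ∈ P.sub l \ A.fat := by
  have : z ∈ P.ω \ P.b '' Set.Icc P.α P.β := ⟨hz.1, fun h => hz.2 (A.γ_subset_fat h)⟩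
  rw [P.sub_union] at this
  rcases this with h | h
  exacts [⟨0, h, hz.2⟩, ⟨1, h, hz.2⟩]

end CreaseApprox

theorem CreasedPlate.sub_disjoint_of_ne (P : CreasedPlate) {l l' : Fin 2} (h : l ≠ l') :
    Disjoint (P.sub l) (P.sub l') := by
  fin_cases l <;> fin_cases l'
  · exact absurd rfl h
  · exact P.sub_disjoint
  · exact P.sub_disjoint.symm
  · exact absurd rfl h

/-- Each subdomain is relatively closed in `ω \ γ` because the other one is open and disjoint from
it. -/
theorem CreasedPlate.mem_sub_of_closure (P : CreasedPlate) {l : Fin 2} {y : Plane} (hy : y ∈ P.ω)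
    (hγ : y ∉ P.γ) (hcl : y ∈ closure (P.sub l)) : y ∈ P.sub l := by
  have : y ∈ P.ω \ P.b '' Set.Icc P.α P.β := ⟨hy, hγ⟩
  rw [P.sub_union] at this
  have key : ∀ l', y ∈ P.sub l' → y ∈ P.sub l := by
    intro l' h
    by_cases hl : l = l'
    · rwa [hl]
    · obtain ⟨z, hz1, hz2⟩ := mem_closure_iff.1 hcl _ (P.sub_lipschitz l').1 h
      exact absurd hz1 (Set.disjoint_left.1 (P.sub_disjoint_of_ne hl) hz2)
  rcases this with h | h
  exacts [key 0 h, key 1 h]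

namespace CreaseApprox

variable {P : CreasedPlate} {A : CreaseApprox P}

/-- Edge lengths are bounded by parameter increments since the arclength parametrization is
`1`-Lipschitz. The parameter window `[a, b]` makes the bound usable both for the whole crease and
for the part that enters a small box. -/
theorem sum_diam_F_le {κ : ℝ} (hκ : 0 < κ)
    (hreg : ∀ s ∈ A.K.faces, s.card = 3 →
      ∃ x, Metric.closedBall x (κ * Metric.diam (s : Set Plane)) ⊆ convexHull ℝ (s : Set Plane))
    (hne : ∀ i : Fin A.N, P.b (A.t i.castSucc) ≠ P.b (A.t i.succ))
    {S : Finset (Finset Plane)} (hS : ∀ s ∈ S, s ∈ A.F) {a b : ℝ} (hab : a ≤ b)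
    (hSt : ∀ s ∈ S, ∀ i, P.b (A.t i) ∈ s → a ≤ A.t i ∧ A.t i ≤ b) :
    ∑ s ∈ S, Metric.diam (s : Set Plane) ≤ (b - a) / κ := by
  classical
  rw [le_div_iff₀ hκ, mul_comm]
  set J : Finset (Fin A.N) := {i | a ≤ A.t i.castSucc ∧ A.t i.succ ≤ b} with hJ
  refine (sum_diam_le (K := A.K) (J := J) (c := fun i => P.b (A.t i.castSucc))
    (c' := fun i => P.b (A.t i.succ)) hκ (fun s hs => A.F_faces s (hS s hs))
    (fun s hs => hreg s (A.F_faces s (hS s hs)).1 (A.F_faces s (hS s hs)).2) ?_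
    (fun i _ => hne i)).trans ?_
  · intro s hs
    obtain ⟨i, hi1, hi2⟩ := A.F_segment s (hS s hs)
    exact ⟨i, by simp [hJ, (hSt s hs _ hi1).1, (hSt s hs _ hi2).2], hi1, hi2⟩
  · refine le_trans (Finset.sum_le_sum fun i _ => ?_)
      (sum_increments_le A.t_strictMono.monotone hab (J := J) (by simp [hJ]))
    refine (P.dist_b_le (A.t_mem _) (A.t_mem _)).trans ?_
    rw [abs_sub_comm, abs_of_pos (sub_pos.2 (A.t_strictMono Fin.castSucc_lt_succ))]

/-- A locally nonexpansive map oscillates by a bounded amount on each side of the fattened crease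
line, uniformly in the approximation. -/
theorem dist_le_of_mem_sub {κ : ℝ} (hκ : 0 < κ)
    (hreg : ∀ s ∈ A.K.faces, s.card = 3 →
      ∃ x, Metric.closedBall x (κ * Metric.diam (s : Set Plane)) ⊆ convexHull ℝ (s : Set Plane))
    (hne : ∀ i : Fin A.N, P.b (A.t i.castSucc) ≠ P.b (A.t i.succ)) {l : Fin 2} {C g₀ : ℝ}
    (hC : 0 ≤ C) (hg₀ : 0 < g₀)
    (hcol : ∀ g, 0 < g → g < g₀ →
      volume {z ∈ P.sub l | Metric.infDist z (P.sub l)ᶜ ≤ g} ≤ ENNReal.ofReal (C * g))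
    {E : Type*} [PseudoMetricSpace E] {w : Plane → E} (hw : LocNonexpansive A.dom w)
    {x y : Plane} (hx : x ∈ P.sub l \ A.fat) (hy : y ∈ P.sub l \ A.fat) :
    dist (w x) (w y) ≤ dist x y + 40 * (C + 10 / κ * ((P.β - P.α) / κ)) := by
  have hVo : IsOpen (P.sub l \ A.fat) := (P.sub_lipschitz l).1.sdiff A.isClosed_fat
  have hVb : Bornology.IsBounded (P.sub l \ A.fat) :=
    (P.sub_lipschitz l).2.2.1.subset Set.sdiff_subset
  have hconn : IsPreconnected (P.sub l \ A.fat) := (A.sub_connected l).isPreconnected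
  have hVc : ((P.sub l \ A.fat)ᶜ).Nonempty := by
    rw [Set.nonempty_compl]; intro h
    rw [h] at hVb
    exact NormedSpace.unbounded_univ ℝ Plane hVb
  set S := A.F_finite.toFinset with hS
  have hSF : ∀ s ∈ S, s ∈ A.F := fun s hs => A.F_finite.mem_toFinset.1 hs
  have hfat : A.fat = ⋃ s ∈ S, convexHull ℝ (s : Set Plane) := by simp [fat, hS]
  obtain ⟨g₁, hg₁, hcol'⟩ := volume_collar_le (S := S) hVo (Set.sdiff_subset) hκ hC hg₀
    (fun s hs => Set.disjoint_left.2 fun z hz hzs =>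
      hz.2 (Set.mem_iUnion₂.2 ⟨s, hSF s hs, hzs⟩))
    (by
      intro z hz
      by_contra hcon
      rw [Set.mem_union, not_or, ← hfat, Set.notMem_compl_iff] at hcon
      exact (hVo.frontier_eq ▸ hz).2 hcon) hVc
    (fun s hs => ⟨Finset.diam_pos_of_card (A.F_faces s (hSF s hs)).2,
      hreg s (A.F_faces s (hSF s hs)).1 (A.F_faces s (hSF s hs)).2⟩) hcol
  have hsum : ∑ s ∈ S, Metric.diam (s : Set Plane) ≤ (P.β - P.α) / κ :=
    sum_diam_F_le hκ hreg hne hSF P.α_lt_β.le fun s _ i _ => A.t_mem i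
  have hba : 0 ≤ P.β - P.α := sub_nonneg.2 P.α_lt_β.le
  refine (hw.mono (sub_diff_subset_dom l)).dist_le hVo hconn hVb (by positivity) hg₁
    (fun g hg hgg => (hcol' g hg hgg).trans ?_) hx hy
  apply ENNReal.ofReal_le_ofReal
  gcongr

/-- A locally nonexpansive map oscillates by at most a multiple of `r` between points near the
crease line and the top of a box of size `r`. -/
theorem dist_top_le {κ : ℝ} (hκ : 0 < κ)
    (hreg : ∀ s ∈ A.K.faces, s.card = 3 →
      ∃ x, Metric.closedBall x (κ * Metric.diam (s : Set Plane)) ⊆ convexHull ℝ (s : Set Plane))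
    (hne : ∀ i : Fin A.N, P.b (A.t i.castSucc) ≠ P.b (A.t i.succ)) {l : Fin 2} {h : ℝ}
    (hh : ∀ s ∈ A.K.faces, Metric.diam (s : Set Plane) ≤ h)
    {p e n : Plane} {s₀ : ℝ} {η : ℝ → ℝ} {r : ℝ}
    (H : LocalSide P (P.sub l) A.fat p e n s₀ η r h)
    {E : Type*} [PseudoMetricSpace E] {w : Plane → E} (hw : LocNonexpansive A.dom w)
    {x : Plane} (hx : x ∈ P.sub l \ A.fat) (hxb : x ∈ box p e n (r / 4)) :
    dist (w x) (w (LocalSide.top p n r)) ≤ (2100 + 2400 / κ ^ 2) * r := by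
  classical
  have hr := H.graph.r_pos
  have hconn : IsPreconnected (P.sub l \ A.fat) := (A.sub_connected l).isPreconnected
  have hDo : IsOpen (P.sub l \ A.fat) := (P.sub_lipschitz l).1.sdiff A.isClosed_fat
  set U := (P.sub l \ A.fat) ∩ box p e n r with hU
  have hUo : IsOpen U := hDo.inter (isOpen_box _ _ _ _)
  set V := connectedComponentIn U (LocalSide.top p n r) with hV
  have hxV : x ∈ V := H.mem_component_top hconn hx hxb
  have hVU : V ⊆ U := connectedComponentIn_subset _ _
  have htV : LocalSide.top p n r ∈ V :=
    mem_connectedComponentIn (H.sky_subset H.top_mem.1 H.top_mem.2)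
  have hVo : IsOpen V := hUo.connectedComponentIn
  have hbox : box p e n r ⊆ Metric.ball p (2 * r) := H.graph.frame.box_subset_ball p hr
  have hVb : Bornology.IsBounded V :=
    Metric.isBounded_ball.subset ((hVU.trans Set.inter_subset_right).trans hbox)
  have hVc : (Vᶜ).Nonempty := by
    rw [Set.nonempty_compl]; intro h
    rw [h] at hVb
    exact NormedSpace.unbounded_univ ℝ Plane hVb
  -- Only triangles meeting the closed box can contribute to the frontier of `V`. Their crease
  -- vertices lie in the box of half side `2 * r`, so their parameters are within `3 * r` of `s₀`
  -- and the diameters sum to at most `6 * r / κ`.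
  set S : Finset (Finset Plane) := A.F_finite.toFinset.filter fun s =>
    (convexHull ℝ (s : Set Plane) ∩ closure (box p e n r)).Nonempty with hS
  have hSF : ∀ s ∈ S, s ∈ A.F := fun s hs =>
    A.F_finite.mem_toFinset.1 (Finset.mem_filter.1 hs).1
  have hWcol : ∀ g, 0 < g → g < r / 2 →
      volume {z ∈ box p e n r | Metric.infDist z (box p e n r)ᶜ ≤ g} ≤
        ENNReal.ofReal (51 * r * g) := by
    intro g hg hgr
    refine ((convex_box p e n r).volume_inner_collar_le (isOpen_box _ _ _ _) hr
      (by positivity : 0 ≤ 2 * r) hg (by linarith) (H.graph.frame.ball_subset_box p r)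
      (hbox.trans Metric.ball_subset_closedBall)).trans (ENNReal.ofReal_le_ofReal ?_)
    have : 4 / r * (Real.pi * (2 * r) ^ 2) = 16 * Real.pi * r := by field_simp; ring
    rw [this]
    gcongr
    linarith [Real.pi_lt_d2]
  obtain ⟨g₁, hg₁, hcol'⟩ := volume_collar_le (S := S) hVo (hVU.trans Set.inter_subset_right) hκ
    (by positivity : 0 ≤ 51 * r) (by positivity : 0 < r / 2)
    (fun s hs => Set.disjoint_left.2 fun z hz hzs =>
      (hVU hz).1.2 (Set.mem_iUnion₂.2 ⟨s, hSF s hs, hzs⟩))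
    (by
      intro y hy
      have hyV : y ∉ V := (hVo.frontier_eq ▸ hy).2
      have hycl : y ∈ closure V := frontier_subset_closure hy
      -- A frontier point inside the box but off the triangles would lie in the open set `U`, and
      -- components of `U` are relatively closed.
      by_cases hyb : y ∈ box p e n r
      · right
        by_contra hyS
        have hyfat : y ∉ A.fat := by
          intro hyf
          obtain ⟨s, hs, hys⟩ := Set.mem_iUnion₂.1 hyf
          exact hyS (Set.mem_iUnion₂.2 ⟨s, Finset.mem_filter.2
            ⟨A.F_finite.mem_toFinset.2 hs, y, hys, subset_closure hyb⟩, hys⟩)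
        have hyω : y ∈ P.ω := H.graph.box_subset (box_mono (by linarith) hyb)
        have hysub : y ∈ P.sub l := P.mem_sub_of_closure hyω
          (fun hγ => hyfat (A.γ_subset_fat hγ))
          (closure_mono (fun z hz => (hVU hz).1.1) hycl)
        exact hyV (LocalSide.connectedComponentIn_isClosed_in hUo ⟨⟨hysub, hyfat⟩, hyb⟩ hycl)
      · exact Or.inl hyb) hVc
    (fun s hs => ⟨Finset.diam_pos_of_card (A.F_faces s (hSF s hs)).2,
      hreg s (A.F_faces s (hSF s hs)).1 (A.F_faces s (hSF s hs)).2⟩) hWcol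
  have hsum : ∑ s ∈ S, Metric.diam (s : Set Plane) ≤ ((s₀ + 3 * r) - (s₀ - 3 * r)) / κ := by
    refine sum_diam_F_le hκ hreg hne hSF (by linarith) fun s hs i hi => ?_
    obtain ⟨y, hys, hycl⟩ := (Finset.mem_filter.1 hs).2
    have hd : dist y (P.b (A.t i)) ≤ h := dist_le_of_mem_hull (hh s (A.F_faces s (hSF s hs)).1) hys
      (subset_convexHull ℝ (s : Set Plane) (Finset.mem_coe.2 hi))
    have hyb : y ∈ box p e n (r + r / 2) := by
      have hcl : IsClosed ({w : Plane | |inner ℝ (w - p) e| ≤ r} ∩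
          {w | |inner ℝ (w - p) n| ≤ r}) :=
        (isClosed_le (by fun_prop) continuous_const).inter
          (isClosed_le (by fun_prop) continuous_const)
      have h1 := closure_minimal (s := box p e n r) (t := {w : Plane | |inner ℝ (w - p) e| ≤ r} ∩
          {w | |inner ℝ (w - p) n| ≤ r}) (fun w hw => ⟨hw.1.le, hw.2.le⟩) hcl hycl
      exact ⟨lt_of_le_of_lt h1.1 (by linarith), lt_of_le_of_lt h1.2 (by linarith)⟩
    have hb2 := box_mono (show r + r / 2 + h ≤ 2 * r by linarith [H.h_lt]) (H.mem_box_of_dist hyb hd)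
    have := abs_le.1 (H.graph.param _ (A.t_mem i) hb2)
    constructor <;> linarith
  -- The box contributes `51 * r`, from `16 * π ≤ 51`, and the triangles `10 / κ * (6 * r / κ)`.
  have hcolA : ∀ g, 0 < g → g < g₁ → volume {z ∈ V | Metric.infDist z Vᶜ ≤ g} ≤
      ENNReal.ofReal ((51 + 60 / κ ^ 2) * r * g) := by
    intro g hg hgg
    refine (hcol' g hg hgg).trans (ENNReal.ofReal_le_ofReal ?_)
    gcongr
    calc 51 * r + 10 / κ * ∑ s ∈ S, Metric.diam (s : Set Plane)
        ≤ 51 * r + 10 / κ * (((s₀ + 3 * r) - (s₀ - 3 * r)) / κ) := by gcongr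
      _ = (51 + 60 / κ ^ 2) * r := by field_simp; ring
  have hVdom : V ⊆ A.dom := fun z hz => sub_diff_subset_dom l (hVU hz).1
  have := (hw.mono hVdom).dist_le hVo isPreconnected_connectedComponentIn hVb
    (by positivity) hg₁ hcolA hxV htV
  have hd : dist x (LocalSide.top p n r) ≤ 4 * r := by
    have h1 := hbox (hVU hxV).2
    have h2 := hbox (hVU htV).2
    rw [Metric.mem_ball] at h1 h2
    linarith [dist_triangle_right x (LocalSide.top p n r) p]
  -- The term `2040 * r` and the distance, at most `4 * r`, are absorbed into `2100 * r`.
  have e1 : 40 * ((51 + 60 / κ ^ 2) * r) = 2040 * r + 2400 / κ ^ 2 * r := by ring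
  nlinarith

end CreaseApprox

/-! ### The two sides of the crease line and the link between them -/

namespace CreasedPlate

variable (P : CreasedPlate)

theorem mem_sub_of_mem {z : Plane} (hz : z ∈ P.ω) (hγ : z ∉ P.γ) : ∃ l, z ∈ P.sub l := by
  have : z ∈ P.ω \ P.b '' Set.Icc P.α P.β := ⟨hz, hγ⟩
  rw [P.sub_union] at this
  rcases this with h | h
  exacts [⟨0, h⟩, ⟨1, h⟩]

theorem sub_subset (l : Fin 2) : P.sub l ⊆ P.ω \ P.γ := by
  show P.sub l ⊆ P.ω \ P.b '' Set.Icc P.α P.β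
  rw [P.sub_union]; fin_cases l
  exacts [Set.subset_union_left, Set.subset_union_right]

theorem subset_sub_of_isPreconnected {Q : Set Plane} (hQ : IsPreconnected Q)
    (hQω : Q ⊆ P.ω \ P.γ) : ∃ l, Q ⊆ P.sub l := by
  rcases hQ.subset_or_subset (P.sub_lipschitz 0).1 (P.sub_lipschitz 1).1 P.sub_disjoint
    (fun z hz => by
      have : z ∈ P.ω \ P.b '' Set.Icc P.α P.β := hQω hz
      rwa [P.sub_union] at this) with h | h
  exacts [⟨0, h⟩, ⟨1, h⟩]

end CreasedPlate

namespace LocalGraph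

variable {P : CreasedPlate} {p e n : Plane} {s₀ : ℝ} {η : ℝ → ℝ} {r : ℝ}

/-- No continuity of `η` is assumed: each point is joined by a vertical segment to the convex strip
above height `r / 2`, which lies above the graph. -/
theorem isPreconnected_epigraph (G : LocalGraph P p e n s₀ η r) :
    IsPreconnected {z ∈ box p e n (2 * r) | η (inner ℝ (z - p) e) < inner ℝ (z - p) n} := by
  have hr := G.r_pos
  have hsky : ∀ z ∈ box p e n (2 * r) ∩ {w | r / 2 < inner ℝ (w - p) n},
      η (inner ℝ (z - p) e) < inner ℝ (z - p) n := fun z hz => by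
    have h1 := (_root_.abs_lt.1 (G.abs_lt _ hz.1.1)).2
    have h2 : r / 2 < inner ℝ (z - p) n := hz.2
    linarith
  have hmem : ∀ ξ, |ξ| < 2 * r → p + (ξ • e + r • n) ∈
      box p e n (2 * r) ∩ {w | r / 2 < inner ℝ (w - p) n} := fun ξ hξ => by
    obtain ⟨h1, h2⟩ := LocalSide.coord_combo (p := p) G.frame ξ r
    refine ⟨⟨by rwa [h1], by rw [h2, abs_of_pos hr]; linarith⟩, ?_⟩
    show r / 2 < inner ℝ _ n
    rw [h2]; linarith
  have h0 := hmem 0 (by simpa using hr)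
  refine isPreconnected_of_forall (p + ((0 : ℝ) • e + r • n)) ?_
  rintro y ⟨hyb, hy⟩
  obtain ⟨h1, h2⟩ := LocalSide.coord_combo (p := p) G.frame (inner ℝ (y - p) e) r
  refine ⟨({w | inner ℝ (w - p) e = inner ℝ (y - p) e} ∩
      {w | η (inner ℝ (y - p) e) < inner ℝ (w - p) n} ∩ box p e n (2 * r)) ∪
      (box p e n (2 * r) ∩ {w | r / 2 < inner ℝ (w - p) n}), ?_, Or.inr h0,
      Or.inl ⟨⟨rfl, hy⟩, hyb⟩, ?_⟩
  · rintro w (⟨⟨hw1, hw2⟩, hwb⟩ | hw)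
    · refine ⟨hwb, ?_⟩
      have hw1 : inner ℝ (w - p) e = inner ℝ (y - p) e := hw1
      rw [hw1]; exact hw2
    · exact ⟨hw.1, hsky w hw⟩
  · refine IsPreconnected.union (p + ((inner ℝ (y - p) e : ℝ) • e + r • n)) ?_ (hmem _ hyb.1)
      (((LocalSide.convex_line p e _).inter (LocalSide.convex_half p n _)).inter
        (convex_box p e n _)).isPreconnected
      ((convex_box p e n _).inter (LocalSide.convex_half p n _)).isPreconnected
    refine ⟨⟨h1, ?_⟩, (hmem _ hyb.1).1⟩
    show _ < inner ℝ _ n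
    have := hsky _ (hmem _ hyb.1)
    rwa [h1] at this

theorem exists_epigraph_subset (G : LocalGraph P p e n s₀ η r) :
    ∃ l, {z ∈ box p e n (2 * r) | η (inner ℝ (z - p) e) < inner ℝ (z - p) n} ⊆ P.sub l :=
  P.subset_sub_of_isPreconnected G.isPreconnected_epigraph fun z hz =>
    ⟨G.box_subset hz.1, fun hγ => hz.2.ne' ((G.mem_iff z hz.1).1 hγ)⟩

/-- Near a regular point the two subdomains lie on different sides of the crease line. -/
theorem exists_sides (G : LocalGraph P p e n s₀ η r) (hp : ∀ l, p ∈ closure (P.sub l)) :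
    ∃ l₁ l₂, l₁ ≠ l₂ ∧
      (∀ z ∈ box p e n (2 * r), z ∈ P.sub l₁ ↔ η (inner ℝ (z - p) e) < inner ℝ (z - p) n) ∧
      ∀ z ∈ box p e n (2 * r), z ∈ P.sub l₂ ↔ inner ℝ (z - p) n < η (inner ℝ (z - p) e) := by
  have hr := G.r_pos
  obtain ⟨l₁, h₁⟩ := G.exists_epigraph_subset
  obtain ⟨l₂, h₂'⟩ := G.neg_right.exists_epigraph_subset
  have h₂ : ∀ z ∈ box p e n (2 * r), inner ℝ (z - p) n < η (inner ℝ (z - p) e) → z ∈ P.sub l₂ := by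
    intro z hz hlt
    refine h₂' ⟨by simpa [box, inner_neg_right] using hz, ?_⟩
    rw [inner_neg_right]; exact neg_lt_neg hlt
  have hne : ∀ l, ∀ z ∈ box p e n (2 * r), z ∈ P.sub l →
      inner ℝ (z - p) n ≠ η (inner ℝ (z - p) e) :=
    fun l z hz hzl heq => (P.sub_subset l hzl).2 ((G.mem_iff z hz).2 heq)
  -- If both sides of the graph belonged to one subdomain, the other would have no points in the
  -- box, although `p` is in its closure.
  have h12 : l₁ ≠ l₂ := by
    rintro rfl
    obtain ⟨l', hl'⟩ : ∃ l' : Fin 2, l' ≠ l₁ := exists_ne _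
    have hpb : p ∈ box p e n (2 * r) := ⟨by simpa using hr, by simpa using hr⟩
    obtain ⟨z, hzb, hzl⟩ := mem_closure_iff.1 (hp l') _ (isOpen_box p e n _) hpb
    have hd := Set.disjoint_left.1 (P.sub_disjoint_of_ne hl') hzl
    rcases lt_or_gt_of_ne (hne l' z hzb hzl) with h | h
    · exact hd (h₂ z hzb h)
    · exact hd (h₁ ⟨hzb, h⟩)
  refine ⟨l₁, l₂, h12, fun z hz => ⟨fun hzl => ?_, fun h => h₁ ⟨hz, h⟩⟩,
    fun z hz => ⟨fun hzl => ?_, h₂ z hz⟩⟩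
  · exact (lt_or_gt_of_ne (hne _ z hz hzl)).resolve_left fun h =>
      Set.disjoint_left.1 (P.sub_disjoint_of_ne h12) hzl (h₂ z hz h)
  · exact (lt_or_gt_of_ne (hne _ z hz hzl)).resolve_right fun h =>
      Set.disjoint_left.1 (P.sub_disjoint_of_ne h12) (h₁ ⟨hz, h⟩) hzl

end LocalGraph

/-- The assumption on the vertices is passed to the limit: on a fine mesh a vertex near `p` lies in
`ω`, hence in the closure of both sides by `vertex_mem`. -/
theorem CreaseApprox.mem_closure_sub {P : CreasedPlate} {A : ℕ → CreaseApprox P}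
    (hmesh : MeshSizeVanishes A) {p : Plane} (hp : p ∈ P.γ) (hpω : p ∈ P.ω) (l : Fin 2) :
    p ∈ closure (P.sub l) := by
  rw [Metric.mem_closure_iff]
  intro ε hε
  obtain ⟨ρ, hρ, hball⟩ := Metric.isOpen_iff.1 P.ω_open p hpω
  obtain ⟨m, hm⟩ := (hmesh (min (ε / 2) (ρ / 2)) (by positivity)).exists
  obtain ⟨i, hi, -⟩ := CreaseApprox.exists_vertex_near hm ((A m).γ_subset_fat hp)
  have hiω : P.b ((A m).t i) ∈ P.ω := hball (by
    rw [Metric.mem_ball, dist_comm]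
    exact hi.trans_lt ((min_le_right _ _).trans_lt (by linarith)))
  obtain ⟨z, hz, hzd⟩ := Metric.mem_closure_iff.1 ((A m).vertex_mem i hiω l) (ε / 2) (by positivity)
  refine ⟨z, hz.1, ?_⟩
  have := hi.trans (min_le_left _ _)
  linarith [dist_triangle p (P.b ((A m).t i)) z]

/-- Near a regular point of the crease line there are points on both sides at which the values of
an admissible map differ by at most a multiple of their distance. -/
theorem LocalGraph.exists_link {P : CreasedPlate} {p e n : Plane} {s₀ : ℝ} {η : ℝ → ℝ} {r : ℝ}
    (G : LocalGraph P p e n s₀ η r) (hpγ : p ∈ P.γ) (hp : ∀ l, p ∈ closure (P.sub l)) :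
    ∃ z : Fin 2 → Plane, (∀ l, z l ∈ P.sub l ∧ dist (z l) p ≤ r) ∧
      ∀ (A : CreaseApprox P) (κ h : ℝ), 0 < κ → h < r / 16 →
        (∀ s ∈ A.K.faces, Metric.diam (s : Set Plane) ≤ h) →
        (∀ s ∈ A.K.faces, s.card = 3 →
          ∃ x, Metric.closedBall x (κ * Metric.diam (s : Set Plane)) ⊆
            convexHull ℝ (s : Set Plane)) →
        (∀ i : Fin A.N, P.b (A.t i.castSucc) ≠ P.b (A.t i.succ)) →
        ∀ w : Plane → Space3, LocNonexpansive A.dom w →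
          ContinuousOn w (A.dom ∪ Set.range A.vertex) →
          (∀ l, z l ∉ A.fat) ∧ dist (w (z 0)) (w (z 1)) ≤ 2 * ((2100 + 2400 / κ ^ 2) * r) := by
  have hr := G.r_pos
  obtain ⟨l₁, l₂, h12, hs₁, hs₂⟩ := G.exists_sides hp
  have hbn : ∀ r', box p e (-n) r' = box p e n r' := fun r' => by simp [box, inner_neg_right]
  -- The reference points depend only on the box and not on the approximation, so the limit map can
  -- be evaluated at them.
  set q₁ := LocalSide.top p n r with hq₁
  set q₂ := LocalSide.top p (-n) r with hq₂
  have hqd : ∀ v : Plane, ‖v‖ = 1 → dist (LocalSide.top p v r) p ≤ r := by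
    intro v hv
    rw [LocalSide.top, dist_eq_norm, add_sub_cancel_left, norm_smul, hv, mul_one,
      Real.norm_of_nonneg (by positivity)]
    linarith
  have hq1s : q₁ ∈ P.sub l₁ := by
    obtain ⟨h1, h2⟩ := LocalSide.top_coord (p := p) (r := r) G.frame
    have h0 := (_root_.abs_lt.1 (G.abs_lt 0 (by simpa using hr))).2
    refine (hs₁ _ ⟨by rw [h1]; simpa, by rw [h2, abs_of_pos (by positivity)]; linarith⟩).2 ?_
    rw [h1, h2]; linarith
  have hq2s : q₂ ∈ P.sub l₂ := by
    obtain ⟨h1, h2⟩ := LocalSide.top_coord (p := p) (r := r) G.frame.neg_right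
    rw [inner_neg_right] at h2
    have h0 := (_root_.abs_lt.1 (G.abs_lt 0 (by simpa using hr))).1
    refine (hs₂ _ ⟨by rw [h1]; simpa, by rw [← abs_neg, h2, abs_of_pos (by positivity)]; linarith⟩).2 ?_
    rw [h1]; linarith
  have key : ∀ (A : CreaseApprox P) (κ h : ℝ), 0 < κ → h < r / 16 →
        (∀ s ∈ A.K.faces, Metric.diam (s : Set Plane) ≤ h) →
        (∀ s ∈ A.K.faces, s.card = 3 →
          ∃ x, Metric.closedBall x (κ * Metric.diam (s : Set Plane)) ⊆
            convexHull ℝ (s : Set Plane)) →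
        (∀ i : Fin A.N, P.b (A.t i.castSucc) ≠ P.b (A.t i.succ)) →
        ∀ w : Plane → Space3, LocNonexpansive A.dom w →
          ContinuousOn w (A.dom ∪ Set.range A.vertex) →
          q₁ ∉ A.fat ∧ q₂ ∉ A.fat ∧ dist (w q₁) (w q₂) ≤ 2 * ((2100 + 2400 / κ ^ 2) * r) := by
    intro A κ h hκ hhr hh hreg hne w hw hwc
    obtain ⟨i, hi, -⟩ := CreaseApprox.exists_vertex_near hh (A.γ_subset_fat hpγ)
    have hh0 : 0 ≤ h := dist_nonneg.trans hi
    have H₁ : LocalSide P (P.sub l₁) A.fat p e n s₀ η r h :=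
      ⟨G, hs₁, (P.sub_lipschitz l₁).1, A.isClosed_fat, A.γ_subset_fat,
        CreaseApprox.fat_near hh, hh0, hhr⟩
    have H₂ : LocalSide P (P.sub l₂) A.fat p e (-n) s₀ (fun ξ => -η ξ) r h := by
      refine ⟨G.neg_right, ?_, (P.sub_lipschitz l₂).1, A.isClosed_fat, A.γ_subset_fat,
        CreaseApprox.fat_near hh, hh0, hhr⟩
      intro z hz
      rw [hbn] at hz
      rw [hs₂ z hz, inner_neg_right, neg_lt_neg_iff]
    refine ⟨(H₁.sky_subset H₁.top_mem.1 H₁.top_mem.2).1.2,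
      (H₂.sky_subset H₂.top_mem.1 H₂.top_mem.2).1.2, ?_⟩
    set c := P.b (A.t i) with hc
    have hpb : p ∈ box p e n (r / 8) := ⟨by simpa using hr, by simpa using hr⟩
    have hcb : c ∈ box p e n (r / 4) := box_mono (by linarith) (H₁.mem_box_of_dist hpb hi)
    have hcω : c ∈ P.ω := G.box_subset (box_mono (by linarith) hcb)
    -- The vertex `c` is a limit of points of either side, so continuity at `c` extends the
    -- one-sided oscillation bound to it. This is where the continuity condition of the admissible
    -- set ties the two sides together.
    have bound : ∀ l q C, (∀ x ∈ P.sub l \ A.fat, x ∈ box p e n (r / 4) → dist (w x) (w q) ≤ C) →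
        dist (w c) (w q) ≤ C := by
      intro l q C hx
      have hcl : c ∈ closure ((P.sub l \ A.fat) ∩ box p e n (r / 4)) := by
        have := (isOpen_box p e n (r / 4)).inter_closure
          (t := P.sub l \ A.fat) ⟨hcb, A.vertex_mem i hcω l⟩
        rwa [Set.inter_comm]
      have hcw : ContinuousWithinAt w ((P.sub l \ A.fat) ∩ box p e n (r / 4)) c :=
        (hwc c (Or.inr ⟨i, rfl⟩)).mono fun x hx =>
          Or.inl (CreaseApprox.sub_diff_subset_dom l hx.1)
      have := mem_closure_iff_nhdsWithin_neBot.1 hcl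
      have ht : Tendsto (fun x => dist (w x) (w q)) (𝓝[(P.sub l \ A.fat) ∩ box p e n (r / 4)] c)
        (𝓝 (dist (w c) (w q))) := (hcw.tendsto).dist tendsto_const_nhds
      exact le_of_tendsto ht (eventually_mem_nhdsWithin.mono fun x hx' => hx x hx'.1 hx'.2)
    have b1 := bound l₁ q₁ _ fun x hx hxb =>
      CreaseApprox.dist_top_le hκ hreg hne hh H₁ hw hx hxb
    have b2 := bound l₂ q₂ _ fun x hx hxb =>
      CreaseApprox.dist_top_le hκ hreg hne hh H₂ hw hx (by rwa [hbn])
    linarith [dist_triangle_left (w q₁) (w q₂) (w c)]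
  have hcases : (l₁ = 0 ∧ l₂ = 1) ∨ (l₁ = 1 ∧ l₂ = 0) := by omega
  have hd1 := hqd n G.frame.norm_right
  have hd2 := hqd (-n) (by rw [norm_neg, G.frame.norm_right])
  rcases hcases with ⟨rfl, rfl⟩ | ⟨rfl, rfl⟩
  · refine ⟨![q₁, q₂], fun l => ?_, fun A κ h h1 h2 h3 h4 h5 w hw hwc => ?_⟩
    · fin_cases l
      exacts [⟨hq1s, hd1⟩, ⟨hq2s, hd2⟩]
    · obtain ⟨a, b, c⟩ := key A κ h h1 h2 h3 h4 h5 w hw hwc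
      refine ⟨fun l => ?_, c⟩
      fin_cases l
      exacts [a, b]
  · refine ⟨![q₂, q₁], fun l => ?_, fun A κ h h1 h2 h3 h4 h5 w hw hwc => ?_⟩
    · fin_cases l
      exacts [⟨hq2s, hd2⟩, ⟨hq1s, hd1⟩]
    · obtain ⟨a, b, c⟩ := key A κ h h1 h2 h3 h4 h5 w hw hwc
      refine ⟨fun l => ?_, by rw [dist_comm]; exact c⟩
      fin_cases l
      exacts [b, a]

/-! ### Weak derivatives -/

theorem MeasureTheory.LocallyIntegrableOn.integrable_smul_of_tsupport_subset {U : Set Plane}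
    {E : Type*} [NormedAddCommGroup E] [NormedSpace ℝ E] {f : Plane → E} {φ : Plane → ℝ}
    (hf : LocallyIntegrableOn f U) (hφ : Continuous φ) (hc : HasCompactSupport φ)
    (ht : tsupport φ ⊆ U) : Integrable fun x => φ x • f x := by
  have h1 : IntegrableOn (fun x => φ x • f x) (tsupport φ) :=
    (hf.integrableOn_compact_subset ht hc).continuousOn_smul hφ.continuousOn hc
  refine (integrableOn_iff_integrable_of_support_subset fun x hx => ?_).1 h1
  by_contra h
  exact hx (by simp [image_eq_zero_of_notMem_tsupport h])

theorem setIntegral_eq_integral_of_tsupport_subset {U : Set Plane} {E : Type*}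
    [NormedAddCommGroup E] [NormedSpace ℝ E] {f : Plane → E} {φ : Plane → ℝ}
    (ht : tsupport φ ⊆ U) : ∫ x in U, φ x • f x = ∫ x, φ x • f x :=
  setIntegral_eq_integral_of_forall_compl_eq_zero fun x hx => by
    rw [image_eq_zero_of_notMem_tsupport fun h => hx (ht h), zero_smul]

theorem tsupport_fderiv_apply_subset' (φ : Plane → ℝ) (v : Plane) :
    tsupport (fun x => fderiv ℝ φ x v) ⊆ tsupport φ :=
  tsupport_fderiv_apply_subset ℝ v

namespace IsWeakPartial

variable {U W : Set Plane} {j : Fin 2} {f f' g g' : Plane → Space3}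

theorem integral_eq (h : IsWeakPartial U j f g) {φ : Plane → ℝ}
    (hφ : ContDiff ℝ (⊤ : ℕ∞) φ) (hc : HasCompactSupport φ) (ht : tsupport φ ⊆ U) :
    ∫ x, fderiv ℝ φ x (EuclideanSpace.single j 1) • f x = -∫ x, φ x • g x := by
  rw [← setIntegral_eq_integral_of_tsupport_subset ht,
    ← setIntegral_eq_integral_of_tsupport_subset ((tsupport_fderiv_apply_subset' φ _).trans ht)]
  exact h.2.2 φ hφ hc ht

theorem of_integral_eq (hf : LocallyIntegrableOn f U) (hg : LocallyIntegrableOn g U)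
    (h : ∀ φ : Plane → ℝ, ContDiff ℝ (⊤ : ℕ∞) φ → HasCompactSupport φ → tsupport φ ⊆ U →
      ∫ x, fderiv ℝ φ x (EuclideanSpace.single j 1) • f x = -∫ x, φ x • g x) :
    IsWeakPartial U j f g := by
  refine ⟨hf, hg, fun φ hφ hc ht => ?_⟩
  rw [setIntegral_eq_integral_of_tsupport_subset ht,
    setIntegral_eq_integral_of_tsupport_subset ((tsupport_fderiv_apply_subset' φ _).trans ht)]
  exact h φ hφ hc ht

theorem mono (h : IsWeakPartial U j f g) (hW : W ⊆ U) : IsWeakPartial W j f g :=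
  of_integral_eq (h.1.mono_set hW) (h.2.1.mono_set hW)
    fun _ hφ hc ht => h.integral_eq hφ hc (ht.trans hW)

theorem congr_ae (h : IsWeakPartial U j f g) (hf : f =ᵐ[volume.restrict U] f')
    (hg : g =ᵐ[volume.restrict U] g') : IsWeakPartial U j f' g' := by
  refine ⟨h.1.congr hf, h.2.1.congr hg, fun φ hφ hc ht => ?_⟩
  have e1 : ∫ x in U, fderiv ℝ φ x (EuclideanSpace.single j 1) • f' x =
      ∫ x in U, fderiv ℝ φ x (EuclideanSpace.single j 1) • f x :=
    integral_congr_ae (hf.mono fun x hx => by simp only [hx])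
  have e2 : ∫ x in U, φ x • g' x = ∫ x in U, φ x • g x :=
    integral_congr_ae (hg.mono fun x hx => by simp only [hx])
  rw [e1, e2, h.2.2 φ hφ hc ht]

theorem integrable_smul (h : IsWeakPartial U j f g) {φ : Plane → ℝ}
    (hφ : Continuous φ) (hc : HasCompactSupport φ) (ht : tsupport φ ⊆ U) :
    Integrable (fun x => φ x • g x) :=
  h.2.1.integrable_smul_of_tsupport_subset hφ hc ht

theorem integrable_fderiv_smul (h : IsWeakPartial U j f g) {φ : Plane → ℝ}
    (hφ : ContDiff ℝ (⊤ : ℕ∞) φ) (hc : HasCompactSupport φ) (ht : tsupport φ ⊆ U) (v : Plane) :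
    Integrable (fun x => fderiv ℝ φ x v • f x) :=
  h.1.integrable_smul_of_tsupport_subset
    ((hφ.continuous_fderiv (by simp)).clm_apply continuous_const) (hc.fderiv_apply ℝ v)
    ((tsupport_fderiv_apply_subset' φ _).trans ht)

theorem add (h : IsWeakPartial U j f g) (h' : IsWeakPartial U j f' g') :
    IsWeakPartial U j (fun x => f x + f' x) (fun x => g x + g' x) := by
  refine of_integral_eq (h.1.add h'.1) (h.2.1.add h'.2.1) fun φ hφ hc ht => ?_
  simp only [smul_add]
  rw [integral_add (h.integrable_fderiv_smul hφ hc ht _) (h'.integrable_fderiv_smul hφ hc ht _),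
    integral_add (h.integrable_smul hφ.continuous hc ht) (h'.integrable_smul hφ.continuous hc ht),
    h.integral_eq hφ hc ht, h'.integral_eq hφ hc ht, neg_add]

theorem const_smul (c : ℝ) (h : IsWeakPartial U j f g) :
    IsWeakPartial U j (fun x => c • f x) (fun x => c • g x) := by
  refine of_integral_eq (h.1.smul c) (h.2.1.smul c) fun φ hφ hc ht => ?_
  simp only [smul_comm _ c]
  rw [integral_smul, integral_smul, h.integral_eq hφ hc ht, smul_neg]

theorem sub (h : IsWeakPartial U j f g) (h' : IsWeakPartial U j f' g') :
    IsWeakPartial U j (fun x => f x - f' x) (fun x => g x - g' x) := by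
  simpa [sub_eq_add_neg] using h.add (h'.const_smul (-1))

theorem ae_eq (hU : IsOpen U) (h : IsWeakPartial U j f g) (h' : IsWeakPartial U j f g') :
    g =ᵐ[volume.restrict U] g' := by
  have h0 : ∀ᵐ x, x ∈ U → g x - g' x = 0 := by
    refine hU.ae_eq_zero_of_integral_contDiff_smul_eq_zero (h.2.1.sub h'.2.1) fun φ hφ hc ht => ?_
    have hz := h.integral_eq hφ hc ht
    rw [h'.integral_eq hφ hc ht, neg_inj] at hz
    simp only [smul_sub]
    rw [integral_sub (h.integrable_smul hφ.continuous hc ht)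
      (h'.integrable_smul hφ.continuous hc ht), hz, sub_self]
  rw [Filter.EventuallyEq, ae_restrict_iff' hU.measurableSet]
  exact h0.mono fun x hx hxU => sub_eq_zero.1 (hx hxU)

theorem weakPartial_ae_eq (hU : IsOpen U) (h : IsWeakPartial U j f g) :
    weakPartial U j f =ᵐ[volume.restrict U] g := by
  have hex : HasWeakPartial U j f := ⟨g, h⟩
  rw [weakPartial, dif_pos hex]
  exact ae_eq hU (Classical.choose_spec hex) h

end IsWeakPartial

theorem HasWeakPartial.isWeakPartial {U : Set Plane} {j : Fin 2} {f : Plane → Space3}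
    (h : HasWeakPartial U j f) : IsWeakPartial U j f (weakPartial U j f) := by
  rw [weakPartial, dif_pos h]
  exact Classical.choose_spec h

/-! ### Smoothing -/

/-- The convolution of `F` with the kernel `φ`. -/
def smoothing (φ : Plane → ℝ) (F : Plane → Space3) : Plane → Space3 :=
  convolution φ F (ContinuousLinearMap.lsmul ℝ ℝ) volume

theorem smoothing_apply (φ : Plane → ℝ) (F : Plane → Space3) (x : Plane) :
    smoothing φ F x = ∫ y, φ (x - y) • F y := by
  rw [smoothing, convolution_eq_swap]; rfl

theorem contDiff_smoothing {φ : Plane → ℝ} {F : Plane → Space3} (hφ : ContDiff ℝ (⊤ : ℕ∞) φ)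
    (hc : HasCompactSupport φ) (hF : LocallyIntegrable F) :
    ContDiff ℝ (⊤ : ℕ∞) (smoothing φ F) :=
  hc.contDiff_convolution_left _ hφ hF

theorem fderiv_smoothing {φ : Plane → ℝ} {F : Plane → Space3} (hφ : ContDiff ℝ (⊤ : ℕ∞) φ)
    (hc : HasCompactSupport φ) (hF : LocallyIntegrable F) (x v : Plane) :
    fderiv ℝ (smoothing φ F) x v = smoothing (fun y => fderiv ℝ φ y v) F x := by
  have h1 := hc.hasFDerivAt_convolution_left (ContinuousLinearMap.lsmul ℝ ℝ) (hφ.of_le (by simp)) hF x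
  have h2 : ConvolutionExistsAt (fderiv ℝ φ) F x
      ((ContinuousLinearMap.lsmul ℝ ℝ : ℝ →L[ℝ] Space3 →L[ℝ] Space3).precompL Plane) volume :=
    (hc.fderiv ℝ).convolutionExists_left _ (hφ.continuous_fderiv (by simp)) hF x
  rw [smoothing, h1.fderiv, convolution_def, ContinuousLinearMap.integral_apply h2, smoothing,
    convolution_def]
  rfl

theorem hasCompactSupport_comp_sub_left {φ : Plane → ℝ} (hc : HasCompactSupport φ) (x : Plane) :
    HasCompactSupport fun y => φ (x - y) :=
  hc.comp_homeomorph (Homeomorph.subLeft x)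

theorem fderiv_comp_sub_left {φ : Plane → ℝ} (hφ : Differentiable ℝ φ) (x y v : Plane) :
    fderiv ℝ (fun y => φ (x - y)) y v = -fderiv ℝ φ (x - y) v := by
  have h1 : HasFDerivAt (fun y : Plane => x - y) (-ContinuousLinearMap.id ℝ Plane) y :=
    (hasFDerivAt_id y).const_sub x
  have h2 : HasFDerivAt (fun y => φ (x - y)) _ y := (hφ (x - y)).hasFDerivAt.comp y h1
  rw [h2.fderiv]
  simp

theorem tsupport_comp_sub_left_subset {φ : Plane → ℝ} {U : Set Plane} {x : Plane}
    (hx : ∀ y, x - y ∈ tsupport φ → y ∈ U) : tsupport (fun y => φ (x - y)) ⊆ U := by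
  intro y hy
  refine hx y ?_
  have : tsupport (fun y => φ (x - y)) = (Homeomorph.subLeft x) ⁻¹' tsupport φ :=
    tsupport_comp_eq_preimage φ (Homeomorph.subLeft x)
  rw [this] at hy; exact hy

theorem integral_smul_indicator_eq {U : Set Plane} {ψ : Plane → ℝ} (F : Plane → Space3)
    (h : ∀ y, y ∉ U → ψ y = 0) : ∫ y, ψ y • U.indicator F y = ∫ y, ψ y • F y := by
  congr 1; ext1 y
  by_cases hy : y ∈ U
  · rw [Set.indicator_of_mem hy]
  · rw [h y hy, zero_smul, zero_smul]

/-- Differentiation commutes with smoothing away from the boundary. -/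
theorem IsWeakPartial.fderiv_smoothing {U : Set Plane} {j : Fin 2} {f g : Plane → Space3}
    (h : IsWeakPartial U j f g) (hU : MeasurableSet U) (hf : IntegrableOn f U)
    {φ : Plane → ℝ} (hφ : ContDiff ℝ (⊤ : ℕ∞) φ) (hc : HasCompactSupport φ) {x : Plane}
    (hx : ∀ y, x - y ∈ tsupport φ → y ∈ U) :
    fderiv ℝ (smoothing φ (U.indicator f)) x (EuclideanSpace.single j 1) =
      smoothing φ (U.indicator g) x := by
  rw [_root_.fderiv_smoothing hφ hc ((integrable_indicator_iff hU).2 hf).locallyIntegrable,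
    smoothing_apply, smoothing_apply]
  have hψ : ContDiff ℝ (⊤ : ℕ∞) fun y => φ (x - y) := hφ.comp (contDiff_const.sub contDiff_id)
  have hz : ∀ y, y ∉ U → x - y ∉ tsupport φ := fun y hy h => hy (hx y h)
  have := h.integral_eq hψ (hasCompactSupport_comp_sub_left hc x) (tsupport_comp_sub_left_subset hx)
  simp only [fderiv_comp_sub_left (hφ.differentiable (by simp)), neg_smul] at this
  rw [integral_neg, neg_inj] at this
  rw [integral_smul_indicator_eq g fun y hy => image_eq_zero_of_notMem_tsupport (hz y hy),
    integral_smul_indicator_eq f, this]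
  intro y hy
  rw [fderiv_of_notMem_tsupport ℝ (hz y hy)]; rfl

theorem norm_smoothing_le (φ : ContDiffBump (0 : Plane)) {F : Plane → Space3} {M : ℝ}
    (hM : ∀ᵐ x, ‖F x‖ ≤ M) (x : Plane) : ‖smoothing (φ.normed volume) F x‖ ≤ M := by
  rw [smoothing_apply]
  have hint : Integrable (fun y => φ.normed volume (x - y) * M) :=
    ((φ.integrable_normed (μ := volume)).comp_sub_left x).mul_const M
  calc ‖∫ y, φ.normed volume (x - y) • F y‖ ≤ ∫ y, φ.normed volume (x - y) * M := by
        refine norm_integral_le_of_norm_le hint (hM.mono fun y hy => ?_)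
        rw [norm_smul, Real.norm_of_nonneg (φ.nonneg_normed _)]
        exact mul_le_mul_of_nonneg_left hy (φ.nonneg_normed _)
    _ = M := by
        rw [integral_mul_const, integral_sub_left_eq_self (φ.normed volume) volume x,
          φ.integral_normed, one_mul]

/-! ### Mollification -/

/-- A sequence of mollifiers. -/
def mollifier (n : ℕ) : ContDiffBump (0 : Plane) where
  rIn := 1 / (n + 1) / 2
  rOut := 1 / (n + 1)
  rIn_pos := by positivity
  rIn_lt_rOut := half_lt_self (by positivity)

/-- The mollification of a function at scale `1 / (n + 1)`. -/
def mollify (n : ℕ) (F : Plane → Space3) : Plane → Space3 :=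
  smoothing ((mollifier n).normed volume) F

theorem tendsto_mollifier_rOut : Tendsto (fun n => (mollifier n).rOut) atTop (𝓝 0) :=
  tendsto_one_div_add_atTop_nhds_zero_nat

theorem tendsto_mollify {F : Plane → Space3} (hF : AEStronglyMeasurable F) {x : Plane}
    (hx : ContinuousAt F x) : Tendsto (fun n => mollify n F x) atTop (𝓝 (F x)) :=
  ContDiffBump.convolution_tendsto_right (g := fun _ : ℕ => F) (k := fun _ => x)
    tendsto_mollifier_rOut (Eventually.of_forall fun _ => hF)
    (hx.tendsto.comp tendsto_snd) tendsto_const_nhds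

theorem ae_tendsto_mollify {F : Plane → Space3} (hF : LocallyIntegrable F) :
    ∀ᵐ x, Tendsto (fun n => mollify n F x) atTop (𝓝 (F x)) :=
  ContDiffBump.ae_convolution_tendsto_right_of_locallyIntegrable (K := 2) tendsto_mollifier_rOut
    (Eventually.of_forall fun n => by
      show (1 : ℝ) / (n + 1) ≤ 2 * (1 / (n + 1) / 2)
      linarith) hF

theorem mollify_congr {F G : Plane → Space3} (h : F =ᵐ[volume] G) (n : ℕ) :
    mollify n F = mollify n G := by
  ext1 x
  rw [mollify, mollify, smoothing_apply, smoothing_apply]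
  exact integral_congr_ae (h.mono fun y hy => by simp only [hy])

theorem contDiff_mollify {F : Plane → Space3} (hF : LocallyIntegrable F) (n : ℕ) :
    ContDiff ℝ (⊤ : ℕ∞) (mollify n F) :=
  contDiff_smoothing (mollifier n).contDiff_normed (mollifier n).hasCompactSupport_normed hF

theorem norm_mollify_le {F : Plane → Space3} {M : ℝ} (hM : ∀ᵐ x, ‖F x‖ ≤ M) (n : ℕ) (x : Plane) :
    ‖mollify n F x‖ ≤ M := norm_smoothing_le _ hM x

theorem mollify_add {F G : Plane → Space3} (hF : LocallyIntegrable F) (hG : LocallyIntegrable G)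
    (a b : ℝ) (n : ℕ) (x : Plane) :
    mollify n (fun y => a • F y + b • G y) x = a • mollify n F x + b • mollify n G x := by
  simp only [mollify, smoothing_apply, smul_add]
  have key : ∀ {F : Plane → Space3}, LocallyIntegrable F → ∀ c : ℝ,
      Integrable fun y => (mollifier n).normed volume (x - y) • c • F y := fun hF c =>
    (hF.smul c).integrable_smul_left_of_hasCompactSupport
      ((mollifier n).continuous_normed.comp (continuous_const.sub continuous_id))
      (hasCompactSupport_comp_sub_left (mollifier n).hasCompactSupport_normed x)
  rw [integral_add (key hF a) (key hG b)]
  simp only [smul_comm _ a, smul_comm _ b]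
  rw [integral_smul, integral_smul]

/-- Points whose distance from the complement exceeds the smoothing scale. -/
theorem mem_of_mem_tsupport_mollifier {U : Set Plane} {n : ℕ} {x : Plane}
    (hx : Metric.closedBall x (1 / (n + 1)) ⊆ U) (y : Plane)
    (hy : x - y ∈ tsupport ((mollifier n).normed volume)) : y ∈ U := by
  rw [ContDiffBump.tsupport_normed_eq] at hy
  apply hx
  rw [Metric.mem_closedBall, dist_comm, dist_eq_norm]
  simpa [mollifier] using hy

theorem IsWeakPartial.fderiv_mollify {U : Set Plane} {j : Fin 2} {f g : Plane → Space3}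
    (h : IsWeakPartial U j f g) (hU : MeasurableSet U) (hf : IntegrableOn f U) {n : ℕ} {x : Plane}
    (hx : Metric.closedBall x (1 / (n + 1)) ⊆ U) :
    fderiv ℝ (mollify n (U.indicator f)) x (EuclideanSpace.single j 1) =
      mollify n (U.indicator g) x :=
  h.fderiv_smoothing hU hf (mollifier n).contDiff_normed (mollifier n).hasCompactSupport_normed
    (mem_of_mem_tsupport_mollifier hx)

theorem Plane.eq_sum (v : Plane) :
    v = v 0 • EuclideanSpace.single 0 1 + v 1 • EuclideanSpace.single 1 1 := by
  ext i; fin_cases i <;> simp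

theorem Plane.norm_sq (v : Plane) : ‖v‖ ^ 2 = v 0 ^ 2 + v 1 ^ 2 := by
  rw [EuclideanSpace.real_norm_sq_eq, Fin.sum_univ_two]

theorem ContinuousLinearMap.apply_plane {E : Type*} [NormedAddCommGroup E] [NormedSpace ℝ E]
    (L : Plane →L[ℝ] E) (v : Plane) :
    L v = v 0 • L (EuclideanSpace.single 0 1) + v 1 • L (EuclideanSpace.single 1 1) := by
  conv_lhs => rw [Plane.eq_sum v]
  rw [map_add, map_smul, map_smul]

theorem norm_combo_eq {g : Fin 2 → Space3}
    (hg : ∀ j k, inner ℝ (g j) (g k) = if j = k then (1 : ℝ) else 0) (v : Plane) :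
    ‖v 0 • g 0 + v 1 • g 1‖ = ‖v‖ := by
  have h0 : ‖g 0‖ ^ 2 = 1 := by rw [← real_inner_self_eq_norm_sq, hg]; simp
  have h1 : ‖g 1‖ ^ 2 = 1 := by rw [← real_inner_self_eq_norm_sq, hg]; simp
  have h01 : inner ℝ (g 0) (g 1) = (0 : ℝ) := by rw [hg]; simp
  rw [← sq_eq_sq₀ (norm_nonneg _) (norm_nonneg _), norm_add_sq_real, Plane.norm_sq,
    norm_smul, norm_smul, mul_pow, mul_pow, h0, h1, inner_smul_left, inner_smul_right, h01]
  simp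

theorem norm_eq_one_of_orthonormal {g : Fin 2 → Space3}
    (hg : ∀ j k, inner ℝ (g j) (g k) = if j = k then (1 : ℝ) else 0) (j : Fin 2) : ‖g j‖ = 1 := by
  have h0 : ‖g j‖ ^ 2 = 1 := by rw [← real_inner_self_eq_norm_sq, hg]; simp
  exact (pow_eq_one_iff_of_nonneg (norm_nonneg _) two_ne_zero).1 h0

theorem closedBall_subset_of_mem_ball_sub {x₀ z : Plane} {R s : ℝ} (hz : z ∈ Metric.ball x₀ (R - s)) :
    Metric.closedBall z s ⊆ Metric.ball x₀ R := by
  intro y hy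
  rw [Metric.mem_ball] at *
  rw [Metric.mem_closedBall] at hy
  linarith [dist_triangle y z x₀]

theorem eventually_mem_ball_sub {x₀ z : Plane} {R : ℝ} (hz : z ∈ Metric.ball x₀ R) :
    ∀ᶠ n : ℕ in atTop, z ∈ Metric.ball x₀ (R - 1 / (n + 1)) := by
  have h : 0 < R - dist z x₀ := sub_pos.2 (Metric.mem_ball.1 hz)
  filter_upwards [(tendsto_one_div_add_atTop_nhds_zero_nat (𝕜 := ℝ)).eventually_lt_const h] with n hn
  rw [Metric.mem_ball]; linarith

theorem IntegrableOn.of_ae_norm_le {U : Set Plane} {f : Plane → Space3} {M : ℝ}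
    (hfin : volume U < ⊤) (hf : LocallyIntegrableOn f U)
    (hM : ∀ᵐ x ∂volume.restrict U, ‖f x‖ ≤ M) : IntegrableOn f U := by
  have : IsFiniteMeasure (volume.restrict U) := ⟨by simpa using hfin⟩
  exact Integrable.of_bound hf.aestronglyMeasurable M hM

/-- The continuous representative of a function on a ball with orthonormal weak partial
derivatives is nonexpansive. -/
theorem dist_le_of_isWeakPartial {x₀ : Plane} {R : ℝ} {f w : Plane → Space3}
    {g : Fin 2 → Plane → Space3} (hf : IntegrableOn f (Metric.ball x₀ R))
    (hg : ∀ j, IsWeakPartial (Metric.ball x₀ R) j f (g j))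
    (hiso : ∀ᵐ x ∂volume.restrict (Metric.ball x₀ R), ∀ j k : Fin 2,
      inner ℝ (g j x) (g k x) = if j = k then (1 : ℝ) else 0)
    (hw : w =ᵐ[volume.restrict (Metric.ball x₀ R)] f) (hwc : ContinuousOn w (Metric.ball x₀ R))
    {x y : Plane} (hx : x ∈ Metric.ball x₀ R) (hy : y ∈ Metric.ball x₀ R) :
    dist (w x) (w y) ≤ dist x y := by
  set U := Metric.ball x₀ R with hU
  have hUm : MeasurableSet U := measurableSet_ball
  have hfi : Integrable (U.indicator f) := (integrable_indicator_iff hUm).2 hf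
  have hgi : ∀ j, Integrable (U.indicator (g j)) := fun j =>
    (integrable_indicator_iff hUm).2 (IntegrableOn.of_ae_norm_le measure_ball_lt_top (hg j).2.1
      (hiso.mono fun x hx => (norm_eq_one_of_orthonormal (g := fun j => g j x) hx j).le))
  have hwf : U.indicator f =ᵐ[volume] U.indicator w := by
    rw [Filter.EventuallyEq, ae_restrict_iff' hUm] at hw
    filter_upwards [hw] with z hz
    by_cases hzU : z ∈ U
    · rw [Set.indicator_of_mem hzU, Set.indicator_of_mem hzU, hz hzU]
    · rw [Set.indicator_of_notMem hzU, Set.indicator_of_notMem hzU]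
  have htend : ∀ z ∈ U, Tendsto (fun n => mollify n (U.indicator f) z) atTop (𝓝 (w z)) := by
    intro z hz
    have hc : ContinuousAt (U.indicator w) z := by
      refine (hwc.continuousAt (Metric.isOpen_ball.mem_nhds hz)).congr ?_
      filter_upwards [Metric.isOpen_ball.mem_nhds hz] with y hy
      rw [Set.indicator_of_mem hy]
    have := tendsto_mollify (hfi.aestronglyMeasurable.congr hwf) hc
    rw [Set.indicator_of_mem hz] at this
    simpa only [mollify_congr hwf] using this
  -- On the smaller ball the gradient of the mollification is an average of linear isometries, hence
  -- has norm at most one; the bound survives the pointwise limit.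
  have hlip : ∀ n : ℕ, ∀ a ∈ Metric.ball x₀ (R - 1 / (n + 1)), ∀ b ∈ Metric.ball x₀ (R - 1 / (n + 1)),
      ‖mollify n (U.indicator f) b - mollify n (U.indicator f) a‖ ≤ 1 * ‖b - a‖ := by
    intro n a ha b hb
    refine (convex_ball x₀ _).norm_image_sub_le_of_norm_fderiv_le
      (fun z _ => ((contDiff_mollify hfi.locallyIntegrable n).differentiable (by simp)) z)
      (fun z hz => ?_) ha hb
    refine ContinuousLinearMap.opNorm_le_bound _ zero_le_one fun v => ?_
    have hzU := closedBall_subset_of_mem_ball_sub hz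
    rw [ContinuousLinearMap.apply_plane, (hg 0).fderiv_mollify hUm hf hzU,
      (hg 1).fderiv_mollify hUm hf hzU,
      ← mollify_add (hgi 0).locallyIntegrable (hgi 1).locallyIntegrable, one_mul]
    refine norm_mollify_le ?_ n z
    rw [ae_restrict_iff' hUm] at hiso
    filter_upwards [hiso] with y hy
    by_cases hyU : y ∈ U
    · simp only [Set.indicator_of_mem hyU]
      exact (norm_combo_eq (g := fun j => g j y) (hy hyU) v).le
    · simp [Set.indicator_of_notMem hyU]
  rw [dist_comm, dist_comm x, dist_eq_norm, dist_eq_norm]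
  refine le_of_tendsto ((htend y hy).sub (htend x hx)).norm ?_
  filter_upwards [eventually_mem_ball_sub hx, eventually_mem_ball_sub hy] with n hnx hny
  simpa using hlip n x hnx y hny

/-- A continuous function on a ball whose second distributional derivatives vanish is affine. -/
theorem exists_affine_of_integral_eq_zero {x₀ : Plane} {R : ℝ} (hR : 0 < R) {F : Plane → Space3}
    (hFi : IntegrableOn F (Metric.ball x₀ R)) (hFc : ContinuousOn F (Metric.ball x₀ R))
    (h : ∀ j k : Fin 2, ∀ φ : Plane → ℝ, ContDiff ℝ (⊤ : ℕ∞) φ → HasCompactSupport φ →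
      tsupport φ ⊆ Metric.ball x₀ R →
      ∫ x, fderiv ℝ (fun y => fderiv ℝ φ y (EuclideanSpace.single j 1)) x
        (EuclideanSpace.single k 1) • F x = 0) :
    ∃ c : Fin 2 → Space3, ∀ x ∈ Metric.ball x₀ R,
      F x = F x₀ + ((x - x₀) 0 • c 0 + (x - x₀) 1 • c 1) := by
  set U := Metric.ball x₀ R with hU
  have hUm : MeasurableSet U := measurableSet_ball
  have hfi : Integrable (U.indicator F) := (integrable_indicator_iff hUm).2 hFi
  have htend : ∀ z ∈ U, Tendsto (fun n => mollify n (U.indicator F) z) atTop (𝓝 (F z)) := by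
    intro z hz
    have hc : ContinuousAt (U.indicator F) z := by
      refine (hFc.continuousAt (Metric.isOpen_ball.mem_nhds hz)).congr ?_
      filter_upwards [Metric.isOpen_ball.mem_nhds hz] with y hy
      rw [Set.indicator_of_mem hy]
    have := tendsto_mollify hfi.aestronglyMeasurable hc
    rwa [Set.indicator_of_mem hz] at this
  have hx₀ : x₀ ∈ U := Metric.mem_ball_self hR
  set Φ : ℕ → Plane → Space3 := fun n => mollify n (U.indicator F) with hΦ
  have hΦs : ∀ n, ContDiff ℝ (⊤ : ℕ∞) (Φ n) := fun n => contDiff_mollify hfi.locallyIntegrable n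
  -- The second derivatives of the mollification at `z` are integrals of `F` against second
  -- derivatives of the test function `y ↦ φ (z - y)`; the two signs from the reflection cancel.
  have hfd : ∀ n : ℕ, ∀ j, ∀ z ∈ Metric.ball x₀ (R - 1 / (n + 1)), ∀ k,
      fderiv ℝ (fun y => fderiv ℝ (Φ n) y (EuclideanSpace.single j 1)) z
        (EuclideanSpace.single k 1) = 0 := by
    intro n j z hz k
    set φ := (mollifier n).normed volume with hφdef
    have hφ : ContDiff ℝ (⊤ : ℕ∞) φ := (mollifier n).contDiff_normed
    have hc : HasCompactSupport φ := (mollifier n).hasCompactSupport_normed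
    have hφ1 : ∀ v : Plane, ContDiff ℝ (⊤ : ℕ∞) (fun y => fderiv ℝ φ y v) := fun v =>
      (hφ.fderiv_right (m := (⊤ : ℕ∞)) (by simp)).clm_apply contDiff_const
    have e1 : (fun y => fderiv ℝ (Φ n) y (EuclideanSpace.single j 1)) =
        smoothing (fun y => fderiv ℝ φ y (EuclideanSpace.single j 1)) (U.indicator F) :=
      funext fun y => fderiv_smoothing hφ hc hfi.locallyIntegrable y _
    rw [e1, fderiv_smoothing (hφ1 _) (hc.fderiv_apply ℝ _) hfi.locallyIntegrable, smoothing_apply]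
    have hzU := mem_of_mem_tsupport_mollifier (closedBall_subset_of_mem_ball_sub hz)
    rw [integral_smul_indicator_eq F]
    · have := h j k (fun y => φ (z - y)) (hφ.comp (contDiff_const.sub contDiff_id))
        (hasCompactSupport_comp_sub_left hc z) (tsupport_comp_sub_left_subset hzU)
      rw [← this]
      congr 1; ext1 y
      have e2 : (fun y => fderiv ℝ (fun y => φ (z - y)) y (EuclideanSpace.single j 1)) =
          fun y => -fderiv ℝ φ (z - y) (EuclideanSpace.single j 1) :=
        funext fun y => fderiv_comp_sub_left (hφ.differentiable (by simp)) z y _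
      rw [e2, fderiv_fun_neg, neg_apply,
        fderiv_comp_sub_left (φ := fun y => fderiv ℝ φ y (EuclideanSpace.single j 1))
          ((hφ1 _).differentiable (by simp)), neg_neg]
    · intro y hy
      have hy1 : z - y ∉ tsupport φ := fun h => hy (hzU y h)
      have hy2 : z - y ∉ tsupport (fun y => fderiv ℝ φ y (EuclideanSpace.single j 1)) :=
        fun h => hy1 (tsupport_fderiv_apply_subset' φ _ h)
      rw [fderiv_of_notMem_tsupport ℝ hy2]; rfl
  have hcl : ∀ n : ℕ, 0 < R - 1 / (n + 1) → ∀ z ∈ Metric.ball x₀ (R - 1 / (n + 1)),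
      Φ n z - Φ n x₀ = (z - x₀) 0 • fderiv ℝ (Φ n) x₀ (EuclideanSpace.single 0 1) +
        (z - x₀) 1 • fderiv ℝ (Φ n) x₀ (EuclideanSpace.single 1 1) := by
    intro n hn z hz
    have hb := Metric.mem_ball_self (x := x₀) hn
    have hD : ∀ y ∈ Metric.ball x₀ (R - 1 / (n + 1)), fderiv ℝ (Φ n) y = fderiv ℝ (Φ n) x₀ := by
      intro y hy
      have hj : ∀ j, fderiv ℝ (Φ n) y (EuclideanSpace.single j 1) =
          fderiv ℝ (Φ n) x₀ (EuclideanSpace.single j 1) := by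
        intro j
        have hs : ContDiff ℝ (⊤ : ℕ∞) (fun y => fderiv ℝ (Φ n) y (EuclideanSpace.single j 1)) :=
          ((hΦs n).fderiv_right (m := (⊤ : ℕ∞)) (by simp)).clm_apply contDiff_const
        have := (convex_ball x₀ (R - 1 / (n + 1))).norm_image_sub_le_of_norm_fderiv_le (C := 0)
          (fun w _ => (hs.differentiable (by simp)) w) (fun w hw => by
            rw [norm_le_zero_iff]
            ext1 v
            rw [ContinuousLinearMap.apply_plane, hfd n j w hw, hfd n j w hw]; simp) hb hy
        rw [zero_mul, norm_le_zero_iff] at this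
        exact sub_eq_zero.1 this
      ext1 v
      rw [ContinuousLinearMap.apply_plane, hj, hj, ← ContinuousLinearMap.apply_plane]
    have := (convex_ball x₀ (R - 1 / (n + 1))).norm_image_sub_le_of_norm_fderiv_le' (C := 0)
      (f := Φ n) (φ := fderiv ℝ (Φ n) x₀)
      (fun w _ => ((hΦs n).differentiable (by simp)) w) (fun w hw => by rw [hD w hw]; simp) hb hz
    rw [zero_mul, norm_le_zero_iff, sub_eq_zero] at this
    rw [this, ContinuousLinearMap.apply_plane]
  have hpt : ∀ j : Fin 2, x₀ + EuclideanSpace.single j (R / 2) ∈ U := by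
    intro j
    rw [hU, Metric.mem_ball, dist_eq_norm, add_sub_cancel_left]
    simp [abs_of_pos hR]; linarith
  have hev : ∀ᶠ n : ℕ in atTop, 0 < R - 1 / (n + 1) :=
    (eventually_mem_ball_sub hx₀).mono fun n hn => by simpa using hn
  -- The mollifications are affine on smaller balls, so their gradients are difference quotients
  -- over the fixed distance `R / 2`, and these converge.
  set c : Fin 2 → Space3 := fun j => (R / 2)⁻¹ • (F (x₀ + EuclideanSpace.single j (R / 2)) - F x₀)
    with hcdef
  have hLc : ∀ j, Tendsto (fun n => fderiv ℝ (Φ n) x₀ (EuclideanSpace.single j 1)) atTop (𝓝 (c j)) := by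
    intro j
    refine (((htend _ (hpt j)).sub (htend _ hx₀)).const_smul (R / 2)⁻¹).congr' ?_
    filter_upwards [hev, eventually_mem_ball_sub (hpt j)] with n hn hnj
    rw [hcl n hn _ hnj, add_sub_cancel_left]
    have hR2 : R / R = 1 := div_self hR.ne'
    fin_cases j <;> simp [smul_smul, hR2]
  refine ⟨c, fun x hx => ?_⟩
  have h1 : Tendsto (fun n => Φ n x - Φ n x₀) atTop (𝓝 (F x - F x₀)) :=
    (htend x hx).sub (htend x₀ hx₀)
  have h2 : Tendsto (fun n => Φ n x - Φ n x₀) atTop (𝓝 ((x - x₀) 0 • c 0 + (x - x₀) 1 • c 1)) := by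
    refine (((hLc 0).const_smul ((x - x₀) 0)).add ((hLc 1).const_smul ((x - x₀) 1))).congr' ?_
    filter_upwards [hev, eventually_mem_ball_sub hx] with n hn hnx
    rw [hcl n hn x hnx]
  rw [← tendsto_nhds_unique h1 h2]; abel

/-! ### Integration by parts -/

/-- Points of the support have balls of a common radius `δ` inside `U`. Closer than `δ` the product
estimate applies; farther apart, boundedness of the product suffices, at the price of a constant of
order `1 / δ`. -/
theorem lipschitzWith_smul_of_tsupport_subset {U : Set Plane} (hU : IsOpen U)
    {f : Plane → Space3} {C : NNReal}
    (hf : ∀ x r, Metric.ball x r ⊆ U → LipschitzOnWith C f (Metric.ball x r)) {φ : Plane → ℝ}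
    (hφ : ContDiff ℝ (⊤ : ℕ∞) φ) (hc : HasCompactSupport φ) (ht : tsupport φ ⊆ U) :
    ∃ D : NNReal, LipschitzWith D fun x => φ x • f x := by
  have hfc : ContinuousOn f U := by
    intro x hx
    obtain ⟨r, hr, hball⟩ := Metric.isOpen_iff.1 hU x hx
    exact ((hf x r hball).continuousOn.continuousAt
      (Metric.ball_mem_nhds x hr)).continuousWithinAt
  obtain ⟨δ, hδ, hδU⟩ := hc.isCompact.exists_thickening_subset_open hU ht
  obtain ⟨M, hM⟩ := hc.isCompact.exists_bound_of_continuousOn (hfc.mono ht)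
  obtain ⟨B, hB⟩ := hφ.continuous.bounded_above_of_compact_support hc
  obtain ⟨D, hD⟩ := hφ.lipschitzWith_of_hasCompactSupport hc (by simp)
  have hB0 : 0 ≤ B := (norm_nonneg _).trans (hB 0)
  set M' := max M 0 with hM'
  have hM0 : 0 ≤ M' := le_max_right _ _
  have hMK : ∀ x ∈ tsupport φ, ‖f x‖ ≤ M' := fun x hx => (hM x hx).trans (le_max_left _ _)
  have hz : ∀ x, x ∉ tsupport φ → φ x • f x = 0 := fun x hx => by
    rw [image_eq_zero_of_notMem_tsupport hx, zero_smul]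
  have hbd : ∀ x, ‖φ x • f x‖ ≤ B * M' := by
    intro x
    by_cases hx : x ∈ tsupport φ
    · rw [norm_smul]; exact mul_le_mul (hB x) (hMK x hx) (norm_nonneg _) hB0
    · rw [hz x hx, norm_zero]; positivity
  have key : ∀ x ∈ tsupport φ, ∀ y,
      ‖φ x • f x - φ y • f y‖ ≤ (B * C + D * M' + 2 * B * M' / δ) * dist x y := by
    intro x hx y
    rcases lt_or_ge (dist x y) δ with h | h
    · have hball : Metric.ball x δ ⊆ U := (Metric.ball_subset_thickening hx δ).trans hδU
      have h1 := (hf x δ hball).dist_le_mul x (Metric.mem_ball_self hδ) y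
        (by rw [Metric.mem_ball, dist_comm]; exact h)
      have h2 := hD.dist_le_mul x y
      rw [dist_eq_norm] at h1 h2
      have e : φ x • f x - φ y • f y = φ y • (f x - f y) + (φ x - φ y) • f x := by module
      rw [e]
      have h3 : ‖φ y • (f x - f y)‖ ≤ B * (C * dist x y) := by
        rw [norm_smul]; exact mul_le_mul (hB y) h1 (norm_nonneg _) hB0
      have h4 : ‖(φ x - φ y) • f x‖ ≤ (D * dist x y) * M' := by
        rw [norm_smul]; exact mul_le_mul h2 (hMK x hx) (norm_nonneg _) (by positivity)
      have h5 : 0 ≤ 2 * B * M' / δ * dist x y := by positivity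
      linarith [norm_add_le (φ y • (f x - f y)) ((φ x - φ y) • f x)]
    · have h1 := norm_sub_le (φ x • f x) (φ y • f y)
      have h2 : 2 * B * M' ≤ 2 * B * M' / δ * dist x y := by
        rw [div_mul_eq_mul_div, le_div_iff₀ hδ]; gcongr
      have h3 : 0 ≤ (B * C + D * M') * dist x y := by positivity
      linarith [hbd x, hbd y]
  refine ⟨(B * C + D * M' + 2 * B * M' / δ).toNNReal, LipschitzWith.of_dist_le_mul fun x y => ?_⟩
  rw [Real.coe_toNNReal _ (by positivity), dist_eq_norm]
  by_cases hx : x ∈ tsupport φ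
  · exact key x hx y
  by_cases hy : y ∈ tsupport φ
  · rw [norm_sub_rev, dist_comm]; exact key y hy x
  · rw [hz x hx, hz y hy, sub_zero, norm_zero]; positivity

/-- For locally Lipschitz functions the pointwise derivative is the weak derivative. -/
theorem isWeakPartial_of_lipschitz {U : Set Plane} (hU : IsOpen U) {j : Fin 2}
    {f g : Plane → Space3} {C : NNReal}
    (hf : ∀ x r, Metric.ball x r ⊆ U → LipschitzOnWith C f (Metric.ball x r))
    (hd : ∀ᵐ x ∂volume.restrict U, HasLineDerivAt ℝ f (g x) x (EuclideanSpace.single j 1))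
    (hg : LocallyIntegrableOn g U) : IsWeakPartial U j f g := by
  have hfc : ContinuousOn f U := by
    intro x hx
    obtain ⟨r, hr, hball⟩ := Metric.isOpen_iff.1 hU x hx
    exact ((hf x r hball).continuousOn.continuousAt
      (Metric.ball_mem_nhds x hr)).continuousWithinAt
  have hfl : LocallyIntegrableOn f U := hfc.locallyIntegrableOn hU.measurableSet
  refine IsWeakPartial.of_integral_eq hfl hg fun φ hφ hc ht => ?_
  set v : Plane := EuclideanSpace.single j 1 with hv
  have i1 : Integrable fun x => fderiv ℝ φ x v • f x :=
    hfl.integrable_smul_of_tsupport_subset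
      ((hφ.continuous_fderiv (by simp)).clm_apply continuous_const) (hc.fderiv_apply ℝ v)
      ((tsupport_fderiv_apply_subset' φ _).trans ht)
  have i2 : Integrable fun x => φ x • g x :=
    hg.integrable_smul_of_tsupport_subset hφ.continuous hc ht
  obtain ⟨D, hD⟩ := lipschitzWith_smul_of_tsupport_subset hU hf hφ hc ht
  rw [eq_neg_iff_add_eq_zero, ← integral_add i1 i2]
  refine ext_inner_left ℝ fun e => ?_
  have i12 : Integrable fun x => fderiv ℝ φ x v • f x + φ x • g x := i1.add i2
  rw [← integral_inner i12, inner_zero_right]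
  set H : Plane → ℝ := fun x => inner ℝ e (φ x • f x) with hH
  have hHl : LipschitzWith (‖innerSL ℝ e‖₊ * D) H := (innerSL ℝ e).lipschitz.comp hD
  have hHc : HasCompactSupport H := by
    refine hc.mono fun x hx => ?_
    intro h0
    exact hx (by simp only [hH]; rw [h0, zero_smul, inner_zero_right])
  -- Integrating by parts against the constant `1`: the line derivative of a compactly supported
  -- Lipschitz function has integral zero.
  have h0 := (LipschitzWith.const (1 : ℝ) : LipschitzWith 0 fun _ : Plane => (1 : ℝ)).integral_lineDeriv_mul_eq
    (μ := volume) hHl hHc v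
  have e0 : ∀ x : Plane, lineDeriv ℝ (fun _ : Plane => (1 : ℝ)) x v = 0 := fun x => by
    simp [lineDeriv]
  simp only [e0, zero_mul, integral_zero, mul_one, lineDeriv_neg, integral_neg] at h0
  rw [eq_comm, neg_eq_zero] at h0
  rw [← h0]
  apply integral_congr_ae
  rw [ae_restrict_iff' hU.measurableSet] at hd
  filter_upwards [hd] with x hx
  by_cases hxU : x ∈ U
  · have h1 := hx hxU
    have h2 : HasLineDerivAt ℝ φ (fderiv ℝ φ x v) x v :=
      ((hφ.differentiable (by simp)) x).hasFDerivAt.hasLineDerivAt v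
    have h3 : HasLineDerivAt ℝ (fun x => φ x • f x) (φ x • g x + fderiv ℝ φ x v • f x) x v := by
      have := HasDerivAt.fun_smul h2 h1
      simpa [HasLineDerivAt] using this
    have h4 : HasLineDerivAt ℝ H (inner ℝ e (φ x • g x + fderiv ℝ φ x v • f x)) x v := by
      have := (hasDerivAt_const (0 : ℝ) e).inner ℝ h3
      simpa [HasLineDerivAt] using this
    rw [h4.lineDeriv]
    simp only [inner_add_right]
    ring_nf
  · have hxs : x ∉ tsupport φ := fun h => hxU (ht h)
    have hHz : H =ᶠ[𝓝 x] fun _ => 0 := by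
      filter_upwards [(isClosed_tsupport φ).isOpen_compl.mem_nhds hxs] with y hy
      simp only [hH]
      rw [image_eq_zero_of_notMem_tsupport hy, zero_smul, inner_zero_right]
    have h4 : HasLineDerivAt ℝ H 0 x v := by
      have := (hasFDerivAt_const (𝕜 := ℝ) (0 : ℝ) x).congr_of_eventuallyEq hHz
      simpa using this.hasLineDerivAt v
    rw [h4.lineDeriv, fderiv_of_notMem_tsupport ℝ hxs, image_eq_zero_of_notMem_tsupport hxs]
    simp

theorem isWeakPartial_affine {U : Set Plane} (hU : IsOpen U) (a : Space3) (x₀ : Plane)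
    (c : Fin 2 → Space3) (j : Fin 2) :
    IsWeakPartial U j (fun x => a + ((x - x₀) 0 • c 0 + (x - x₀) 1 • c 1)) fun _ => c j := by
  set L : Plane →L[ℝ] Space3 := (EuclideanSpace.proj 0 : Plane →L[ℝ] ℝ).smulRight (c 0) +
    (EuclideanSpace.proj 1 : Plane →L[ℝ] ℝ).smulRight (c 1) with hL
  have e : (fun x : Plane => a + ((x - x₀) 0 • c 0 + (x - x₀) 1 • c 1)) = fun x => a + L (x - x₀) := by
    ext1 x; simp [hL]
  have hLj : L (EuclideanSpace.single j 1) = c j := by fin_cases j <;> simp [hL]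
  rw [e]
  refine isWeakPartial_of_lipschitz hU (C := ‖L‖₊) (fun x r _ => ?_)
    (Eventually.of_forall fun x => ?_) (locallyIntegrableOn_const _)
  · refine LipschitzWith.lipschitzOnWith (LipschitzWith.of_dist_le_mul fun x y => ?_)
    rw [dist_add_left, dist_eq_norm, ← map_sub, sub_sub_sub_cancel_right, dist_eq_norm]
    exact L.le_opNorm _
  · rw [← hLj]
    have : HasFDerivAt (fun x => a + L (x - x₀)) L x :=
      (L.hasFDerivAt.comp x ((hasFDerivAt_id x).sub_const x₀)).const_add a
    exact this.hasLineDerivAt _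

theorem isWeakPartial_const {U : Set Plane} (hU : IsOpen U) (a : Space3) (j : Fin 2) :
    IsWeakPartial U j (fun _ => a) fun _ => 0 := by
  simpa using isWeakPartial_affine hU a 0 (fun _ => 0) j

/-- Each coordinate of `F` multiplied by `φ` is an admissible test function; the three coordinates
of the resulting identities are summed. -/
theorem IsWeakPartial.integral_inner_smooth {U : Set Plane} {j : Fin 2} {g h : Plane → Space3}
    (H : IsWeakPartial U j g h) {φ : Plane → ℝ} (hφ : ContDiff ℝ (⊤ : ℕ∞) φ)
    (hc : HasCompactSupport φ) (ht : tsupport φ ⊆ U) {F : Plane → Space3}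
    (hF : ContDiff ℝ (⊤ : ℕ∞) F) :
    ∫ x, (inner ℝ (F x) (fderiv ℝ φ x (EuclideanSpace.single j 1) • g x + φ x • h x) +
      inner ℝ (fderiv ℝ F x (EuclideanSpace.single j 1)) (φ x • g x)) = 0 := by
  set v : Plane := EuclideanSpace.single j 1 with hv
  have hFi : ∀ i, ContDiff ℝ (⊤ : ℕ∞) fun x => F x i := fun i =>
    (EuclideanSpace.proj i : Space3 →L[ℝ] ℝ).contDiff.comp hF
  have hψ : ∀ i, ContDiff ℝ (⊤ : ℕ∞) fun x => φ x * F x i := fun i => hφ.mul (hFi i)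
  have hψc : ∀ i, HasCompactSupport fun x => φ x * F x i := fun i => hc.mul_right
  have hψt : ∀ i, tsupport (fun x => φ x * F x i) ⊆ U := fun i => (tsupport_mul_subset_left).trans ht
  have hfd : ∀ i x, fderiv ℝ (fun x => φ x * F x i) x v =
      φ x * (fderiv ℝ F x v) i + F x i * fderiv ℝ φ x v := by
    intro i x
    have h1 : HasFDerivAt (fun x => F x i)
        ((EuclideanSpace.proj i : Space3 →L[ℝ] ℝ).comp (fderiv ℝ F x)) x :=
      (EuclideanSpace.proj i : Space3 →L[ℝ] ℝ).hasFDerivAt.comp x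
        ((hF.differentiable (by simp)) x).hasFDerivAt
    have h2 : HasFDerivAt (fun x => φ x * F x i) _ x :=
      ((hφ.differentiable (by simp)) x).hasFDerivAt.mul h1
    rw [h2.fderiv]
    simp
  set Q : Fin 3 → Plane → Space3 := fun i x =>
    fderiv ℝ (fun x => φ x * F x i) x v • g x + (φ x * F x i) • h x with hQ
  have i1 := fun i => H.integrable_fderiv_smul (hψ i) (hψc i) (hψt i) v
  have i2 := fun i => H.integrable_smul (hψ i).continuous (hψc i) (hψt i)
  have hQi : ∀ i, Integrable (Q i) := fun i => (i1 i).add (i2 i)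
  have hQ0 : ∀ i, ∫ x, Q i x = 0 := by
    intro i
    simp only [hQ]
    rw [integral_add (i1 i) (i2 i), H.integral_eq (hψ i) (hψc i) (hψt i), neg_add_cancel]
  calc _ = ∫ x, ∑ i, inner ℝ (EuclideanSpace.single i (1 : ℝ)) (Q i x) := by
        congr 1; ext1 x
        simp only [hQ, hfd, PiLp.inner_apply, Fin.sum_univ_three]
        simp
        ring
    _ = ∑ i, inner ℝ (EuclideanSpace.single i (1 : ℝ)) (∫ x, Q i x) := by
        rw [integral_finsetSum _ fun i _ => (hQi i).const_inner _]
        exact Finset.sum_congr rfl fun i _ => integral_inner (hQi i) _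
    _ = 0 := by simp [hQ0]

theorem norm_indicator_le_of_ae {U : Set Plane} (hU : MeasurableSet U) {f : Plane → Space3} {M : ℝ}
    (hM0 : 0 ≤ M) (hM : ∀ᵐ x ∂volume.restrict U, ‖f x‖ ≤ M) : ∀ᵐ x, ‖U.indicator f x‖ ≤ M := by
  rw [ae_restrict_iff' hU] at hM
  filter_upwards [hM] with x hx
  by_cases h : x ∈ U
  · rw [Set.indicator_of_mem h]; exact hx h
  · rw [Set.indicator_of_notMem h, norm_zero]; exact hM0

/-- The product rule for two weakly differentiable functions. -/
theorem IsWeakPartial.integral_inner_eq_zero {U : Set Plane} (hU : IsOpen U) (hfin : volume U < ⊤)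
    {j : Fin 2} {f γ₁ γ₂ h : Plane → Space3} (hf : IsWeakPartial U j f γ₁)
    (hg : IsWeakPartial U j γ₂ h) {M : ℝ} (hfM : ∀ᵐ x ∂volume.restrict U, ‖f x‖ ≤ M)
    (hγM : ∀ᵐ x ∂volume.restrict U, ‖γ₁ x‖ ≤ M) (hM0 : 0 ≤ M) {φ : Plane → ℝ}
    (hφ : ContDiff ℝ (⊤ : ℕ∞) φ) (hc : HasCompactSupport φ) (ht : tsupport φ ⊆ U) :
    ∫ x, (inner ℝ (f x) (fderiv ℝ φ x (EuclideanSpace.single j 1) • γ₂ x + φ x • h x) +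
      inner ℝ (γ₁ x) (φ x • γ₂ x)) = 0 := by
  set v : Plane := EuclideanSpace.single j 1 with hv
  have hUm := hU.measurableSet
  have hfi : IntegrableOn f U := IntegrableOn.of_ae_norm_le hfin hf.1 hfM
  have hγi : IntegrableOn γ₁ U := IntegrableOn.of_ae_norm_le hfin hf.2.1 hγM
  have hFi : Integrable (U.indicator f) := (integrable_indicator_iff hUm).2 hfi
  have hGi : Integrable (U.indicator γ₁) := (integrable_indicator_iff hUm).2 hγi
  set p : Plane → Space3 := fun x => fderiv ℝ φ x v • γ₂ x + φ x • h x with hp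
  set q : Plane → Space3 := fun x => φ x • γ₂ x with hq
  have hpi : Integrable p := (hg.integrable_fderiv_smul hφ hc ht v).add
    (hg.integrable_smul hφ.continuous hc ht)
  have hqi : Integrable q := hg.1.integrable_smul_of_tsupport_subset hφ.continuous hc ht
  have hp0 : ∀ x, x ∉ tsupport φ → p x = 0 := fun x hx => by
    simp only [hp]
    rw [fderiv_of_notMem_tsupport ℝ hx, image_eq_zero_of_notMem_tsupport hx]; simp
  have hq0 : ∀ x, x ∉ tsupport φ → q x = 0 := fun x hx => by
    simp only [hq]
    rw [image_eq_zero_of_notMem_tsupport hx, zero_smul]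
  obtain ⟨δ, hδ, hδU⟩ := hc.isCompact.exists_cthickening_subset_open hU ht
  -- Mollifying `f` reduces to the smooth case once the scale is below the distance from the support
  -- of `φ` to the boundary. The bounds by `M` allow dominated convergence.
  set T : ℕ → Plane → ℝ := fun n x => inner ℝ (mollify n (U.indicator f) x) (p x) +
    inner ℝ (mollify n (U.indicator γ₁) x) (q x) with hT
  have hT0 : ∀ᶠ n in atTop, ∫ x, T n x = 0 := by
    filter_upwards [(tendsto_one_div_add_atTop_nhds_zero_nat (𝕜 := ℝ)).eventually_le_const hδ]
      with n hn
    rw [← hg.integral_inner_smooth hφ hc ht (contDiff_mollify hFi.locallyIntegrable n)]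
    congr 1; ext1 x
    simp only [hT]
    by_cases hx : x ∈ tsupport φ
    · have hsub : Metric.closedBall x (1 / (n + 1)) ⊆ U :=
        (Metric.closedBall_subset_closedBall hn).trans
          ((Metric.closedBall_subset_cthickening hx δ).trans hδU)
      rw [hf.fderiv_mollify hUm hfi hsub]
    · rw [hq0 x hx, show φ x • γ₂ x = 0 from hq0 x hx, inner_zero_right, inner_zero_right]
  have hlim : Tendsto (fun n => ∫ x, T n x) atTop
      (𝓝 (∫ x, (inner ℝ (U.indicator f x) (p x) + inner ℝ (U.indicator γ₁ x) (q x)))) := by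
    refine tendsto_integral_of_dominated_convergence (fun x => M * ‖p x‖ + M * ‖q x‖) ?_
      ((hpi.norm.const_mul M).add (hqi.norm.const_mul M)) ?_ ?_
    · intro n
      exact ((contDiff_mollify hFi.locallyIntegrable n).continuous.aestronglyMeasurable.inner
        hpi.aestronglyMeasurable).add
        ((contDiff_mollify hGi.locallyIntegrable n).continuous.aestronglyMeasurable.inner
        hqi.aestronglyMeasurable)
    · intro n
      refine Eventually.of_forall fun x => (norm_add_le _ _).trans (add_le_add ?_ ?_)
      · exact (norm_inner_le_norm _ _).trans (mul_le_mul_of_nonneg_right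
          (norm_mollify_le (norm_indicator_le_of_ae hUm hM0 hfM) n x) (norm_nonneg _))
      · exact (norm_inner_le_norm _ _).trans (mul_le_mul_of_nonneg_right
          (norm_mollify_le (norm_indicator_le_of_ae hUm hM0 hγM) n x) (norm_nonneg _))
    · filter_upwards [ae_tendsto_mollify hFi.locallyIntegrable,
        ae_tendsto_mollify hGi.locallyIntegrable] with x hx1 hx2
      exact (hx1.inner tendsto_const_nhds).add (hx2.inner tendsto_const_nhds)
  have hfinal := tendsto_nhds_unique (tendsto_const_nhds.congr' (hT0.mono fun n hn => hn.symm)) hlim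
  rw [hfinal]
  congr 1; ext1 x
  by_cases hx : x ∈ U
  · rw [Set.indicator_of_mem hx, Set.indicator_of_mem hx]
  · have hxs : x ∉ tsupport φ := fun h => hx (ht h)
    rw [hp0 x hxs, hq0 x hxs, show fderiv ℝ φ x v • γ₂ x + φ x • h x = 0 from hp0 x hxs,
      show φ x • γ₂ x = 0 from hq0 x hxs]
    simp

/-! ### Limits of isometries with vanishing bending energy -/

theorem norm_integral_le_setIntegral {B : Set Plane} {E : Type*} [NormedAddCommGroup E]
    [NormedSpace ℝ E] {p : Plane → E} {q : Plane → ℝ} (hq : IntegrableOn q B)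
    (h0 : ∀ x, x ∉ B → p x = 0) (hle : ∀ᵐ x ∂volume.restrict B, ‖p x‖ ≤ q x) :
    ‖∫ x, p x‖ ≤ ∫ x in B, q x := by
  rw [← setIntegral_eq_integral_of_forall_compl_eq_zero h0]
  exact norm_integral_le_of_norm_le hq hle

theorem tendsto_integral_smul_zero {B : Set Plane} {f : ℕ → Plane → Space3}
    (hi : ∀ m, IntegrableOn (f m) B) (hf : Tendsto (fun m => ∫ x in B, ‖f m x‖) atTop (𝓝 0))
    {ψ : Plane → ℝ} (hψ : Continuous ψ) (hc : HasCompactSupport ψ) (ht : tsupport ψ ⊆ B) :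
    Tendsto (fun m => ∫ x, ψ x • f m x) atTop (𝓝 0) := by
  obtain ⟨K, hK⟩ := hψ.bounded_above_of_compact_support hc
  refine squeeze_zero_norm (a := fun m => K * ∫ x in B, ‖f m x‖) (fun m => ?_)
    (by simpa using hf.const_mul K)
  rw [← integral_const_mul]
  refine norm_integral_le_setIntegral ((hi m).norm.const_mul K) (fun x hx => ?_)
    (Eventually.of_forall fun x => ?_)
  · rw [image_eq_zero_of_notMem_tsupport fun h => hx (ht h), zero_smul]
  · rw [norm_smul]; exact mul_le_mul_of_nonneg_right (hK x) (norm_nonneg _)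

/-- Bounded pointwise convergence gives `L¹` convergence, and Hessians vanishing in `L¹` make the
second distributional derivatives of `F` zero, so `F` is affine. The quadratic constraint needs more
than weak convergence of the gradients: their localized products are controlled by integrating by
parts once, which moves a derivative onto terms that tend to zero. -/
theorem exists_isometric_affine_limit {x₀ : Plane} {R : ℝ} (hR : 0 < R)
    {v : ℕ → Plane → Space3} {g : ℕ → Fin 2 → Plane → Space3}
    {h : ℕ → Fin 2 → Fin 2 → Plane → Space3} {F : Plane → Space3} {C : ℝ}
    (hv : ∀ m j, IsWeakPartial (Metric.ball x₀ R) j (v m) (g m j))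
    (hg : ∀ m j k, IsWeakPartial (Metric.ball x₀ R) k (g m j) (h m j k))
    (hiso : ∀ m, ∀ᵐ x ∂volume.restrict (Metric.ball x₀ R), ∀ j k : Fin 2,
      inner ℝ (g m j x) (g m k x) = if j = k then (1 : ℝ) else 0)
    (hb : ∀ m, ∀ᵐ x ∂volume.restrict (Metric.ball x₀ R), ‖v m x‖ ≤ C)
    (hlim : ∀ᵐ x ∂volume.restrict (Metric.ball x₀ R), Tendsto (fun m => v m x) atTop (𝓝 (F x)))
    (hFc : ContinuousOn F (Metric.ball x₀ R))
    (hhi : ∀ m j k, IntegrableOn (h m j k) (Metric.ball x₀ R))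
    (hh : ∀ j k, Tendsto (fun m => ∫ x in Metric.ball x₀ R, ‖h m j k x‖) atTop (𝓝 0)) :
    ∃ c : Fin 2 → Space3, (∀ j k, inner ℝ (c j) (c k) = if j = k then (1 : ℝ) else 0) ∧
      ∀ x ∈ Metric.ball x₀ R, F x = F x₀ + ((x - x₀) 0 • c 0 + (x - x₀) 1 • c 1) := by
  set B := Metric.ball x₀ R with hB
  have hBo : IsOpen B := Metric.isOpen_ball
  have hBm : MeasurableSet B := measurableSet_ball
  have hBfin : volume B < ⊤ := measure_ball_lt_top
  have hBf : IsFiniteMeasure (volume.restrict B) := ⟨by simpa using hBfin⟩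
  have hvi : ∀ m, IntegrableOn (v m) B := fun m =>
    IntegrableOn.of_ae_norm_le hBfin (hv m 0).1 (hb m)
  have hFb : ∀ᵐ x ∂volume.restrict B, ‖F x‖ ≤ C := by
    filter_upwards [hlim, ae_all_iff.2 hb] with x hx hxb
    exact le_of_tendsto hx.norm (Eventually.of_forall hxb)
  have hFi : IntegrableOn F B := IntegrableOn.of_ae_norm_le hBfin
    (hFc.locallyIntegrableOn hBm) hFb
  have hD : Tendsto (fun m => ∫ x in B, ‖v m x - F x‖) atTop (𝓝 0) := by
    have := tendsto_integral_of_dominated_convergence (μ := volume.restrict B)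
      (F := fun m x => ‖v m x - F x‖) (f := fun _ => 0) (fun _ => C + C)
      (fun m => ((hvi m).aestronglyMeasurable.sub hFi.aestronglyMeasurable).norm)
      (integrable_const _) (fun m => by
        filter_upwards [hb m, hFb] with x h1 h2
        rw [norm_norm]
        exact (norm_sub_le _ _).trans (add_le_add h1 h2)) (by
        filter_upwards [hlim] with x hx
        simpa using (hx.sub (tendsto_const_nhds (x := F x))).norm)
    simpa using this
  have hvF : ∀ ψ : Plane → ℝ, Continuous ψ → HasCompactSupport ψ → tsupport ψ ⊆ B →
      Tendsto (fun m => ∫ x, ψ x • v m x) atTop (𝓝 (∫ x, ψ x • F x)) := by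
    intro ψ hψ hc ht
    have h0 := tendsto_integral_smul_zero (fun m => (hvi m).sub hFi) hD hψ hc ht
    have : ∀ m, ∫ x, ψ x • (v m - F) x = (∫ x, ψ x • v m x) - ∫ x, ψ x • F x := by
      intro m
      rw [← integral_sub ((hv m 0).1.integrable_smul_of_tsupport_subset hψ hc ht)
        ((hFc.locallyIntegrableOn hBm).integrable_smul_of_tsupport_subset hψ hc ht)]
      congr 1; ext1 x; rw [Pi.sub_apply, smul_sub]
    simp only [this] at h0
    simpa using h0.add_const (∫ x, ψ x • F x)
  obtain ⟨c, hc⟩ := exists_affine_of_integral_eq_zero hR hFi hFc fun j k φ hφ hφc ht => by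
    have hφ1 : ContDiff ℝ (⊤ : ℕ∞) (fun y => fderiv ℝ φ y (EuclideanSpace.single j 1)) :=
      (hφ.fderiv_right (m := (⊤ : ℕ∞)) (by simp)).clm_apply contDiff_const
    have hφ1c := hφc.fderiv_apply ℝ (EuclideanSpace.single j 1)
    have hφ1t := (tsupport_fderiv_apply_subset' φ (EuclideanSpace.single j 1)).trans ht
    have hφ2 : Continuous (fun x => fderiv ℝ (fun y => fderiv ℝ φ y (EuclideanSpace.single j 1)) x
        (EuclideanSpace.single k 1)) :=
      (hφ1.continuous_fderiv (by simp)).clm_apply continuous_const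
    refine tendsto_nhds_unique (hvF _ hφ2 (hφ1c.fderiv_apply ℝ _)
      ((tsupport_fderiv_apply_subset' _ _).trans hφ1t)) ?_
    have e : ∀ m, ∫ x, fderiv ℝ (fun y => fderiv ℝ φ y (EuclideanSpace.single j 1)) x
        (EuclideanSpace.single k 1) • v m x = ∫ x, φ x • h m k j x := by
      intro m
      rw [(hv m k).integral_eq hφ1 hφ1c hφ1t, (hg m k j).integral_eq hφ hφc ht, neg_neg]
    simp only [e]
    exact tendsto_integral_smul_zero (fun m => hhi m k j) (hh k j) hφ.continuous hφc ht
  refine ⟨c, ?_, hc⟩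
  set A : Plane → Space3 := fun x => F x₀ + ((x - x₀) 0 • c 0 + (x - x₀) 1 • c 1) with hA
  have hAF : ∀ᵐ x ∂volume.restrict B, A x = F x :=
    (ae_restrict_iff' hBm).2 (Eventually.of_forall fun x hx => (hc x hx).symm)
  have hAw : ∀ j, IsWeakPartial B j A fun _ => c j := isWeakPartial_affine hBo _ _ _
  -- the difference of the maps and the limit
  set V : ℕ → Plane → Space3 := fun m x => v m x - A x with hV
  set γ : ℕ → Fin 2 → Plane → Space3 := fun m j x => g m j x - c j with hγ
  have hVw : ∀ m j, IsWeakPartial B j (V m) (γ m j) := fun m j => (hv m j).sub (hAw j)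
  have hγw : ∀ m j k, IsWeakPartial B k (γ m j) (h m j k) := fun m j k => by
    simpa using (hg m j k).sub (isWeakPartial_const hBo (c j) k)
  set M : ℝ := max (C + C) (1 + (‖c 0‖ + ‖c 1‖)) with hM
  have hM0 : 0 ≤ M := le_max_of_le_right (by positivity)
  have hVM : ∀ m, ∀ᵐ x ∂volume.restrict B, ‖V m x‖ ≤ M := fun m => by
    filter_upwards [hb m, hFb, hAF] with x h1 h2 h3
    simp only [hV]; rw [h3]
    exact ((norm_sub_le _ _).trans (add_le_add h1 h2)).trans (le_max_left _ _)
  have hγM : ∀ m j, ∀ᵐ x ∂volume.restrict B, ‖γ m j x‖ ≤ M := fun m j => by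
    filter_upwards [hiso m] with x hx
    have h1 := norm_eq_one_of_orthonormal (g := fun j => g m j x) hx j
    have h2 : ‖c j‖ ≤ ‖c 0‖ + ‖c 1‖ := by
      fin_cases j
      exacts [le_add_of_nonneg_right (norm_nonneg _), le_add_of_nonneg_left (norm_nonneg _)]
    simp only [hγ]
    exact ((norm_sub_le _ _).trans (add_le_add h1.le h2)).trans (le_max_right _ _)
  have hVi : ∀ m, IntegrableOn (V m) B := fun m => IntegrableOn.of_ae_norm_le hBfin (hVw m 0).1 (hVM m)
  have hVD : Tendsto (fun m => ∫ x in B, ‖V m x‖) atTop (𝓝 0) := by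
    refine hD.congr fun m => integral_congr_ae ?_
    filter_upwards [hAF] with x hx
    simp only [hV]; rw [hx]
  -- a cutoff function
  let φb : ContDiffBump x₀ := ⟨R / 4, R / 2, by positivity, by linarith⟩
  set φ : Plane → ℝ := φb.toFun with hφdef
  have hφ : ContDiff ℝ (⊤ : ℕ∞) φ := φb.contDiff
  have hφc : HasCompactSupport φ := φb.hasCompactSupport
  have hφt : tsupport φ ⊆ B := by
    rw [hφdef, φb.tsupport_eq]
    exact Metric.closedBall_subset_ball (show R / 2 < R by linarith)
  have hφpos : 0 < ∫ x, φ x := φb.integral_pos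
  have hφz : ∀ x, x ∉ B → φ x = 0 := fun x hx => image_eq_zero_of_notMem_tsupport fun h => hx (hφt h)
  -- The product rule trades `⟨γ_j, φ γ_k⟩` for the pairing of `V m` with `(∂_j φ) γ_k + φ ∂_j γ_k`.
  -- The first part vanishes because `V m → 0` in `L¹` and `γ_k` is bounded, the second because the
  -- Hessian tends to zero in `L¹` and `V m` is bounded.
  have hI1 : ∀ j k, Tendsto (fun m => ∫ x, inner ℝ (γ m j x) (φ x • γ m k x)) atTop (𝓝 0) := by
    intro j k
    set w : Plane := EuclideanSpace.single j 1 with hw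
    have hφ1 : Continuous (fun x => fderiv ℝ φ x w) :=
      (hφ.continuous_fderiv (by simp)).clm_apply continuous_const
    obtain ⟨K₁, hK₁⟩ := hφ1.bounded_above_of_compact_support (hφc.fderiv_apply ℝ w)
    obtain ⟨K₂, hK₂⟩ := hφ.continuous.bounded_above_of_compact_support hφc
    have hint : ∀ m, Integrable (fun x => fderiv ℝ φ x w • γ m k x + φ x • h m k j x) := fun m =>
      ((hγw m k j).integrable_fderiv_smul hφ hφc hφt w).add
        ((hγw m k j).integrable_smul hφ.continuous hφc hφt)
    have hint2 : ∀ m, Integrable (fun x => φ x • γ m k x) := fun m =>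
      (hγw m k j).1.integrable_smul_of_tsupport_subset hφ.continuous hφc hφt
    have hsupp : ∀ m x, x ∉ B → fderiv ℝ φ x w • γ m k x + φ x • h m k j x = 0 := by
      intro m x hx
      rw [hφz x hx, fderiv_of_notMem_tsupport ℝ fun h => hx (hφt h)]; simp
    have ibd : ∀ {f p : Plane → Space3}, IntegrableOn f B → (∀ᵐ x ∂volume.restrict B, ‖f x‖ ≤ M) →
        Integrable p → (∀ x, x ∉ B → p x = 0) → Integrable fun x => inner ℝ (f x) (p x) := by
      intro f p hf hfM hp hp0
      have e : (fun x => inner ℝ (f x) (p x)) = fun x => inner ℝ (B.indicator f x) (p x) := by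
        ext1 x
        by_cases hx : x ∈ B
        · rw [Set.indicator_of_mem hx]
        · rw [hp0 x hx, inner_zero_right, inner_zero_right]
      rw [e]
      refine Integrable.mono' (hp.norm.const_mul M)
        (((integrable_indicator_iff hBm).2 hf).aestronglyMeasurable.inner hp.aestronglyMeasurable) ?_
      filter_upwards [norm_indicator_le_of_ae hBm hM0 hfM] with x hx
      exact (norm_inner_le_norm _ _).trans (mul_le_mul_of_nonneg_right hx (norm_nonneg _))
    have key : ∀ m, ∫ x, inner ℝ (γ m j x) (φ x • γ m k x) =
        -∫ x, inner ℝ (V m x) (fderiv ℝ φ x w • γ m k x + φ x • h m k j x) := by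
      intro m
      have := (hVw m j).integral_inner_eq_zero hBo hBfin (hγw m k j) (hVM m) (hγM m j) hM0 hφ hφc hφt
      rw [integral_add (ibd (hVi m) (hVM m) (hint m) (hsupp m))
        (ibd (IntegrableOn.of_ae_norm_le hBfin (hVw m j).2.1 (hγM m j)) (hγM m j) (hint2 m)
          fun x hx => by rw [hφz x hx, zero_smul])] at this
      exact eq_neg_of_add_eq_zero_right this
    have hbound : Tendsto (fun m => ∫ x in B, (K₁ * M * ‖V m x‖ + M * K₂ * ‖h m k j x‖)) atTop (𝓝 0) := by
      have e : ∀ m, ∫ x in B, (K₁ * M * ‖V m x‖ + M * K₂ * ‖h m k j x‖) =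
          K₁ * M * (∫ x in B, ‖V m x‖) + M * K₂ * ∫ x in B, ‖h m k j x‖ := by
        intro m
        rw [integral_add ((hVi m).norm.const_mul _) ((hhi m k j).norm.const_mul _),
          integral_const_mul, integral_const_mul]
      simp only [e]
      simpa using (hVD.const_mul (K₁ * M)).add ((hh k j).const_mul (M * K₂))
    refine squeeze_zero_norm (fun m => ?_) hbound
    rw [key, norm_neg]
    refine norm_integral_le_setIntegral (((hVi m).norm.const_mul _).add ((hhi m k j).norm.const_mul _))
      (fun x hx => by rw [hsupp m x hx, inner_zero_right]) ?_
    filter_upwards [hVM m, hγM m k] with x h1 h2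
    rw [inner_add_right]
    have hK10 : 0 ≤ K₁ := (norm_nonneg _).trans (hK₁ x)
    have hK20 : 0 ≤ K₂ := (norm_nonneg _).trans (hK₂ x)
    refine (norm_add_le _ _).trans (add_le_add ?_ ?_)
    · refine (norm_inner_le_norm _ _).trans ?_
      rw [norm_smul, mul_comm]
      exact mul_le_mul_of_nonneg_right (mul_le_mul (hK₁ x) h2 (norm_nonneg _) hK10) (norm_nonneg _)
    · refine (norm_inner_le_norm _ _).trans ?_
      rw [norm_smul, mul_assoc]
      exact mul_le_mul h1 (mul_le_mul_of_nonneg_right (hK₂ x) (norm_nonneg _)) (by positivity) hM0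
  have hI2 : ∀ j, Tendsto (fun m => ∫ x, φ x • γ m j x) atTop (𝓝 0) := by
    intro j
    have e : ∀ m, ∫ x, φ x • γ m j x = -∫ x, fderiv ℝ φ x (EuclideanSpace.single j 1) • V m x :=
      fun m => by rw [(hVw m j).integral_eq hφ hφc hφt, neg_neg]
    simp only [e]
    simpa using (tendsto_integral_smul_zero hVi hVD
      ((hφ.continuous_fderiv (by simp)).clm_apply continuous_const)
      (hφc.fderiv_apply ℝ (EuclideanSpace.single j 1))
      ((tsupport_fderiv_apply_subset' φ _).trans hφt)).neg
  intro j k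
  set δ : ℝ := if j = k then 1 else 0 with hδ
  have hφi : Integrable φ := hφ.continuous.integrable_of_hasCompactSupport hφc
  have hγφ : ∀ m j, Integrable fun x => φ x • γ m j x := fun m j =>
    (hγw m j j).1.integrable_smul_of_tsupport_subset hφ.continuous hφc hφt
  -- Expanding around `c` with the constraint gives `⟨γ_j, γ_k⟩ = δ - ⟨c_j, c_k⟩ - ⟨c_j, γ_k⟩ -
  -- ⟨c_k, γ_j⟩`. In the limit only the constant times `∫ φ > 0` remains.
  have e : ∀ m, ∫ x, inner ℝ (γ m j x) (φ x • γ m k x) =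
      (δ - inner ℝ (c j) (c k)) * (∫ x, φ x) - inner ℝ (c j) (∫ x, φ x • γ m k x) -
        inner ℝ (c k) (∫ x, φ x • γ m j x) := by
    intro m
    have i3 : Integrable fun x => (δ - inner ℝ (c j) (c k)) * φ x - inner ℝ (c j) (φ x • γ m k x) :=
      (hφi.const_mul _).sub ((hγφ m k).const_inner _)
    rw [← integral_inner (hγφ m k), ← integral_inner (hγφ m j), ← integral_const_mul,
      ← integral_sub (hφi.const_mul _) ((hγφ m k).const_inner _),
      ← integral_sub i3 ((hγφ m j).const_inner _)]
    apply integral_congr_ae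
    have h1 := hiso m
    rw [ae_restrict_iff' hBm] at h1
    filter_upwards [h1] with x hx
    by_cases hxB : x ∈ B
    · have h2 := hx hxB j k
      simp only [hγ, inner_smul_right, inner_sub_left, inner_sub_right]
      rw [h2, real_inner_comm (c k) (g m j x), real_inner_comm (c j) (c k)]
      ring
    · rw [hφz x hxB]; simp
  have hlim2 : Tendsto (fun m => (δ - inner ℝ (c j) (c k)) * (∫ x, φ x) -
      inner ℝ (c j) (∫ x, φ x • γ m k x) - inner ℝ (c k) (∫ x, φ x • γ m j x)) atTop
      (𝓝 ((δ - inner ℝ (c j) (c k)) * (∫ x, φ x) - inner ℝ (c j) (0 : Space3) -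
        inner ℝ (c k) (0 : Space3))) :=
    (tendsto_const_nhds.sub (tendsto_const_nhds.inner (hI2 k))).sub
      (tendsto_const_nhds.inner (hI2 j))
  have h3 := hI1 j k
  simp only [e] at h3
  have h4 := tendsto_nhds_unique hlim2 h3
  rw [inner_zero_right, inner_zero_right, sub_zero, sub_zero] at h4
  rcases mul_eq_zero.1 h4 with h5 | h5
  · linarith
  · exact absurd h5 (ne_of_gt hφpos)

/-! ### Admissible maps -/

theorem bendingEnergy_nonneg (U : Set Plane) (f : Plane → Space3) : 0 ≤ bendingEnergy U f :=
  mul_nonneg (by norm_num) (integral_nonneg fun _ =>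
    Finset.sum_nonneg fun _ _ => Finset.sum_nonneg fun _ _ => by positivity)

theorem bendingEnergy_eq_zero {U : Set Plane} {f : Plane → Space3}
    (h : ∀ j k, weakHess U f j k =ᵐ[volume.restrict U] 0) : bendingEnergy U f = 0 := by
  have h' : ∀ᵐ x ∂volume.restrict U, ∀ j k, weakHess U f j k x = 0 :=
    ae_all_iff.2 fun j => ae_all_iff.2 fun k => h j k
  have : ∫ x in U, ∑ j : Fin 2, ∑ k : Fin 2, ‖weakHess U f j k x‖ ^ 2 = ∫ x in U, (0 : ℝ) :=
    integral_congr_ae (h'.mono fun x hx => by simp [hx])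
  rw [bendingEnergy, this]; simp

/-- Maps whose weak gradient is locally constant belong to `H²` and have no bending energy. -/
theorem memH2_of_weakPartial_const {U : Set Plane} (hU : IsOpen U) {f : Plane → Space3}
    {g : Fin 2 → Plane → Space3} (hf : MemLp f 2 (volume.restrict U))
    (hg : ∀ j, IsWeakPartial U j f (g j)) (hgl : ∀ j, MemLp (g j) 2 (volume.restrict U))
    (hh : ∀ j k, IsWeakPartial U k (g j) fun _ => 0) :
    MemH2 U f ∧ ∀ j k, weakHess U f j k =ᵐ[volume.restrict U] 0 := by
  have e := fun j => (hg j).weakPartial_ae_eq hU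
  have hw : ∀ j k, IsWeakPartial U k (weakPartial U j f) fun _ => 0 := fun j k =>
    (hh j k).congr_ae (e j).symm (ae_eq_refl _)
  have hz : ∀ j k, weakHess U f j k =ᵐ[volume.restrict U] 0 := fun j k =>
    (hw j k).weakPartial_ae_eq hU
  exact ⟨⟨hf, fun j => ⟨⟨_, hg j⟩, (hgl j).ae_eq (e j).symm⟩,
    fun j k => ⟨⟨_, hw j k⟩, (MemLp.zero' (ε := Space3)).ae_eq (hz j k).symm⟩⟩, hz⟩

/-- The affine map with constant term `a` and partial derivatives `c`. -/
def affineMap (a : Space3) (c : Fin 2 → Space3) (x : Plane) : Space3 :=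
  a + (x 0 • c 0 + x 1 • c 1)

theorem isWeakPartial_affineMap {U : Set Plane} (hU : IsOpen U) (a : Space3) (c : Fin 2 → Space3)
    (j : Fin 2) : IsWeakPartial U j (affineMap a c) fun _ => c j := by
  simpa using! isWeakPartial_affine hU a 0 c j

theorem dist_affineMap (a : Space3) {c : Fin 2 → Space3}
    (hc : ∀ j k, inner ℝ (c j) (c k) = if j = k then (1 : ℝ) else 0) (x y : Plane) :
    dist (affineMap a c x) (affineMap a c y) = dist x y := by
  rw [dist_eq_norm, dist_eq_norm, ← norm_combo_eq hc (x - y)]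
  congr 1
  simp only [affineMap, PiLp.sub_apply]
  module

theorem isometry_affineMap (a : Space3) {c : Fin 2 → Space3}
    (hc : ∀ j k, inner ℝ (c j) (c k) = if j = k then (1 : ℝ) else 0) : Isometry (affineMap a c) :=
  Isometry.of_dist_eq (dist_affineMap a hc)

theorem hasLineDerivAt_affineMap (a : Space3) (c : Fin 2 → Space3) (x : Plane) (j : Fin 2) :
    HasLineDerivAt ℝ (affineMap a c) (c j) x (EuclideanSpace.single j 1) := by
  set L : Plane →L[ℝ] Space3 := (EuclideanSpace.proj 0 : Plane →L[ℝ] ℝ).smulRight (c 0) +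
    (EuclideanSpace.proj 1 : Plane →L[ℝ] ℝ).smulRight (c 1) with hL
  have e : affineMap a c = fun x => a + L x := by
    ext1 x; simp [hL, affineMap]
  have hLj : L (EuclideanSpace.single j 1) = c j := by fin_cases j <;> simp [hL]
  rw [e, ← hLj]
  exact (L.hasFDerivAt.const_add a).hasLineDerivAt _

theorem memLp_of_bound_of_isBounded {U : Set Plane} (hUb : Bornology.IsBounded U) {f : Plane → Space3}
    (hf : AEStronglyMeasurable f (volume.restrict U)) {M : ℝ}
    (hM : ∀ᵐ x ∂volume.restrict U, ‖f x‖ ≤ M) (p : ENNReal) : MemLp f p (volume.restrict U) := by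
  have : IsFiniteMeasure (volume.restrict U) := ⟨by simpa using hUb.measure_lt_top⟩
  exact MemLp.of_bound hf M hM

namespace CreasedPlate

variable (P : CreasedPlate)

theorem isBounded_ω : Bornology.IsBounded P.ω := by
  refine (((P.sub_lipschitz 0).2.2.1.union (P.sub_lipschitz 1).2.2.1).union
    P.isCompact_γ.isBounded).subset fun x hx => ?_
  by_cases hγ : x ∈ P.γ
  · exact Or.inr hγ
  · obtain ⟨l, hl⟩ := P.mem_sub_of_mem hx hγ
    fin_cases l
    exacts [Or.inl (Or.inl hl), Or.inl (Or.inr hl)]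

open Classical in
/-- The map that equals `f 0` on the first subdomain and `f 1` elsewhere. -/
def glue {E : Type*} (f : Fin 2 → Plane → E) (x : Plane) : E :=
  if x ∈ P.sub 0 then f 0 x else f 1 x

theorem glue_eq {E : Type*} (f : Fin 2 → Plane → E) {l : Fin 2} {x : Plane} (hx : x ∈ P.sub l) :
    P.glue f x = f l x := by
  fin_cases l
  · exact if_pos hx
  · exact if_neg fun h => Set.disjoint_left.1 P.sub_disjoint h hx

theorem glue_eventuallyEq {E : Type*} (f : Fin 2 → Plane → E) {l : Fin 2} {x : Plane}
    (hx : x ∈ P.sub l) : P.glue f =ᶠ[𝓝 x] f l := by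
  filter_upwards [(P.sub_lipschitz l).1.mem_nhds hx] with y hy using P.glue_eq f hy

theorem measurable_glue {f : Fin 2 → Plane → Space3} (hf : ∀ l, Measurable (f l)) :
    Measurable (P.glue f) :=
  Measurable.ite (P.sub_lipschitz 0).1.measurableSet (hf 0) (hf 1)

theorem ae_notMem_γ : ∀ᵐ x, x ∉ P.γ := by
  rw [ae_iff]; simpa using P.volume_γ

variable {P}

/-- A segment between the two sides crosses the frontier of `sub 0` at a crease point, where the two
isometries agree; the distances on either side of that point add up along the segment. -/
theorem dist_glue_le {f : Fin 2 → Plane → Space3} (hf : ∀ l, Isometry (f l))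
    (hγ : ∀ p ∈ P.γ, p ∈ P.ω → f 0 p = f 1 p) {y z : Plane} (hyz : segment ℝ y z ⊆ P.ω) :
    dist (P.glue f y) (P.glue f z) ≤ dist y z := by
  have key : ∀ y z, segment ℝ y z ⊆ P.ω → y ∈ P.sub 0 → z ∉ P.sub 0 →
      dist (f 0 y) (f 1 z) ≤ dist y z := by
    intro y z hyz hy hz
    have hSo := (P.sub_lipschitz 0).1
    obtain ⟨q, hq, hqf⟩ : ∃ q ∈ segment ℝ y z, q ∈ frontier (P.sub 0) := by
      by_contra! hcon
      refine hz ((convex_segment y z).isPreconnected.subset_of_closure_inter_subset hSo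
        ⟨y, left_mem_segment ℝ y z, hy⟩ (fun q hq => ?_) (right_mem_segment ℝ y z))
      by_contra hqS
      exact hcon q hq.2 (hSo.frontier_eq ▸ ⟨hq.1, hqS⟩)
    have hqγ : q ∈ P.γ := by
      by_contra hcon
      exact (hSo.frontier_eq ▸ hqf).2
        (P.mem_sub_of_closure (hyz hq) hcon (frontier_subset_closure hqf))
    calc dist (f 0 y) (f 1 z) ≤ dist (f 0 y) (f 0 q) + dist (f 0 q) (f 1 z) := dist_triangle _ _ _
      _ = dist y q + dist q z := by
        rw [(hf 0).dist_eq, hγ q hqγ (hyz hq), (hf 1).dist_eq]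
      _ = dist y z := dist_add_dist_of_mem_segment hq
  by_cases hy : y ∈ P.sub 0 <;> by_cases hz : z ∈ P.sub 0
  · rw [glue, glue, if_pos hy, if_pos hz, (hf 0).dist_eq]
  · rw [glue, glue, if_pos hy, if_neg hz]; exact key y z hyz hy hz
  · rw [glue, glue, if_neg hy, if_pos hz, dist_comm, dist_comm y]
    exact key z y (by rwa [segment_symm]) hz hy
  · rw [glue, glue, if_neg hy, if_neg hz, (hf 1).dist_eq]

variable (P)

theorem isOpen_compl_γ : IsOpen (P.ω \ P.γ) := P.ω_open.sdiff P.isCompact_γ.isClosed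

/-- Continuous piecewise affine isometries are admissible and have no bending energy. -/
theorem glue_mem_V (a : Fin 2 → Space3) {c : Fin 2 → Fin 2 → Space3}
    (hc : ∀ l j k, inner ℝ (c l j) (c l k) = if j = k then (1 : ℝ) else 0)
    (hγ : ∀ p ∈ P.γ, p ∈ P.ω → affineMap (a 0) (c 0) p = affineMap (a 1) (c 1) p) :
    (P.glue fun l => affineMap (a l) (c l)) ∈ P.V ∧
      ∀ j k, weakHess (P.ω \ P.γ) (P.glue fun l => affineMap (a l) (c l)) j k
        =ᵐ[volume.restrict (P.ω \ P.γ)] 0 := by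
  set f : Plane → Space3 := P.glue fun l => affineMap (a l) (c l) with hf
  set g : Fin 2 → Plane → Space3 := fun j => P.glue fun l _ => c l j with hg
  have hiso : ∀ l, Isometry (affineMap (a l) (c l)) := fun l => isometry_affineMap _ (hc l)
  have hfm : Measurable f := P.measurable_glue fun l => (hiso l).continuous.measurable
  have hgm : ∀ j, Measurable (g j) := fun j => P.measurable_glue fun l => measurable_const
  have hgn : ∀ j x, ‖g j x‖ ≤ 1 := by
    intro j x
    simp only [hg, glue]
    split_ifs
    exacts [(norm_eq_one_of_orthonormal (hc 0) j).le, (norm_eq_one_of_orthonormal (hc 1) j).le]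
  have hgl : ∀ j U, LocallyIntegrableOn (g j) U := fun j U =>
    (((memLp_top_of_bound (hgm j).aestronglyMeasurable 1
      (Eventually.of_forall (hgn j))).locallyIntegrable le_top).locallyIntegrableOn U)
  obtain ⟨M, hM⟩ : ∃ M, ∀ x ∈ P.ω, ‖f x‖ ≤ M := by
    have hb : ∀ l, ∃ M, ∀ x ∈ P.ω, ‖affineMap (a l) (c l) x‖ ≤ M := by
      intro l
      obtain ⟨M, hM⟩ := ((hiso l).lipschitz.isBounded_image P.isBounded_ω).exists_norm_le
      exact ⟨M, fun x hx => hM _ ⟨x, hx, rfl⟩⟩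
    obtain ⟨M₀, h₀⟩ := hb 0
    obtain ⟨M₁, h₁⟩ := hb 1
    refine ⟨max M₀ M₁, fun x hx => ?_⟩
    simp only [hf, glue]
    split_ifs
    exacts [(h₀ x hx).trans (le_max_left _ _), (h₁ x hx).trans (le_max_right _ _)]
  have hMae : ∀ U ⊆ P.ω, MeasurableSet U → ∀ᵐ x ∂volume.restrict U, ‖f x‖ ≤ M := fun U hU hUm =>
    (ae_restrict_iff' hUm).2 (Eventually.of_forall fun x hx => hM x (hU hx))
  -- No jump term arises at the crease: the glued map is `1`-Lipschitz on balls of `ω`, and its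
  -- pointwise derivative is known off the null set `γ`.
  have hw : ∀ j, IsWeakPartial P.ω j f (g j) := by
    intro j
    refine isWeakPartial_of_lipschitz P.ω_open (C := 1) (fun x r hball => ?_) ?_ (hgl j _)
    · refine LipschitzOnWith.of_dist_le_mul fun y hy z hz => ?_
      rw [NNReal.coe_one, one_mul]
      exact dist_glue_le hiso hγ (((convex_ball x r).segment_subset hy hz).trans hball)
    · rw [ae_restrict_iff' P.ω_open.measurableSet]
      filter_upwards [P.ae_notMem_γ] with x hxγ hxω
      obtain ⟨l, hl⟩ := P.mem_sub_of_mem hxω hxγ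
      have h1 := (hasLineDerivAt_affineMap (a l) (c l) x j).congr_of_eventuallyEq
        (P.glue_eventuallyEq (fun l => affineMap (a l) (c l)) hl)
      rwa [show g j x = c l j from P.glue_eq (fun l _ => c l j) hl]
  have hsub : P.ω \ P.γ ⊆ P.ω := Set.sdiff_subset
  have hbd : Bornology.IsBounded (P.ω \ P.γ) := P.isBounded_ω.subset hsub
  have hH := memH2_of_weakPartial_const P.isOpen_compl_γ (f := f) (g := g)
    (memLp_of_bound_of_isBounded hbd hfm.aestronglyMeasurable
      (hMae _ hsub P.isOpen_compl_γ.measurableSet) 2)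
    (fun j => (hw j).mono hsub)
    (fun j => memLp_of_bound_of_isBounded hbd (hgm j).aestronglyMeasurable
      (Eventually.of_forall (hgn j)) 2)
    -- A ball in `ω \ γ` lies in one subdomain, so there the gradient is constant.
    (fun j k => by
      refine isWeakPartial_of_lipschitz P.isOpen_compl_γ (C := 0) (fun x r hball => ?_) ?_
        locallyIntegrableOn_zero
      · obtain ⟨l, hl⟩ := P.subset_sub_of_isPreconnected (convex_ball x r).isPreconnected hball
        refine LipschitzOnWith.of_dist_le_mul fun y hy z hz => ?_
        simp only [hg]
        rw [P.glue_eq _ (hl hy), P.glue_eq _ (hl hz)]; simp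
      · rw [ae_restrict_iff' P.isOpen_compl_γ.measurableSet]
        refine Eventually.of_forall fun x hx => ?_
        obtain ⟨l, hl⟩ := P.mem_sub_of_mem hx.1 hx.2
        refine HasLineDerivAt.congr_of_eventuallyEq ?_ (P.glue_eventuallyEq (fun l _ => c l j) hl)
        exact (hasFDerivAt_const (𝕜 := ℝ) (c l j) x).hasLineDerivAt _)
  have hae := fun j => (hw j).weakPartial_ae_eq P.ω_open
  refine ⟨⟨hH.1, ⟨memLp_of_bound_of_isBounded P.isBounded_ω hfm.aestronglyMeasurable
    (hMae _ subset_rfl P.ω_open.measurableSet) ⊤, fun j => ⟨⟨_, hw j⟩, ?_⟩⟩, ?_⟩, hH.2⟩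
  · exact (memLp_of_bound_of_isBounded P.isBounded_ω (hgm j).aestronglyMeasurable
      (Eventually.of_forall (hgn j)) ⊤).ae_eq (hae j).symm
  · filter_upwards [hae 0, hae 1] with x h0 h1 j k
    have h2 : ∀ j, weakPartial P.ω j f x = g j x := fun j => by
      fin_cases j
      exacts [h0, h1]
    rw [h2, h2]
    simp only [hg, glue]
    by_cases hx : x ∈ P.sub 0
    · simp only [if_pos hx]; exact hc 0 j k
    · simp only [if_neg hx]; exact hc 1 j k

end CreasedPlate

namespace CreaseApprox

variable {P : CreasedPlate} (A : CreaseApprox P)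

/-- Affine isometries are admissible for the approximating problem and have no bending energy. -/
theorem exists_mem_V_I_eq_zero : ∃ v ∈ A.V, A.I v = 0 := by
  set c : Fin 2 → Space3 := ![EuclideanSpace.single 0 1, EuclideanSpace.single 1 1] with hcdef
  have hc : ∀ j k, inner ℝ (c j) (c k) = if j = k then (1 : ℝ) else 0 := by
    intro j k
    fin_cases j <;> fin_cases k <;> simp [hcdef, EuclideanSpace.inner_single_left]
  have hb : Bornology.IsBounded A.dom := P.isBounded_ω.subset Set.sdiff_subset
  have hcont : Continuous (affineMap 0 c) := (isometry_affineMap 0 hc).continuous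
  obtain ⟨M, hM⟩ := ((isometry_affineMap 0 hc).lipschitz.isBounded_image hb).exists_norm_le
  have hw := isWeakPartial_affineMap A.isOpen_dom 0 c
  have hH := memH2_of_weakPartial_const A.isOpen_dom (f := affineMap 0 c) (g := fun j _ => c j)
    (memLp_of_bound_of_isBounded hb hcont.aestronglyMeasurable
      ((ae_restrict_iff' A.isOpen_dom.measurableSet).2
        (Eventually.of_forall fun x hx => hM _ ⟨x, hx, rfl⟩)) 2)
    hw (fun j => memLp_of_bound_of_isBounded hb aestronglyMeasurable_const
      (Eventually.of_forall fun _ => le_rfl) 2)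
    (fun j k => isWeakPartial_const A.isOpen_dom _ _)
  refine ⟨affineMap 0 c, ⟨hH.1, ?_, affineMap 0 c, ae_eq_refl _, hcont.continuousOn⟩,
    bendingEnergy_eq_zero hH.2⟩
  have hae := fun j => (hw j).weakPartial_ae_eq A.isOpen_dom
  filter_upwards [hae 0, hae 1] with x h0 h1 j k
  have h2 : ∀ j, weakPartial A.dom j (affineMap 0 c) x = c j := fun j => by
    fin_cases j
    exacts [h0, h1]
  rw [h2, h2, hc]

variable {A}

/-- The constraint makes the weak gradient a linear isometry almost everywhere, so the continuous
representative is nonexpansive on balls. This and continuity at the vertices are all that the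
uniform bounds use. -/
theorem exists_rep {v : Plane → Space3} (hv : v ∈ A.V) :
    ∃ w : Plane → Space3, w =ᵐ[volume.restrict A.dom] v ∧
      ContinuousOn w (A.dom ∪ Set.range A.vertex) ∧ LocNonexpansive A.dom w := by
  obtain ⟨⟨hvL, hv1, -⟩, hviso, w, hwv, hwc⟩ := hv
  refine ⟨w, hwv, hwc, fun x r hball y hy z hz => ?_⟩
  have hle : volume.restrict (Metric.ball x r) ≤ volume.restrict A.dom :=
    Measure.restrict_mono hball le_rfl
  have : IsFiniteMeasure (volume.restrict (Metric.ball x r)) := ⟨by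
    simpa using (measure_ball_lt_top : volume (Metric.ball x r) < ⊤)⟩
  refine dist_le_of_isWeakPartial (f := v) (g := fun j => weakPartial A.dom j v)
    ((hvL.mono_measure hle).integrable one_le_two)
    (fun j => (hv1 j).1.isWeakPartial.mono hball) (ae_mono hle hviso) (ae_mono hle hwv)
    (hwc.mono (hball.trans Set.subset_union_left)) hy hz

end CreaseApprox

/-! ### Fine meshes -/

namespace CreasedPlate

variable (P : CreasedPlate)

theorem exists_ne_mem_γ : ∃ g₁ ∈ P.γ, ∃ g₂ ∈ P.γ, g₁ ≠ g₂ := by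
  have h := P.α_lt_β
  have h1 : P.α ∈ Set.Icc P.α P.β := ⟨le_rfl, h.le⟩
  have h2 : (P.α + P.β) / 2 ∈ Set.Icc P.α P.β := ⟨by linarith, by linarith⟩
  refine ⟨_, ⟨_, h1, rfl⟩, _, ⟨_, h2, rfl⟩, fun heq => ?_⟩
  have := (P.b_simple _ h1 _ h2 (by linarith) heq).2
  linarith

/-- Otherwise the connected set `ω` would lie in one subdomain, leaving no room for the other. -/
theorem exists_mem_γ_mem_ω : ∃ p ∈ P.γ, p ∈ P.ω := by
  by_contra! hcon
  obtain ⟨l, hl⟩ := P.subset_sub_of_isPreconnected P.ω_connected.isPreconnected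
    fun z hz => ⟨hz, fun h => hcon z h hz⟩
  obtain ⟨k, hk⟩ : ∃ k : Fin 2, k ≠ l := exists_ne _
  obtain ⟨z, hz⟩ := (P.sub_lipschitz k).2.1.nonempty
  exact Set.disjoint_left.1 (P.sub_disjoint_of_ne hk) hz (hl (P.sub_subset k hz).1)

/-- Regular points are dense in the crease line. -/
theorem exists_regular_near {p : Plane} (hp : p ∈ P.γ) (hpω : p ∈ P.ω) {ε : ℝ} (hε : 0 < ε) :
    ∃ p' ∈ P.γ, p' ∈ P.ω ∧ dist p p' < ε ∧ ∃ e n s₀, ∃ r₀ > 0, ∀ r, 0 < r → r < r₀ →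
      ∃ η, LocalGraph P p' e n s₀ η r := by
  obtain ⟨s, hs, rfl⟩ := hp
  obtain ⟨ρ, hρ, hball⟩ := Metric.isOpen_iff.1 P.ω_open _ hpω
  obtain ⟨n, τ, hτ, hτ0, hτn, hC⟩ := P.b_arclength
  set δ := min ε ρ with hδ
  have hδ0 : 0 < δ := lt_min hε hρ
  have hab : max P.α (s - δ) < min P.β (s + δ) := by
    have := P.α_lt_β
    refine max_lt (lt_min this (by linarith [hs.1])) (lt_min (by linarith [hs.2]) (by linarith))
  -- Only finitely many parameters are breakpoints, so a nearby interior parameter of a `C¹` piece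
  -- exists.
  obtain ⟨s', hs', hs'τ⟩ := ((Set.Ioo_infinite hab).sdiff (Set.finite_range τ)).nonempty
  have h1 : P.α < s' := (le_max_left _ _).trans_lt hs'.1
  have h2 : s - δ < s' := (le_max_right _ _).trans_lt hs'.1
  have h3 : s' < P.β := hs'.2.trans_le (min_le_left _ _)
  have h4 : s' < s + δ := hs'.2.trans_le (min_le_right _ _)
  have hs'I : s' ∈ Set.Icc P.α P.β := ⟨h1.le, h3.le⟩
  have hd : dist (P.b s) (P.b s') < δ :=
    (P.dist_b_le hs hs'I).trans_lt (abs_lt.2 ⟨by linarith, by linarith⟩)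
  have hω : P.b s' ∈ P.ω := hball (by
    rw [Metric.mem_ball, dist_comm]; exact hd.trans_le (min_le_right _ _))
  obtain ⟨i, hi1, hi2⟩ : ∃ i : Fin n, τ i.castSucc ≤ s' ∧ s' < τ i.succ := by
    have key : ∀ k : Fin (n + 1), s' < τ k → ∃ i : Fin n, τ i.castSucc ≤ s' ∧ s' < τ i.succ := by
      intro k
      induction k using Fin.induction with
      | zero => intro h; rw [hτ0] at h; linarith
      | succ i ih =>
        intro h
        rcases lt_or_ge s' (τ i.castSucc) with h' | h'
        exacts [ih h', ⟨i, h', h⟩]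
    exact key (Fin.last n) (hτn ▸ h3)
  have hi1' : τ i.castSucc < s' := lt_of_le_of_ne hi1 fun h => hs'τ ⟨_, h⟩
  obtain ⟨e, n', r₀, hr₀, hG⟩ := exists_localGraph P (u := τ i.castSucc) (v := τ i.succ)
    (Set.Icc_subset_Icc (hτ0 ▸ hτ.monotone (Fin.zero_le _)) (hτn ▸ hτ.monotone (Fin.le_last _)))
    ⟨hi1', hi2⟩ (hC i).1 ((hC i).2 s' ⟨hi1', hi2⟩) hω
  exact ⟨P.b s', ⟨s', hs'I, rfl⟩, hω, hd.trans_le (min_le_left _ _), e, n', s', r₀, hr₀, hG⟩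

end CreasedPlate

namespace MeshSizeVanishes

variable {P : CreasedPlate} {A : ℕ → CreaseApprox P}

theorem eventually_ball_subset_dom (hmesh : MeshSizeVanishes A) {x : Plane} {ρ : ℝ} (hρ : 0 < ρ)
    (hx : Metric.ball x (2 * ρ) ⊆ P.ω \ P.γ) : ∀ᶠ m in atTop, Metric.ball x ρ ⊆ (A m).dom := by
  filter_upwards [hmesh (ρ / 2) (by positivity)] with m hm z hz
  refine ⟨(hx (Metric.ball_subset_ball (by linarith) hz)).1, fun hf => ?_⟩
  obtain ⟨c, hc, hzc, -⟩ := CreaseApprox.fat_near hm z hf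
  refine (hx ?_).2 hc
  rw [Metric.mem_ball] at hz ⊢
  linarith [dist_triangle_left c x z]

theorem exists_ball_subset_dom (hmesh : MeshSizeVanishes A) {x : Plane} (hx : x ∈ P.ω \ P.γ) :
    ∃ ρ > 0, Metric.ball x ρ ⊆ P.ω \ P.γ ∧ ∀ᶠ m in atTop, Metric.ball x ρ ⊆ (A m).dom := by
  obtain ⟨ρ, hρ, hball⟩ := Metric.isOpen_iff.1 P.isOpen_compl_γ x hx
  refine ⟨ρ / 2, by positivity, (Metric.ball_subset_ball (by linarith)).trans hball,
    eventually_ball_subset_dom hmesh (by positivity) ?_⟩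
  rwa [mul_div_cancel₀ _ two_ne_zero]

theorem eventually_vertex_ne (hmesh : MeshSizeVanishes A) :
    ∀ᶠ m in atTop, ∀ i : Fin (A m).N, P.b ((A m).t i.castSucc) ≠ P.b ((A m).t i.succ) := by
  obtain ⟨g₁, h₁, g₂, h₂, hne⟩ := P.exists_ne_mem_γ
  have hd := dist_pos.2 hne
  filter_upwards [hmesh (dist g₁ g₂ / 3) (by positivity)] with m hm i
  exact CreaseApprox.vertex_ne hm h₁ h₂ (by linarith) i

/-- The values of admissible maps on the two sides of a regular point of the crease line. -/
theorem exists_link (hmesh : MeshSizeVanishes A) {κ : ℝ} (hκ : 0 < κ)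
    (hreg : ∀ m, ∀ s ∈ (A m).K.faces, s.card = 3 →
      ∃ x, Metric.closedBall x (κ * Metric.diam (s : Set Plane)) ⊆ convexHull ℝ (s : Set Plane))
    {p e n : Plane} {s₀ : ℝ} {η : ℝ → ℝ} {r : ℝ} (G : LocalGraph P p e n s₀ η r) (hp : p ∈ P.γ)
    (hpω : p ∈ P.ω) :
    ∃ z : Fin 2 → Plane, (∀ l, z l ∈ P.sub l ∧ dist (z l) p ≤ r) ∧
      ∀ᶠ m in atTop, (∀ l, z l ∉ (A m).fat) ∧ ∀ w : Plane → Space3,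
        LocNonexpansive (A m).dom w → ContinuousOn w ((A m).dom ∪ Set.range (A m).vertex) →
          dist (w (z 0)) (w (z 1)) ≤ 2 * ((2100 + 2400 / κ ^ 2) * r) := by
  have hr := G.r_pos
  obtain ⟨z, hz, hlink⟩ := G.exists_link hp (CreaseApprox.mem_closure_sub hmesh hp hpω)
  refine ⟨z, hz, ?_⟩
  filter_upwards [hmesh (r / 17) (by positivity), hmesh.eventually_vertex_ne] with m hm hne
  have h := hlink (A m) κ (r / 17) hκ (by linarith) hm (hreg m) hne
  -- That the reference points avoid the fattened crease line does not depend on the map, so it is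
  -- read off from the zero map.
  have hz2 : ∀ l, z l ∉ (A m).fat :=
    (h (fun _ => 0) (fun _ _ _ _ _ _ _ => by simp) continuousOn_const).1
  exact ⟨hz2, fun w hw hwc => (h w hw hwc).2⟩

/-- Admissible maps are bounded up to constants, uniformly in the approximation. -/
theorem exists_bound (hmesh : MeshSizeVanishes A) {κ : ℝ} (hκ : 0 < κ)
    (hreg : ∀ m, ∀ s ∈ (A m).K.faces, s.card = 3 →
      ∃ x, Metric.closedBall x (κ * Metric.diam (s : Set Plane)) ⊆ convexHull ℝ (s : Set Plane)) :
    ∃ C, ∃ x₀ ∈ P.ω \ P.γ, ∀ᶠ m in atTop, ∀ w : Plane → Space3,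
        LocNonexpansive (A m).dom w → ContinuousOn w ((A m).dom ∪ Set.range (A m).vertex) →
          ∀ x ∈ (A m).dom, dist (w x) (w x₀) ≤ C := by
  obtain ⟨p₀, hp₀, hp₀ω⟩ := P.exists_mem_γ_mem_ω
  obtain ⟨p, hp, hpω, -, e, n, s₀, r₀, hr₀, hG⟩ := P.exists_regular_near hp₀ hp₀ω one_pos
  obtain ⟨η, G⟩ := hG (r₀ / 2) (by positivity) (by linarith)
  obtain ⟨z, hz, hlink⟩ := hmesh.exists_link hκ hreg G hp hpω
  choose B hB g hg hcol using fun l => (P.sub_lipschitz l).exists_collar_bound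
  obtain ⟨Δ, hΔ⟩ := Metric.isBounded_iff.1 P.isBounded_ω
  set K : Fin 2 → ℝ := fun l => 40 * (B l + 10 / κ * ((P.β - P.α) / κ)) with hK
  set Λ := 2 * ((2100 + 2400 / κ ^ 2) * (r₀ / 2)) with hΛ
  have hΛ0 : 0 ≤ Λ := by positivity
  have hba : 0 ≤ P.β - P.α := sub_nonneg.2 P.α_lt_β.le
  have hK0 : ∀ l, 0 ≤ K l := fun l => by have := hB l; simp only [hK]; positivity
  refine ⟨Δ + (K 0 + K 1) + Λ, z 0, P.sub_subset 0 (hz 0).1, ?_⟩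
  filter_upwards [hlink, hmesh.eventually_vertex_ne] with m hm hne w hw hwc x hx
  -- Each point is compared with the reference point of its own side; for the side `l = 1` the link
  -- leads on to `z 0`.
  have key : ∀ l, x ∈ P.sub l \ (A m).fat → dist (w x) (w (z l)) ≤ Δ + K l := by
    intro l hxl
    refine ((CreaseApprox.dist_le_of_mem_sub hκ (hreg m) hne (hB l) (hg l) (hcol l) hw hxl
      ⟨(hz l).1, hm.1 l⟩)).trans (add_le_add ?_ le_rfl)
    exact hΔ hx.1 (P.sub_subset l (hz l).1).1
  obtain ⟨l, hl⟩ := CreaseApprox.dom_subset x hx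
  have h1 := hm.2 w hw hwc
  have h2 := hK0 0
  have h3 := hK0 1
  have h4 := key l hl
  fin_cases l
  · simp only [Fin.zero_eta] at h4
    linarith
  · simp only [Fin.mk_one] at h4
    linarith [dist_triangle_right (w x) (w (z 0)) (w (z 1))]

end MeshSizeVanishes

/-! ### Extraction of a convergent subsequence -/

/-- Arzelà–Ascoli with varying domains: compactness of a countable product gives convergence on a
dense sequence, and local nonexpansiveness on a ball that is eventually in the domains spreads it to
all of `D`. -/
theorem exists_subseq_tendsto {D : Set Plane} {dom : ℕ → Set Plane}
    (hdom : ∀ x ∈ D, ∃ ρ > 0, Metric.ball x ρ ⊆ D ∧ ∀ᶠ m in atTop, Metric.ball x ρ ⊆ dom m)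
    {f : ℕ → Plane → Space3} (hf : ∀ m, LocNonexpansive (dom m) (f m)) {C : ℝ}
    (hb : ∀ᶠ m in atTop, ∀ x ∈ dom m, ‖f m x‖ ≤ C) :
    ∃ φ : ℕ → ℕ, StrictMono φ ∧ ∃ F : Plane → Space3,
      ∀ x ∈ D, Tendsto (fun m => f (φ m) x) atTop (𝓝 (F x)) := by
  classical
  set e := TopologicalSpace.denseSeq Plane with he
  have hed : DenseRange e := TopologicalSpace.denseRange_denseSeq Plane
  set C' := max C 0 with hC'
  -- Off its domain `f m` is uncontrolled, so large values are replaced by `0` to stay in a compact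
  -- set. At points of `D` the replacement is eventually inactive.
  set y : ℕ → ℕ → Space3 := fun m k => if ‖f m (e k)‖ ≤ C' then f m (e k) else 0 with hy
  have hyK : ∀ m, y m ∈ Set.pi Set.univ fun _ : ℕ => Metric.closedBall (0 : Space3) C' := by
    intro m k _
    rw [mem_closedBall_zero_iff]
    simp only [hy]
    split_ifs with h
    · exact h
    · rw [norm_zero]; exact le_max_right _ _
  obtain ⟨y₀, -, φ, hφ, hlim⟩ := (isCompact_univ_pi fun _ : ℕ =>
    isCompact_closedBall (0 : Space3) C').tendsto_subseq hyK
  have hconv : ∀ k, e k ∈ D → Tendsto (fun m => f (φ m) (e k)) atTop (𝓝 (y₀ k)) := by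
    intro k hk
    have h1 := (tendsto_pi_nhds.1 hlim) k
    refine h1.congr' ?_
    obtain ⟨ρ, hρ, -, hev⟩ := hdom _ hk
    filter_upwards [hφ.tendsto_atTop.eventually hev, hφ.tendsto_atTop.eventually hb] with m h2 h3
    simp only [Function.comp_apply, hy]
    rw [if_pos ((h3 _ (h2 (Metric.mem_ball_self hρ))).trans (le_max_left _ _))]
  refine ⟨φ, hφ, ?_⟩
  have hex : ∀ x, ∃ F, x ∈ D → Tendsto (fun m => f (φ m) x) atTop (𝓝 F) := by
    intro x
    by_cases hx : x ∈ D
    swap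
    · exact ⟨0, fun h => absurd h hx⟩
    suffices hcs : CauchySeq fun m => f (φ m) x by
      obtain ⟨F, hF⟩ := cauchySeq_tendsto_of_complete hcs
      exact ⟨F, fun _ => hF⟩
    obtain ⟨ρ, hρ, hρD, hev⟩ := hdom x hx
    rw [Metric.cauchySeq_iff']
    intro ε hε
    obtain ⟨k, hk⟩ := hed.exists_dist_lt x (show 0 < min ρ (ε / 4) by positivity)
    have hkρ : e k ∈ Metric.ball x ρ := by
      rw [Metric.mem_ball, dist_comm]; exact hk.trans_le (min_le_left _ _)
    have hkε : dist x (e k) < ε / 4 := hk.trans_le (min_le_right _ _)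
    obtain ⟨N₁, hN₁⟩ := Metric.cauchySeq_iff'.1 (hconv k (hρD hkρ)).cauchySeq (ε / 4) (by positivity)
    obtain ⟨N₂, hN₂⟩ := eventually_atTop.1 (hφ.tendsto_atTop.eventually hev)
    have hclose : ∀ m ≥ N₂, dist (f (φ m) x) (f (φ m) (e k)) < ε / 4 := fun m hm =>
      (hf _ x ρ (hN₂ m hm) x (Metric.mem_ball_self hρ) _ hkρ).trans_lt hkε
    refine ⟨max N₁ N₂, fun m hm => ?_⟩
    have a1 := hclose m ((le_max_right _ _).trans hm)
    have a2 := hclose (max N₁ N₂) (le_max_right _ _)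
    have a3 := hN₁ m ((le_max_left _ _).trans hm)
    have a4 := hN₁ (max N₁ N₂) (le_max_left _ _)
    have t1 := dist_triangle4 (f (φ m) x) (f (φ m) (e k)) (f (φ (max N₁ N₂)) (e k))
      (f (φ (max N₁ N₂)) x)
    have t2 := dist_triangle_right (f (φ m) (e k)) (f (φ (max N₁ N₂)) (e k)) (f (φ N₁) (e k))
    rw [dist_comm (f (φ (max N₁ N₂)) (e k)) (f (φ (max N₁ N₂)) x)] at t1
    linarith
  choose F hF using hex
  exact ⟨F, hF⟩

/-! ### Identification of the limit -/

theorem affineMap_eq_of_eventuallyEq {a a' : Space3} {c c' : Fin 2 → Space3} {x : Plane}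
    (h : affineMap a c =ᶠ[𝓝 x] affineMap a' c') : a = a' ∧ c = c' := by
  have hc : c = c' := by
    ext1 j
    have h1 := ((hasLineDerivAt_affineMap a c x j).congr_of_eventuallyEq h.symm).lineDeriv
    rw [(hasLineDerivAt_affineMap a' c' x j).lineDeriv] at h1
    exact h1.symm
  subst hc
  have := h.self_of_nhds
  simp only [affineMap] at this
  exact ⟨add_right_cancel this, rfl⟩

/-- A locally affine map on a connected open set is affine. -/
theorem exists_affineMap_of_locally {S : Set Plane} (hSc : IsConnected S)
    {F : Plane → Space3} {p : (Fin 2 → Space3) → Prop}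
    (h : ∀ x ∈ S, ∃ a c, p c ∧ F =ᶠ[𝓝 x] affineMap a c) :
    ∃ a c, p c ∧ ∀ x ∈ S, F x = affineMap a c x := by
  obtain ⟨x₁, hx₁⟩ := hSc.nonempty
  obtain ⟨a, c, hc, hF⟩ := h x₁ hx₁
  refine ⟨a, c, hc, ?_⟩
  set T : Set Plane := {x | F =ᶠ[𝓝 x] affineMap a c} with hT
  have hTo : IsOpen T := isOpen_setOfPred_eventually_nhds
  have hST : S ⊆ T := by
    refine hSc.isPreconnected.subset_of_closure_inter_subset hTo ⟨x₁, hx₁, hF⟩ ?_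
    rintro y ⟨hyT, hyS⟩
    obtain ⟨a', c', -, hF'⟩ := h y hyS
    obtain ⟨z, hz1, hz2⟩ := mem_closure_iff_nhds.1 hyT _ (eventually_eventually_nhds.2 hF')
    have hz1 : F =ᶠ[𝓝 z] affineMap a' c' := hz1
    have hz2 : F =ᶠ[𝓝 z] affineMap a c := hz2
    obtain ⟨rfl, rfl⟩ := affineMap_eq_of_eventuallyEq (hz1.symm.trans hz2)
    exact hF'
  intro x hx
  exact (hST hx : F =ᶠ[𝓝 x] affineMap a c).self_of_nhds

/-- For fixed `ε` the second term disappears as `m → ∞`; then `ε` is made small. Combined with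
Young's inequality this replaces the Cauchy–Schwarz inequality in the energy estimates. -/
theorem tendsto_zero_of_le_add_div {s E : ℕ → ℝ} {K : ℝ} (hs : ∀ m, 0 ≤ s m) (hK : 0 ≤ K)
    (hE : Tendsto E atTop (𝓝 0)) (h : ∀ ε > 0, ∀ m, s m ≤ ε * K + E m / ε) :
    Tendsto s atTop (𝓝 0) := by
  rw [Metric.tendsto_atTop']
  intro ε hε
  set ε' := ε / (2 * (K + 1)) with hε'
  have hε'0 : 0 < ε' := by positivity
  have h1 : ε' * K < ε / 2 := by
    rw [hε', div_mul_eq_mul_div, div_lt_div_iff₀ (by positivity) two_pos]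
    nlinarith
  obtain ⟨N, hN⟩ := eventually_atTop.1 (hE.eventually_lt_const (show 0 < ε' * (ε / 2) by positivity))
  refine ⟨N, fun m hm => ?_⟩
  rw [Real.dist_eq, sub_zero, abs_of_nonneg (hs m)]
  have h2 : E m / ε' < ε / 2 := by
    rw [div_lt_iff₀ hε'0, mul_comm]; exact hN m hm.le
  linarith [h ε' hε'0 m]

theorem le_add_sq_div {x y ε : ℝ} (hε : 0 < ε) : x * y ≤ ε * y ^ 2 + x ^ 2 / ε := by
  have : x * y * ε ≤ (ε * y ^ 2 + x ^ 2 / ε) * ε := by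
    rw [add_mul, div_mul_cancel₀ _ hε.ne']
    nlinarith [sq_nonneg (x - ε * y), sq_nonneg x, sq_nonneg (ε * y)]
  exact le_of_mul_le_mul_right this hε

namespace CreaseApprox

variable {P : CreasedPlate} {A : CreaseApprox P}

theorem memLp_weakHess {v : Plane → Space3} (hv : v ∈ A.V) (j k : Fin 2) :
    MemLp (weakHess A.dom v j k) 2 (volume.restrict A.dom) := (hv.1.2.2 j k).2

theorem integrable_sq_weakHess {v : Plane → Space3} (hv : v ∈ A.V) (j k : Fin 2) :
    Integrable (fun x => ‖weakHess A.dom v j k x‖ ^ 2) (volume.restrict A.dom) :=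
  (memLp_weakHess hv j k).norm.integrable_sq

theorem integral_sq_weakHess_le {v : Plane → Space3} (hv : v ∈ A.V) (j k : Fin 2) :
    ∫ x in A.dom, ‖weakHess A.dom v j k x‖ ^ 2 ≤ 2 * A.I v := by
  rw [I, bendingEnergy, ← mul_assoc, show (2 : ℝ) * (1 / 2) = 1 by norm_num, one_mul]
  refine integral_mono (integrable_sq_weakHess hv j k)
    (integrable_finsetSum _ fun j _ => integrable_finsetSum _ fun k _ =>
      integrable_sq_weakHess hv j k) fun x => ?_
  refine le_trans ?_ (Finset.single_le_sum (f := fun j => ∑ k : Fin 2, ‖weakHess A.dom v j k x‖ ^ 2)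
    (fun _ _ => Finset.sum_nonneg fun _ _ => by positivity) (Finset.mem_univ j))
  exact Finset.single_le_sum (f := fun k => ‖weakHess A.dom v j k x‖ ^ 2)
    (fun _ _ => by positivity) (Finset.mem_univ k)

theorem tendsto_integral_weakHess {A : ℕ → CreaseApprox P} {u : ℕ → Plane → Space3}
    (hu : ∀ m, u m ∈ (A m).V) (hI : Tendsto (fun m => (A m).I (u m)) atTop (𝓝 0)) {x : Plane} {ρ : ℝ}
    (hball : ∀ m, Metric.ball x ρ ⊆ (A m).dom) (j k : Fin 2) :
    (∀ m, IntegrableOn (weakHess (A m).dom (u m) j k) (Metric.ball x ρ)) ∧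
    Tendsto (fun m => ∫ y in Metric.ball x ρ, ‖weakHess (A m).dom (u m) j k y‖) atTop (𝓝 0) := by
  have hfin : IsFiniteMeasure (volume.restrict (Metric.ball x ρ)) := ⟨by
    simpa using (measure_ball_lt_top : volume (Metric.ball x ρ) < ⊤)⟩
  have hle : ∀ m, volume.restrict (Metric.ball x ρ) ≤ volume.restrict (A m).dom :=
    fun m => Measure.restrict_mono (hball m) le_rfl
  have hint : ∀ m, IntegrableOn (weakHess (A m).dom (u m) j k) (Metric.ball x ρ) := fun m =>
    ((memLp_weakHess (hu m) j k).mono_measure (hle m)).integrable one_le_two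
  refine ⟨hint, tendsto_zero_of_le_add_div (E := fun m => 2 * (A m).I (u m))
    (K := ∫ _ in Metric.ball x ρ, (1 : ℝ)) (fun m => integral_nonneg fun _ => norm_nonneg _)
    (integral_nonneg fun _ => zero_le_one) (by simpa using hI.const_mul 2) fun ε hε m => ?_⟩
  have hsq := integrable_sq_weakHess (hu m) j k
  have hsqB := hsq.mono_measure (hle m)
  calc ∫ y in Metric.ball x ρ, ‖weakHess (A m).dom (u m) j k y‖
      ≤ ∫ y in Metric.ball x ρ, (ε * 1 + ‖weakHess (A m).dom (u m) j k y‖ ^ 2 / ε) := by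
        refine integral_mono (hint m).norm ((integrable_const _).add (hsqB.div_const _)) fun y => ?_
        have := le_add_sq_div (x := ‖weakHess (A m).dom (u m) j k y‖) (y := 1) hε
        simpa using this
    _ = ε * (∫ _ in Metric.ball x ρ, (1 : ℝ)) +
          (∫ y in Metric.ball x ρ, ‖weakHess (A m).dom (u m) j k y‖ ^ 2) / ε := by
        rw [integral_add (integrable_const _) (hsqB.div_const _), integral_const_mul, integral_div]
    _ ≤ _ := by
        gcongr
        exact (integral_mono_measure (hle m) (Eventually.of_forall fun _ => by positivity) hsq).trans
          (integral_sq_weakHess_le (hu m) j k)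

end CreaseApprox

/-- Along a subsequence, almost-minimizers converge pointwise, up to constants, to a continuous
piecewise affine isometry. -/
theorem exists_piecewise_affine_limit {P : CreasedPlate} {A : ℕ → CreaseApprox P}
    (hreg : ShapeRegular A) (hmesh : MeshSizeVanishes A) {u w : ℕ → Plane → Space3}
    (hu : ∀ m, u m ∈ (A m).V) (hI : Tendsto (fun m => (A m).I (u m)) atTop (𝓝 0))
    (hwu : ∀ m, w m =ᵐ[volume.restrict (A m).dom] u m)
    (hwc : ∀ m, ContinuousOn (w m) ((A m).dom ∪ Set.range (A m).vertex))
    (hw : ∀ m, LocNonexpansive (A m).dom (w m)) :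
    ∃ φ : ℕ → ℕ, StrictMono φ ∧ ∃ x₀ ∈ P.ω \ P.γ, ∃ (C : ℝ) (a : Fin 2 → Space3)
      (c : Fin 2 → Fin 2 → Space3),
      (∀ l j k, inner ℝ (c l j) (c l k) = if j = k then (1 : ℝ) else 0) ∧
      (∀ p ∈ P.γ, p ∈ P.ω → affineMap (a 0) (c 0) p = affineMap (a 1) (c 1) p) ∧
      (∀ᶠ m in atTop, ∀ x ∈ (A m).dom, dist (w m x) (w m x₀) ≤ C) ∧
      ∀ l, ∀ x ∈ P.sub l, Tendsto (fun k => w (φ k) x - w (φ k) x₀) atTop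
        (𝓝 (affineMap (a l) (c l) x)) := by
  obtain ⟨κ, hκ, hreg⟩ := hreg
  obtain ⟨C, x₀, hx₀, hbound⟩ := hmesh.exists_bound hκ hreg
  have hC : ∀ᶠ m in atTop, ∀ x ∈ (A m).dom, dist (w m x) (w m x₀) ≤ C :=
    hbound.mono fun m hm => hm _ (hw m) (hwc m)
  set f : ℕ → Plane → Space3 := fun m x => w m x - w m x₀ with hf
  obtain ⟨φ, hφ, F, hF⟩ := exists_subseq_tendsto (D := P.ω \ P.γ) (dom := fun m => (A m).dom)
    (fun x hx => hmesh.exists_ball_subset_dom hx) (f := f) (C := C)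
    (fun m x r hb y hy z hz => by
      simp only [hf]; rw [dist_sub_right]; exact hw m x r hb y hy z hz)
    (hC.mono fun m hm x hx => by
      simp only [hf]; rw [← dist_eq_norm]; exact hm x hx)
  have hloc : ∀ x ∈ P.ω \ P.γ, ∃ a c, (∀ j k, inner ℝ (c j) (c k) = if j = k then (1 : ℝ) else 0) ∧
      F =ᶠ[𝓝 x] affineMap a c := by
    intro x hx
    obtain ⟨ρ, hρ, hρD, hev⟩ := hmesh.exists_ball_subset_dom hx
    obtain ⟨N, hN⟩ := eventually_atTop.1 (hφ.tendsto_atTop.eventually (hev.and hC))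
    -- The initial terms are dropped so that the ball lies in the domain and the bound holds for
    -- every index.
    set θ : ℕ → ℕ := fun m => φ (m + N) with hθ
    have hθt : Tendsto θ atTop atTop := hφ.tendsto_atTop.comp (tendsto_add_atTop_nat N)
    have hball : ∀ m, Metric.ball x ρ ⊆ (A (θ m)).dom := fun m => (hN _ (Nat.le_add_left N m)).1
    have hFθ : ∀ y ∈ Metric.ball x ρ, Tendsto (fun m => f (θ m) y) atTop (𝓝 (F y)) := fun y hy =>
      (hF y (hρD hy)).comp (tendsto_add_atTop_nat N)
    have hae : ∀ m, ∀ᵐ y ∂volume.restrict (Metric.ball x ρ), u (θ m) y = w (θ m) y := fun m => by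
      have h : w (θ m) =ᵐ[volume.restrict (Metric.ball x ρ)] u (θ m) :=
        ae_mono (Measure.restrict_mono (hball m) le_rfl) (hwu (θ m))
      exact h.mono fun y hy => hy.symm
    have hhess := CreaseApprox.tendsto_integral_weakHess (A := fun m => A (θ m))
      (u := fun m => u (θ m)) (fun m => hu (θ m)) (hI.comp hθt) hball
    obtain ⟨c, hc, hcF⟩ := exists_isometric_affine_limit hρ
      (v := fun m y => u (θ m) y - w (θ m) x₀) (g := fun m j => weakPartial (A (θ m)).dom j (u (θ m)))
      (h := fun m j k => weakHess (A (θ m)).dom (u (θ m)) j k) (F := F) (C := C)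
      (fun m j => by
        have h1 := ((hu (θ m)).1.2.1 j).1.isWeakPartial.mono (hball m)
        simpa using h1.sub (isWeakPartial_const Metric.isOpen_ball (w (θ m) x₀) j))
      (fun m j k => ((hu (θ m)).1.2.2 j k).1.isWeakPartial.mono (hball m))
      (fun m => ae_mono (Measure.restrict_mono (hball m) le_rfl) (hu (θ m)).2.1)
      (fun m => by
        filter_upwards [hae m, ae_restrict_mem measurableSet_ball] with y hy hyb
        rw [hy, ← dist_eq_norm]
        exact (hN _ (Nat.le_add_left N m)).2 y (hball m hyb))
      (by
        filter_upwards [ae_all_iff.2 hae, ae_restrict_mem measurableSet_ball] with y hy hyb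
        simp only [hy]
        exact hFθ y hyb)
      (by
        refine LipschitzOnWith.continuousOn (K := 1) (LipschitzOnWith.of_dist_le_mul
          fun y hy z hz => ?_)
        rw [NNReal.coe_one, one_mul]
        refine le_of_tendsto ((hFθ y hy).dist (hFθ z hz)) (Eventually.of_forall fun m => ?_)
        simp only [hf]; rw [dist_sub_right]
        exact hw _ x ρ (hball m) y hy z hz)
      (fun m j k => (hhess j k).1 m) (fun j k => (hhess j k).2)
    refine ⟨F x - (x 0 • c 0 + x 1 • c 1), c, hc, ?_⟩
    filter_upwards [Metric.ball_mem_nhds x hρ] with y hy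
    rw [hcF y hy]
    simp only [affineMap, PiLp.sub_apply]
    module
  have hsub : ∀ l, ∃ a c, (∀ j k, inner ℝ (c j) (c k) = if j = k then (1 : ℝ) else 0) ∧
      ∀ x ∈ P.sub l, F x = affineMap a c x := fun l =>
    exists_affineMap_of_locally (P.sub_lipschitz l).2.1
      fun x hx => hloc x (P.sub_subset l hx)
  choose a c hc hcF using hsub
  refine ⟨φ, hφ, x₀, hx₀, C, a, c, hc, ?_, hC, fun l x hx => ?_⟩
  swap
  · rw [← hcF l x hx]; exact hF x (P.sub_subset l hx)
  have hiso : ∀ l, Isometry (affineMap (a l) (c l)) := fun l => isometry_affineMap _ (hc l)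
  set Λ := 2 * (2100 + 2400 / κ ^ 2) with hΛ
  have hΛ0 : 0 ≤ Λ := by positivity
  -- Letting `r → 0`: the reference points converge to `p`, while the link bounds the difference of
  -- the limit values there by `Λ * r`.
  have hregular : ∀ p ∈ P.γ, p ∈ P.ω → (∃ e n s₀, ∃ r₀ > 0, ∀ r, 0 < r → r < r₀ →
      ∃ η, LocalGraph P p e n s₀ η r) → affineMap (a 0) (c 0) p = affineMap (a 1) (c 1) p := by
    rintro p hp hpω ⟨e, n, s₀, r₀, hr₀, hG⟩
    have hle : ∀ r, 0 < r → r < r₀ →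
        dist (affineMap (a 0) (c 0) p) (affineMap (a 1) (c 1) p) ≤ (2 + Λ) * r := by
      intro r hr hrr
      obtain ⟨η, G⟩ := hG r hr hrr
      obtain ⟨z, hz, hlink⟩ := hmesh.exists_link hκ hreg G hp hpω
      have h1 : dist (F (z 0)) (F (z 1)) ≤ Λ * r := by
        refine le_of_tendsto ((hF _ (P.sub_subset 0 (hz 0).1)).dist (hF _ (P.sub_subset 1 (hz 1).1))) ?_
        filter_upwards [hφ.tendsto_atTop.eventually hlink] with m hm
        simp only [hf]; rw [dist_sub_right, hΛ, mul_assoc]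
        exact hm.2 _ (hw _) (hwc _)
      rw [hcF 0 _ (hz 0).1, hcF 1 _ (hz 1).1] at h1
      have h2 := dist_triangle4 (affineMap (a 0) (c 0) p) (affineMap (a 0) (c 0) (z 0))
        (affineMap (a 1) (c 1) (z 1)) (affineMap (a 1) (c 1) p)
      rw [(hiso 0).dist_eq, (hiso 1).dist_eq, dist_comm p] at h2
      linarith [(hz 0).2, (hz 1).2]
    refine dist_le_zero.1 (le_of_forall_pos_le_add fun ε hε => ?_)
    rw [zero_add]
    have hr1 : 0 < min (r₀ / 2) (ε / (2 + Λ)) := by positivity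
    refine (hle _ hr1 ((min_le_left _ _).trans_lt (by linarith))).trans ?_
    calc (2 + Λ) * min (r₀ / 2) (ε / (2 + Λ)) ≤ (2 + Λ) * (ε / (2 + Λ)) := by
          gcongr; exact min_le_right _ _
      _ = ε := mul_div_cancel₀ _ (by positivity)
  -- Regular points are dense in the crease and both affine maps are continuous, so agreement
  -- extends to corners and endpoints inside `ω`.
  intro p hp hpω
  refine dist_le_zero.1 (le_of_forall_pos_le_add fun ε hε => ?_)
  obtain ⟨p', hp', hpω', hd, hG⟩ := P.exists_regular_near hp hpω (show 0 < ε / 2 by positivity)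
  have h1 := hregular p' hp' hpω' hG
  have h2 := dist_triangle (affineMap (a 0) (c 0) p) (affineMap (a 0) (c 0) p')
    (affineMap (a 1) (c 1) p)
  rw [(hiso 0).dist_eq, h1, (hiso 1).dist_eq, dist_comm p'] at h2
  linarith

/-! ### Convergence to the piecewise affine limit -/

/-- Dominated convergence: the bounded plate has finite area, `γ` is null, and the constant `2 * C`
dominates, also where the extension by zero is used. -/
theorem tendstoL2_of_tendsto {P : CreasedPlate} {A : ℕ → CreaseApprox P} {v w : ℕ → Plane → Space3}
    {u₀ : Plane → Space3} {C : ℝ}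
    (hdom : ∀ x ∈ P.ω \ P.γ, ∀ᶠ k in atTop, x ∈ (A k).dom)
    (hv : ∀ k, AEStronglyMeasurable (v k) (volume.restrict (A k).dom)) (hu₀ : Measurable u₀)
    (hwv : ∀ k, w k =ᵐ[volume.restrict (A k).dom] v k)
    (hC : ∀ᶠ k in atTop, ∀ x ∈ (A k).dom, ‖w k x‖ ≤ C)
    (hlim : ∀ x ∈ P.ω \ P.γ, Tendsto (fun k => w k x) atTop (𝓝 (u₀ x))) :
    TendstoL2 A v u₀ := by
  have hmeas : ∀ k, MeasurableSet (A k).dom := fun k => (A k).isOpen_dom.measurableSet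
  have hfin : IsFiniteMeasure (volume.restrict P.ω) := ⟨by
    simpa using P.isBounded_ω.measure_lt_top⟩
  have hγ : ∀ᵐ x ∂volume.restrict P.ω, x ∈ P.ω \ P.γ := by
    filter_upwards [ae_restrict_of_ae P.ae_notMem_γ, ae_restrict_mem P.ω_open.measurableSet]
      with x h1 h2 using ⟨h2, h1⟩
  have hwv' : ∀ᵐ x ∂volume.restrict P.ω, ∀ k, x ∈ (A k).dom → w k x = v k x :=
    ae_all_iff.2 fun k => ae_restrict_of_ae ((ae_restrict_iff' (hmeas k)).1 (hwv k))
  have hbound : ∀ x ∈ P.ω \ P.γ, ‖u₀ x‖ ≤ C := fun x hx =>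
    le_of_tendsto (hlim x hx).norm ((hC.and (hdom x hx)).mono fun k hk => hk.1 x hk.2)
  have hint : Tendsto (fun k => ∫⁻ x in P.ω,
      ‖(A k).dom.indicator (v k) x - u₀ x‖ₑ ^ (2 : ℝ)) atTop (𝓝 0) := by
    have h0 : ∫⁻ _ in P.ω, (0 : ENNReal) = 0 := lintegral_zero
    rw [← h0]
    refine tendsto_lintegral_filter_of_dominated_convergence'
      (fun _ => ENNReal.ofReal (2 * C) ^ (2 : ℝ)) ?_ ?_ ?_ ?_
    · refine Eventually.of_forall fun k => AEMeasurable.pow_const (AEStronglyMeasurable.enorm ?_) _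
      refine AEStronglyMeasurable.sub ?_ hu₀.aestronglyMeasurable
      exact ((aestronglyMeasurable_indicator_iff (hmeas k)).2 (hv k)).restrict
    · filter_upwards [hC] with k hk
      filter_upwards [hγ, hwv'] with x hx hxw
      refine ENNReal.rpow_le_rpow ?_ zero_le_two
      rw [← ofReal_norm]
      refine ENNReal.ofReal_le_ofReal ((norm_sub_le _ _).trans ?_)
      have h2 := hbound x hx
      rw [two_mul]
      refine add_le_add ?_ h2
      by_cases hd : x ∈ (A k).dom
      · rw [Set.indicator_of_mem hd, ← hxw k hd]; exact hk x hd
      · rw [Set.indicator_of_notMem hd, norm_zero]; exact (norm_nonneg _).trans h2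
    · rw [lintegral_const]
      exact ENNReal.mul_ne_top
        (ENNReal.rpow_ne_top_of_nonneg zero_le_two ENNReal.ofReal_ne_top) (measure_ne_top _ _)
    · filter_upwards [hγ, hwv'] with x hx hxw
      have h1 : Tendsto (fun k => (A k).dom.indicator (v k) x - u₀ x) atTop (𝓝 0) := by
        rw [← sub_self (u₀ x)]
        refine ((hlim x hx).congr' ?_).sub_const _
        filter_upwards [hdom x hx] with k hk
        rw [Set.indicator_of_mem hk, hxw k hk]
      have h2 := (ENNReal.continuous_rpow_const (y := (2 : ℝ))).tendsto 0 |>.comp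
        (by simpa using h1.enorm)
      simpa [Function.comp_def] using h2
  have h3 := (ENNReal.continuous_rpow_const (y := (1 / 2 : ℝ))).tendsto 0 |>.comp hint
  rw [ENNReal.zero_rpow_of_pos (by norm_num)] at h3
  refine h3.congr fun k => ?_
  rw [eLpNorm_eq_lintegral_rpow_enorm_toReal two_ne_zero ENNReal.ofNat_ne_top]
  simp

/-- The limit Hessian is zero and the energies vanish, so the convergence is in fact strong. By
Young's inequality each pairing is at most `ε` times the squared norm of `G` plus twice the energy
over `ε`. -/
theorem hessTendstoWeakly_of_tendsto {P : CreasedPlate} {A : ℕ → CreaseApprox P}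
    {v : ℕ → Plane → Space3} {u₀ : Plane → Space3} (hv : ∀ k, v k ∈ (A k).V)
    (hI : Tendsto (fun k => (A k).I (v k)) atTop (𝓝 0))
    (hu₀ : ∀ j k, weakHess (P.ω \ P.γ) u₀ j k =ᵐ[volume.restrict (P.ω \ P.γ)] 0) :
    HessTendstoWeakly A v u₀ := by
  intro G hG
  have hzero : ∫ x in P.ω, ∑ i : Fin 2, ∑ j : Fin 2,
      inner ℝ (weakHess (P.ω \ P.γ) u₀ i j x) (G i j x) = 0 := by
    have h1 : ∀ᵐ x ∂volume.restrict P.ω, ∀ i j, weakHess (P.ω \ P.γ) u₀ i j x = 0 := by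
      refine ae_all_iff.2 fun i => ae_all_iff.2 fun j => ?_
      have h2 := (ae_restrict_iff' P.isOpen_compl_γ.measurableSet).1 (hu₀ i j)
      filter_upwards [ae_restrict_of_ae h2, ae_restrict_of_ae P.ae_notMem_γ,
        ae_restrict_mem P.ω_open.measurableSet] with x h3 h4 h5 using h3 ⟨h5, h4⟩
    rw [integral_congr_ae (g := fun _ => (0 : ℝ)) (h1.mono fun x hx => by simp [hx]), integral_zero]
  rw [hzero, tendsto_zero_iff_norm_tendsto_zero]
  have hG2 : Integrable (fun x => ∑ i : Fin 2, ∑ j : Fin 2, ‖G i j x‖ ^ 2) (volume.restrict P.ω) :=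
    integrable_finsetSum _ fun i _ => integrable_finsetSum _ fun j _ =>
      (hG i j).norm.integrable_sq
  refine tendsto_zero_of_le_add_div (E := fun k => 2 * (A k).I (v k))
    (K := ∫ x in P.ω, ∑ i : Fin 2, ∑ j : Fin 2, ‖G i j x‖ ^ 2) (fun _ => norm_nonneg _)
    (integral_nonneg fun x => by positivity) (by simpa using hI.const_mul 2) fun ε hε k => ?_
  have hmeas : MeasurableSet (A k).dom := (A k).isOpen_dom.measurableSet
  have hH : Integrable (fun x => ∑ i : Fin 2, ∑ j : Fin 2, ‖weakHess (A k).dom (v k) i j x‖ ^ 2)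
      (volume.restrict (A k).dom) :=
    integrable_finsetSum _ fun i _ => integrable_finsetSum _ fun j _ =>
      CreaseApprox.integrable_sq_weakHess (hv k) i j
  set H : Plane → ℝ := (A k).dom.indicator fun x =>
    ∑ i : Fin 2, ∑ j : Fin 2, ‖weakHess (A k).dom (v k) i j x‖ ^ 2 with hHdef
  have hHint : Integrable H (volume.restrict P.ω) :=
    ((integrable_indicator_iff hmeas).2 hH).restrict
  have hHval : ∫ x in P.ω, H x = 2 * (A k).I (v k) := by
    rw [hHdef, setIntegral_indicator hmeas, CreaseApprox.I, bendingEnergy,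
      Set.inter_eq_right.2 (show (A k).dom ⊆ P.ω from Set.sdiff_subset)]
    ring
  rw [← hHval, ← integral_const_mul, ← integral_div,
    ← integral_add (hG2.const_mul ε) (hHint.div_const ε)]
  refine norm_integral_le_of_norm_le ((hG2.const_mul ε).add (hHint.div_const ε))
    (Eventually.of_forall fun x => ?_)
  have hterm : ∀ i j, ‖inner ℝ ((A k).dom.indicator (weakHess (A k).dom (v k) i j) x) (G i j x)‖ ≤
      ε * ‖G i j x‖ ^ 2 + ‖(A k).dom.indicator (weakHess (A k).dom (v k) i j) x‖ ^ 2 / ε :=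
    fun i j => (norm_inner_le_norm _ _).trans (le_add_sq_div hε)
  have hHx : H x = ∑ i : Fin 2, ∑ j : Fin 2,
      ‖(A k).dom.indicator (weakHess (A k).dom (v k) i j) x‖ ^ 2 := by
    by_cases hx : x ∈ (A k).dom
    · simp only [hHdef, Set.indicator_of_mem hx]
    · simp [hHdef, Set.indicator_of_notMem hx]
  calc _ ≤ ∑ i : Fin 2, ∑ j : Fin 2, (ε * ‖G i j x‖ ^ 2 +
        ‖(A k).dom.indicator (weakHess (A k).dom (v k) i j) x‖ ^ 2 / ε) :=
        (norm_sum_le _ _).trans (Finset.sum_le_sum fun i _ =>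
          (norm_sum_le _ _).trans (Finset.sum_le_sum fun j _ => hterm i j))
    _ = _ := by
        rw [hHx]
        simp only [Finset.sum_add_distrib, Finset.mul_sum, Finset.sum_div]

/-- A sequence with vanishing energy that converges pointwise to a continuous piecewise affine
isometry converges to a minimizer. -/
theorem exists_minimizer_of_tendsto {P : CreasedPlate} {A : ℕ → CreaseApprox P}
    {u w : ℕ → Plane → Space3} (b : ℕ → Space3) {C : ℝ} {a : Fin 2 → Space3}
    {c : Fin 2 → Fin 2 → Space3}
    (hdom : ∀ x ∈ P.ω \ P.γ, ∀ᶠ k in atTop, x ∈ (A k).dom)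
    (hu : ∀ k, u k ∈ (A k).V) (hI : Tendsto (fun k => (A k).I (u k)) atTop (𝓝 0))
    (hwu : ∀ k, w k =ᵐ[volume.restrict (A k).dom] u k)
    (hc : ∀ l j k, inner ℝ (c l j) (c l k) = if j = k then (1 : ℝ) else 0)
    (hγ : ∀ p ∈ P.γ, p ∈ P.ω → affineMap (a 0) (c 0) p = affineMap (a 1) (c 1) p)
    (hC : ∀ᶠ k in atTop, ∀ x ∈ (A k).dom, ‖w k x - b k‖ ≤ C)
    (hlim : ∀ l, ∀ x ∈ P.sub l, Tendsto (fun k => w k x - b k) atTop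
      (𝓝 (affineMap (a l) (c l) x))) :
    ∃ u₀ ∈ P.V, (∀ v ∈ P.V, P.I u₀ ≤ P.I v) ∧ TendstoL2 A (fun k x => u k x - b k) u₀ ∧
      HessTendstoWeakly A u u₀ := by
  obtain ⟨hV, hhess⟩ := P.glue_mem_V a hc hγ
  refine ⟨_, hV, fun v _ => ?_, ?_, hessTendstoWeakly_of_tendsto hu hI hhess⟩
  · exact (bendingEnergy_eq_zero hhess).trans_le (bendingEnergy_nonneg _ _)
  · refine tendstoL2_of_tendsto (w := fun k x => w k x - b k) hdom
      (fun k => (hu k).1.1.aestronglyMeasurable.sub aestronglyMeasurable_const)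
      (P.measurable_glue fun l => (isometry_affineMap _ (hc l)).continuous.measurable)
      (fun k => (hwu k).mono fun x hx => by simp only [hx]) hC fun x hx => ?_
    obtain ⟨l, hl⟩ := P.mem_sub_of_mem hx.1 hx.2
    rw [P.glue_eq (fun l => affineMap (a l) (c l)) hl]
    exact hlim l x hl

/-! ### Bounded sequences and conclusion -/

/-- The triangle inequality in `L²` bounds the norm of the constant function `a`, which is `‖a‖`
times a positive power of the total mass. -/
theorem exists_norm_le_of_eLpNorm_le {α E : Type*} [MeasurableSpace α] [NormedAddCommGroup E]
    {ν : Measure α} [IsFiniteMeasure ν] (hν : ν ≠ 0) (K : NNReal) (C : ℝ) :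
    ∃ R : ℝ, ∀ (f : α → E) (a : E), AEStronglyMeasurable f ν → eLpNorm f 2 ν ≤ K →
      (∀ᵐ x ∂ν, ‖f x - a‖ ≤ C) → ‖a‖ ≤ R := by
  set C' := eLpNorm (fun _ : α => C) 2 ν with hC'
  have hC't : C' ≠ ⊤ := (memLp_const C).eLpNorm_ne_top
  set V := ν Set.univ ^ (1 / (2 : ENNReal).toReal) with hV
  have hν0 : ν Set.univ ≠ 0 := by simpa using hν
  have hV0 : V ≠ 0 := by
    rw [hV]; simp [hν0]
  refine ⟨((K + C') / V).toReal, fun f a hf hfK hfa => ?_⟩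
  have h1 : eLpNorm (fun _ : α => a) 2 ν ≤ K + C' := by
    have h2 : (fun _ : α => a) = f - fun x => f x - a := by ext x; simp
    rw [h2]
    refine (eLpNorm_sub_le hf (hf.sub aestronglyMeasurable_const) one_le_two).trans
      (add_le_add hfK (eLpNorm_mono_ae (hfa.mono fun x hx => ?_)))
    exact hx.trans (Real.le_norm_self _)
  rw [eLpNorm_const a two_ne_zero hν, ← hV] at h1
  have hVt : V ≠ ⊤ := by rw [hV]; exact ENNReal.rpow_ne_top_of_nonneg (by positivity) (measure_ne_top _ _)
  have h3 : ‖a‖ₑ ≤ (K + C') / V := (ENNReal.le_div_iff_mul_le (Or.inl hV0) (Or.inl hVt)).2 h1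
  have h4 := ENNReal.toReal_mono (ENNReal.div_ne_top (by simp [hC't]) hV0) h3
  simpa using h4

end

theorem mainTheorem3 (P : CreasedPlate) (A : ℕ → CreaseApprox P)
    (hreg : ShapeRegular A) (hmesh : MeshSizeVanishes A)
    (δ : ℕ → ℝ) (hδ_pos : ∀ m, 0 < δ m) (hδ : Tendsto δ atTop (𝓝 0))
    (u : ℕ → Plane → Space3) (hu : ∀ m, u m ∈ (A m).V)
    (hmin : ∀ m, ∀ v ∈ (A m).V, (A m).I (u m) ≤ (A m).I v + δ m) :
    (∃ φ : ℕ → ℕ, StrictMono φ ∧ ∃ a : ℕ → Space3,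
      ∃ u₀ ∈ P.V, (∀ v ∈ P.V, P.I u₀ ≤ P.I v) ∧
        TendstoL2 (fun k => A (φ k)) (fun k x => u (φ k) x - a k) u₀ ∧
        HessTendstoWeakly (fun k => A (φ k)) (fun k => u (φ k)) u₀) ∧
    ((∃ C : NNReal, ∀ m, eLpNorm ((A m).dom.indicator (u m)) 2 (volume.restrict P.ω) ≤ C) →
      ∃ φ : ℕ → ℕ, StrictMono φ ∧
        ∃ u₀ ∈ P.V, (∀ v ∈ P.V, P.I u₀ ≤ P.I v) ∧
          TendstoL2 (fun k => A (φ k)) (fun k => u (φ k)) u₀ ∧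
          HessTendstoWeakly (fun k => A (φ k)) (fun k => u (φ k)) u₀) := by
  choose w hwu hwc hw using fun m => CreaseApprox.exists_rep (hu m)
  -- The infimum of each approximating energy is zero, so almost-minimality bounds the energy by `δ
  -- m`.
  have hI : Tendsto (fun m => (A m).I (u m)) atTop (𝓝 0) := by
    refine squeeze_zero (fun m => bendingEnergy_nonneg _ _) (fun m => ?_) hδ
    obtain ⟨v, hv, hv0⟩ := (A m).exists_mem_V_I_eq_zero
    simpa [hv0] using hmin m v hv
  have hdom : ∀ x ∈ P.ω \ P.γ, ∀ᶠ m in atTop, x ∈ (A m).dom := fun x hx => by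
    obtain ⟨ρ, hρ, -, hev⟩ := hmesh.exists_ball_subset_dom hx
    exact hev.mono fun m hm => hm (Metric.mem_ball_self hρ)
  obtain ⟨φ, hφ, x₀, hx₀, C, a, c, hc, hγ, hC, hlim⟩ :=
    exists_piecewise_affine_limit hreg hmesh hu hI hwu hwc hw
  simp only [dist_eq_norm] at hC
  refine ⟨⟨φ, hφ, fun k => w (φ k) x₀, ?_⟩, ?_⟩
  · exact exists_minimizer_of_tendsto (A := fun k => A (φ k)) (u := fun k => u (φ k))
      (w := fun k => w (φ k)) (fun k => w (φ k) x₀)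
      (fun x hx => hφ.tendsto_atTop.eventually (hdom x hx)) (fun k => hu _)
      (hI.comp hφ.tendsto_atTop) (fun k => hwu _) hc hγ
      (hφ.tendsto_atTop.eventually hC) hlim
  rintro ⟨K, hK⟩
  obtain ⟨ρ, hρ, -, hev⟩ := hmesh.exists_ball_subset_dom hx₀
  have hfin : IsFiniteMeasure (volume.restrict (Metric.ball x₀ ρ)) := ⟨by
    simpa using (measure_ball_lt_top : volume (Metric.ball x₀ ρ) < ⊤)⟩
  have hν : volume.restrict (Metric.ball x₀ ρ) ≠ 0 := by
    rw [Ne, Measure.restrict_eq_zero]; exact (Metric.measure_ball_pos volume x₀ hρ).ne'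
  -- On a fixed ball around `x₀` the maps are `L²`-bounded and differ from `w m x₀` by at most `C`,
  -- so these values are bounded.
  obtain ⟨R, hR⟩ := exists_norm_le_of_eLpNorm_le (E := Space3) hν K C
  have hbdd : ∀ᶠ m in atTop, w m x₀ ∈ Metric.closedBall (0 : Space3) R := by
    filter_upwards [hev, hC] with m hm hCm
    have hle : volume.restrict (Metric.ball x₀ ρ) ≤ volume.restrict (A m).dom :=
      Measure.restrict_mono hm le_rfl
    rw [mem_closedBall_zero_iff]
    refine hR (u m) _ ((hu m).1.1.aestronglyMeasurable.mono_measure hle) ?_ ?_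
    · refine le_trans ?_ (hK m)
      rw [eLpNorm_indicator_eq_eLpNorm_restrict (A m).isOpen_dom.measurableSet,
        Measure.restrict_restrict (A m).isOpen_dom.measurableSet,
        Set.inter_eq_left.2 (show (A m).dom ⊆ P.ω from Set.sdiff_subset)]
      exact eLpNorm_mono_measure _ hle
    · have h1 : w m =ᵐ[volume.restrict (Metric.ball x₀ ρ)] u m := ae_mono hle (hwu m)
      filter_upwards [h1, ae_restrict_mem measurableSet_ball] with x hx hxb
      rw [← hx]; exact hCm x (hm hxb)
  -- Along a further subsequence the subtracted values converge to `a'`; adding `a'` to both affine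
  -- pieces preserves their agreement on the crease and makes any subtraction unnecessary.
  obtain ⟨a', -, ψ, hψ, hψa⟩ := tendsto_subseq_of_frequently_bounded
    (x := fun k => w (φ k) x₀) Metric.isBounded_closedBall
    (hφ.tendsto_atTop.eventually hbdd).frequently
  have hφψ : Tendsto (φ ∘ ψ) atTop atTop := (hφ.comp hψ).tendsto_atTop
  have hshift : ∀ l x, affineMap (a l + a') (c l) x = affineMap (a l) (c l) x + a' := fun l x => by
    simp only [affineMap]; abel
  have hbound : ∀ᶠ m in atTop, ∀ x ∈ (A m).dom, ‖w m x - 0‖ ≤ C + R :=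
    (hC.and hbdd).mono fun m hm x hx => by
      have h1 := hm.1 x hx
      have h2 := mem_closedBall_zero_iff.1 hm.2
      rw [sub_zero]
      calc ‖w m x‖ = ‖(w m x - w m x₀) + w m x₀‖ := by rw [sub_add_cancel]
        _ ≤ C + R := (norm_add_le _ _).trans (add_le_add h1 h2)
  refine ⟨φ ∘ ψ, hφ.comp hψ, ?_⟩
  have key := exists_minimizer_of_tendsto (A := fun k => A ((φ ∘ ψ) k)) (u := fun k => u ((φ ∘ ψ) k))
    (w := fun k => w ((φ ∘ ψ) k)) (fun _ => 0) (C := C + R) (a := fun l => a l + a') (c := c)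
    (fun x hx => hφψ.eventually (hdom x hx)) (fun k => hu _) (hI.comp hφψ) (fun k => hwu _) hc
    (fun p hp hpω => by rw [hshift, hshift, hγ p hp hpω])
    (hφψ.eventually hbound)
    (fun l x hx => by
      rw [hshift]
      simpa using ((hlim l x hx).comp hψ.tendsto_atTop).add hψa)
  simpa only [sub_zero] using key
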